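/- Let $F$ be the bowtie, i.e. the graph on five vertices consisting of two triangles that share exactly one vertex. All graphs are finite and simple. Let $\mathrm{ex}(n,F)$ be the maximum number of edges in an $F$-free graph on $n$ vertices; an $F$-free graph on $n$ vertices with $\mathrm{ex}(n,F)$ edges is called a maximum $F$-free graph. For integers $n,q\ge 0$ let $h_F(n,q)$ be the minimum number of subgraphs isomorphic to $F$ in a graph with $n$ vertices and $\mathrm{ex}(n,F)+q$ edges, and let $t_F(n,q)$ be the minimum number of such subgraphs in a graph obtained by adding $q$ edges to a maximum $F$-free graph on $n$ vertices. Let $T_2(n)$ be the complete bipartite graph on $n$ vertices with parts of sizes $\lfloor n/2\rfloor$ and $\lceil n/2\rceil$. Theorem. (i) There is $\delta>0$ such that for all integers $n\ge 1/\delta$ and $q\ge 0$ with $\mathrm{ex}(n,F)+q\le (1/4+\delta)n^2$, every graph $H$ with $n$ vertices, $\mathrm{ex}(n,F)+q$ edges and exactly $h_F(n,q)$ subgraphs isomorphic to $F$ contains a copy of $T_2(n)$ as a subgraph. (ii) Consequently, for every function $q=q(n)\ge 0$ with $q(n)=o(n^2)$ and all sufficiently large $n$, we have $h_F(n,q(n))=t_F(n,q(n))$,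 and every graph with $n$ vertices, $\mathrm{ex}(n,F)+q(n)$ edges and exactly $h_F(n,q(n))$ subgraphs isomorphic to $F$ is obtained by adding edges to a maximum $F$-free graph on the same vertex set. -/

import Mathlib

open Filter Asymptotics
open scoped SimpleGraph

/-- The bowtie: the two triangles `{0, 1, 2}` and `{0, 3, 4}` sharing the single vertex `0`. -/
def bowtie : SimpleGraph (Fin 5) :=
  SimpleGraph.fromEdgeSet {s(0, 1), s(0, 2), s(1, 2), s(0, 3), s(0, 4), s(3, 4)}

/-- `IsMaxFree F G`: the graph `G` is a maximum `F`-free graph, that is, it is `F`-free and has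
`ex(n, F)` edges, where `n` is its number of vertices. -/
def IsMaxFree {V W : Type*} [Fintype V] (F : SimpleGraph W) (G : SimpleGraph V) : Prop :=
  F.Free G ∧ G.edgeSet.ncard = SimpleGraph.extremalNumber (Fintype.card V) F

/-- The supersaturation function `h_F(n, q)`: the minimum number of `F`-subgraphs in a graph on
`n` vertices with `ex(n, F) + q` edges. -/
noncomputable def minCopies {W : Type*} (F : SimpleGraph W) (n q : ℕ) : ℕ :=
  sInf {k | ∃ H : SimpleGraph (Fin n),
    H.edgeSet.ncard = SimpleGraph.extremalNumber n F + q ∧ H.copyCount F = k}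

/-- The function `t_F(n, q)`: the minimum number of `F`-subgraphs in a graph obtained by adding
`q` edges to a maximum `F`-free graph on `n` vertices. -/
noncomputable def minCopiesAdding {W : Type*} (F : SimpleGraph W) (n q : ℕ) : ℕ :=
  sInf {k | ∃ G H : SimpleGraph (Fin n), IsMaxFree F G ∧ G ≤ H ∧
    H.edgeSet.ncard = G.edgeSet.ncard + q ∧ H.copyCount F = k}

/-- `IsOptimal F q H`: among all graphs with `ex(n, F) + q` edges on its number `n` of vertices,
`H` has the minimum number `h_F(n, q)` of `F`-subgraphs. -/
def IsOptimal {V W : Type*} [Fintype V] (F : SimpleGraph W) (q : ℕ) (H : SimpleGraph V) : Prop :=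
  H.edgeSet.ncard = SimpleGraph.extremalNumber (Fintype.card V) F + q ∧
    H.copyCount F = minCopies F (Fintype.card V) q

/-!
The proof works with labelled bowties, of which every copy of the bowtie carries the same number,
and with the class `Opt` of graphs that have the fewest of them among all graphs with the same
numbers of vertices and edges. The labelled bowties with centre `c` are the pairs of disjoint
oriented edges in the link of `c`, so their number is the polynomial `τ ^ 2 + 2 * τ - 4 * ∑ d ^ 2` in
the degrees `d` of that link, where `τ = ∑ d` (`bow_eq`).

Let `H` be such an optimal graph with `n` vertices and slightly more than `n ^ 2 / 4` edges.

* *`H` is almost complete bipartite* (`Opt.exists_nearBip`). A balanced complete bipartite graph with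
  a triangle-free, nearly regular graph in one part has few bowties, hence so has `H`, and by
  convexity of the count `H` also has few triangles. Averaging over the colourings that separate
  the neighbourhood of a vertex from the rest then gives a two-colouring with few *inner* edges
  (within a colour class), and, as there are more than `n ^ 2 / 4` edges, with still fewer *gaps*
  (missing edges between the classes). In a colouring with the fewest inner edges, a vertex of large
  inner degree would span many triangles, but it does not: exchanging an edge at that vertex for
  a non-edge whose ends lie in few triangles would destroy more bowties than it creates.
* *No vertex misses many vertices of the other class* (`NearBip.typical`). Otherwise join it to all
  typical vertices of the other class instead of its neighbours. It then lies in a bounded multiple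
  of the average number of bowties, while the edges won allow a far larger proportion of the inner
  edges, and with them of the bowties, to be deleted.
* *There are no gaps* (`NearBip.no_gaps`). Exchange an inner edge for a gap. If the maximum inner
  degree `Δ` is at least two, then an inner edge at a vertex of that degree lies in at least
  `(Δ - 1) * n ^ 2 / 10` labelled bowties, while a filled gap creates only `O(Δ ^ 2 * n)` of them. If
  the inner edges form a matching, the inner edge forms a bowtie with every other inner edge and
  almost every centre, while after deletion of a suitable inner edge the gap has at most one
  triangle on it.
* *The classes are balanced* (`Opt.card_le_of_join`). Now `H` is the join of two graphs. The number
  of its bowties is at least a cubic polynomial `bowPoly` in the sizes of the parts, their numbers of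
  edges and their sums of squared degrees, with equality for triangle-free graphs. The triangle-free
  nearly regular graphs of `exists_triangleFree_nearRegular` have the least possible sums of squared
  degrees. If the part sizes `a` and `b` differ by `k + 1 ≥ 2`, then moving a vertex to the smaller
  part makes room for `k` more edges between the parts, so `k` inner edges disappear; the polynomial
  decreases, unless the larger part has far more inner edges than the smaller one, in which case it
  decreases when inner edges are moved to the smaller part.

This proves that `H` contains the balanced complete bipartite graph. Applied to bowtie-free graphs,
which are optimal, it shows that the extremal number of the bowtie is `⌊n ^ 2 / 4⌋ + 1`, since two inner
edges of a complete bipartite graph lie in a bowtie and one does not (`extremalNumber_bowtie`). Every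
optimal graph therefore contains a maximum bowtie-free graph, which makes the two supersaturation
functions agree.
-/

namespace BowtieSupersat

/-! ### The arithmetic of unbalanced bipartitions -/

/-- A quarter of the number of labelled bowties in a graph consisting of all edges between two
parts of sizes `a` and `b`, together with triangle-free graphs inside the parts which have `x` and
`y` edges and whose squared degrees sum to `p` and `q`. -/
def bowPoly (a b x y p q : ℝ) : ℝ :=
  b * (b - 2) * p + a * (a - 2) * q + 4 * (a + b - 4) * x * y + a * y ^ 2 + b * x ^ 2
    + 3 * b * x + 3 * a * y - 2 * b ^ 2 * x - 2 * a ^ 2 * y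

/-- The sum of squared degrees of a graph with `m` vertices and `e` edges whose degrees all lie in
`{r, r + 1}`. For every `r`, it bounds the sum of squared degrees from below. -/
def sqDeg (m e r : ℝ) : ℝ := 2 * e * (2 * r + 1) - m * r * (r + 1)

/-- Moving `t` edges (about half of the size of the smaller part `b`) from the larger to the
smaller part decreases the number of bowties when `x - y` is noticeably more than `(a + b) / 4`. -/
lemma bowPoly_shift_lt {a b k x y t r p q p' q' : ℝ} (hb : 100000 ≤ b) (hk : 1 ≤ k)
    (hkb : 100000 * k ≤ b) (ha : a = b + k + 1) (hy : 0 ≤ y)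
    (hxy : 100000 * (x + y) ≤ b ^ 2) (ht1 : 2 * t ≤ b) (ht2 : b - 1 ≤ 2 * t) (hr : 0 ≤ r)
    (hra : r * a ≤ 2 * x)
    (hp : p' - p ≤ -4 * x - 2 * t + 2 * a + 2 * r * (a - 2 * t)) (hq : q' - q ≤ 4 * y + 2 * t)
    (hu : (a + b) / 4 * (1 + k / 25) < x - y) :
    bowPoly a b (x - t) (y + t) p' q' < bowPoly a b x y p q := by
  have hb0 : 0 < b := by linarith
  have hp2 : b * (b - 2) * (p' - p) ≤
      b * (b - 2) * (-4 * x - 2 * t + 2 * a + 2 * r * (a - 2 * t)) :=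
    mul_le_mul_of_nonneg_left hp (mul_nonneg (by linarith) (by linarith))
  have hq2 : a * (a - 2) * (q' - q) ≤ a * (a - 2) * (4 * y + 2 * t) :=
    mul_le_mul_of_nonneg_left hq (mul_nonneg (by linarith) (by linarith))
  have key : bowPoly a b (x - t) (y + t) p' q' - bowPoly a b x y p q =
      b * (b - 2) * (p' - p) + a * (a - 2) * (q' - q) + 4 * (a + b - 4) * t * (x - y - t)
      + 2 * t * (a * y - b * x) + (a + b) * t ^ 2 + t * (2 * b ^ 2 - 3 * b - 2 * a ^ 2 + 3 * a) := by
    unfold bowPoly; ring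
  suffices h : b * (b - 2) * (-4 * x + 2 * a + 2 * r * (a - 2 * t)) + a * (a - 2) * (4 * y)
      + 4 * (a + b - 4) * t * (x - y - t) + 2 * t * (a * y - b * x) + (a + b) * t ^ 2
      - t * (a - b) < 0 by
    have e : b * (b - 2) * (-4 * x - 2 * t + 2 * a + 2 * r * (a - 2 * t))
        + a * (a - 2) * (4 * y + 2 * t)
        + t * (2 * b ^ 2 - 3 * b - 2 * a ^ 2 + 3 * a) =
        b * (b - 2) * (-4 * x + 2 * a + 2 * r * (a - 2 * t)) + a * (a - 2) * (4 * y)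
        - t * (a - b) := by ring
    linarith
  obtain ⟨u, hudef⟩ : ∃ u, u = x - y := ⟨_, rfl⟩
  rw [← hudef] at hu ⊢
  have hu2 : b / 2 + k * b / 50 < u := by
    have h1 : b ≤ (a + b) / 2 := by linarith
    have h2 : b / 2 * (1 + k / 25) ≤ (a + b) / 4 * (1 + k / 25) :=
      mul_le_mul_of_nonneg_right (by linarith) (by positivity)
    linarith
  have hkb0 : 0 ≤ k * b := by positivity
  have hu0 : 0 < u := by linarith
  have hx0 : 0 ≤ x := by linarith
  -- the main terms cancel up to `-b ^ 2 * (u - b / 2)`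
  have e1 : b * (b - 2) * (2 * r * (a - 2 * t)) ≤ 6 * k * b ^ 2 * r := by
    have h1 : a - 2 * t ≤ 3 * k := by linarith
    have h2 : 0 ≤ a - 2 * t := by linarith
    have h3 : 2 * r * (a - 2 * t) ≤ 2 * r * (3 * k) := by gcongr
    have h4 : b * (b - 2) ≤ b ^ 2 := by linarith
    calc b * (b - 2) * (2 * r * (a - 2 * t)) ≤ b ^ 2 * (2 * r * (3 * k)) := by gcongr
      _ = _ := by ring
  have e2 : a * (a - 2) * (4 * y) ≤ 4 * b ^ 2 * y + 24 * k * b * y := by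
    have h1 : (k : ℝ) * k ≤ k * b := by
      have : k ≤ b := by linarith
      gcongr
    have h2 : a * (a - 2) = b ^ 2 + 2 * (k * b) + k * k - 1 := by rw [ha]; ring
    have h3 : a * (a - 2) ≤ b ^ 2 + 6 * k * b := by rw [h2]; linarith
    calc a * (a - 2) * (4 * y) ≤ (b ^ 2 + 6 * k * b) * (4 * y) := by gcongr
      _ = _ := by ring
  have e3 : 4 * (a + b - 4) * t * (u - t) ≤ 4 * b ^ 2 * (u - b / 2) + 2 * b ^ 2 + 2 * k * b * u := by
    have hut : 0 ≤ u - t := by linarith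
    have ht0 : (0 : ℝ) ≤ t := by linarith
    have h1 : 4 * (a + b - 4) * t * (u - t) ≤ 4 * (2 * b + k) * t * (u - t) := by
      gcongr; linarith
    have h2 : t * (u - t) ≤ b / 2 * (u - t) := by gcongr; linarith
    have h3 : b / 2 * (b / 2 - t) ≤ b / 2 * (1 / 2) := by gcongr; linarith
    have h4 : b * (t * (u - t)) ≤ b * (b / 2 * (u - b / 2) + b / 4) := by gcongr; linarith
    have h5 : b / 2 * (u - t) ≤ b / 2 * u :=
      mul_le_mul_of_nonneg_left (by linarith) (by linarith)
    have h6 : k * (t * (u - t)) ≤ k * (b / 2 * u) :=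
      mul_le_mul_of_nonneg_left (by linarith) (by linarith)
    linarith
  have e4 : 2 * t * (a * y - b * x) ≤ - b ^ 2 * u + b * u + 2 * k * b * y := by
    have h1 : a * y - b * x = - b * u + (k + 1) * y := by rw [hudef, ha]; ring
    rw [h1]
    have h2 : (b - 1) * (b * u) ≤ 2 * t * (b * u) := by gcongr
    have h3 : 2 * t * ((k + 1) * y) ≤ b * (2 * k * y) := by
      have h4 : (k + 1) * y ≤ 2 * k * y := by gcongr; linarith
      have h5 : 0 ≤ (k + 1) * y := by positivity
      gcongr
    linarith
  have e5 : (a + b) * t ^ 2 ≤ b ^ 3 / 2 + k * b ^ 2 / 2 := by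
    have h0 : 0 ≤ t := by linarith
    have h1 : t ^ 2 ≤ (b / 2) ^ 2 := by gcongr; linarith
    have h2 : (a + b) * t ^ 2 ≤ (2 * b + 2 * k) * (b / 2) ^ 2 := by
      have : a + b ≤ 2 * b + 2 * k := by linarith
      gcongr
    linarith
  have e6 : b * (b - 2) * (-4 * x + 2 * a) ≤ -4 * b ^ 2 * x + 8 * b * x + 2 * b ^ 3 + 4 * k * b ^ 2 := by
    have : b * (b - 2) * (2 * a) ≤ 2 * b ^ 3 + 4 * k * b ^ 2 := by
      have : b * (b - 2) * (2 * a) ≤ b ^ 2 * (2 * (b + 2 * k)) := by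
        have h0 : 0 ≤ b * (b - 2) := mul_nonneg hb0.le (by linarith)
        have h4 : b * (b - 2) ≤ b ^ 2 := by linarith
        have h5 : a ≤ b + 2 * k := by linarith
        have h6 : 0 ≤ a := by linarith
        gcongr
      linarith
    linarith
  have e7 : 0 ≤ t * (a - b) := mul_nonneg (by linarith) (by linarith)
  have f1 : b ^ 2 * (k * b / 50) ≤ b ^ 2 * (u - b / 2) := by
    have : k * b / 50 ≤ u - b / 2 := by linarith
    gcongr
  have f2 : 6 * k * b ^ 2 * r ≤ 12 * k * (b * x) := by
    have : r * b ≤ r * a := by gcongr; linarith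
    have h9 : (6 * k * b) * (r * b) ≤ (6 * k * b) * (2 * x) :=
      mul_le_mul_of_nonneg_left (by linarith) (by positivity)
    linarith
  have f3 : 40 * k * b * (x + y) ≤ k * b ^ 3 / 2500 := by
    have : (40 * k * b) * (100000 * (x + y)) ≤ (40 * k * b) * b ^ 2 := by gcongr
    linarith
  have f4 : k * b ^ 2 * 100000 ≤ k * b ^ 3 := by
    have : (k * b ^ 2) * 100000 ≤ (k * b ^ 2) * b := by gcongr
    linarith
  have f5 : b * x ≤ k * (b * x) := le_mul_of_one_le_left (by positivity) hk
  have f6 : b ^ 2 ≤ k * b ^ 2 := le_mul_of_one_le_left (by positivity) hk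
  have f7 : b * u ≤ b * x := by gcongr; linarith
  have f8 : k * (b * u) ≤ k * (b * x) := by gcongr
  have f9 : 0 ≤ k * (b * y) := by positivity
  have f10 : 0 ≤ k * (b * x) := by positivity
  have f11 : 0 < k * b ^ 3 := by positivity
  subst hudef
  linarith

/-- The limiting form of the change in the number of bowties when a vertex leaves the larger part
together with `k` of the inner edges, in terms of the average inner degrees `α` and `β` of the two
parts and of their integer parts `r` and `s`. -/
lemma move_core {α β : ℝ} {k r s : ℕ} (hk : 1 ≤ k) (hα : (r : ℝ) ≤ α) (hβ : (s : ℝ) ≤ β)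
    (hβ' : β ≤ s + 1 + 1 / 1000) (hγ : α - β ≤ 1 + k / 20) :
    -(k : ℝ) * α + (α ^ 2 - β ^ 2) / 4 - 4 * k * β - 4 * k * r + 4 * α * r - r * (r + 1)
      + s * (s + 1) - 4 * β * s ≤ -(1 / 50) * k * (α + β + r) := by
  have hr0 : (0 : ℝ) ≤ r := Nat.cast_nonneg _
  have hs0 : (0 : ℝ) ≤ s := Nat.cast_nonneg _
  have hk1 : (1 : ℝ) ≤ k := by exact_mod_cast hk
  have hα0 : 0 ≤ α := hr0.trans hα
  have hβ0 : 0 ≤ β := hs0.trans hβ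
  set γ := α - β with hγdef
  have hsq : α ^ 2 - β ^ 2 = γ * (α + β) := by rw [hγdef]; ring
  have hγk : γ ≤ 1.05 * k := by linarith
  have hsq2 : γ * (α + β) ≤ 1.05 * k * (α + β) := by gcongr
  have hαβ : 4 * α * r = 4 * γ * r + 4 * β * r := by rw [hγdef]; ring
  have hγr : γ * r ≤ (1 + k / 20) * r := by gcongr
  rw [hsq, hαβ]
  have hkr : (r : ℝ) ≤ k * r := le_mul_of_one_le_left hr0 hk1
  have hkα : α ≤ k * α := le_mul_of_one_le_left hα0 hk1
  have hkβ : β ≤ k * β := le_mul_of_one_le_left hβ0 hk1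
  -- For `s < r`, write `r = s + g + 1`. The bounds on `α - β` force `k` to be large if `g ≥ 2`.
  rcases le_or_gt r s with hrs | hrs
  · obtain ⟨j, rfl⟩ := Nat.exists_eq_add_of_le hrs
    push_cast at *
    have hj : (j : ℝ) ≤ j ^ 2 := by
      norm_cast; nlinarith [Nat.zero_le j, Nat.le_mul_self j]
    have h1 : 4 * β * r - r * (r + 1) + (r + j) * (r + j + 1) - 4 * β * (r + j) ≤ 0 := by
      have : (4 * j : ℝ) * (r + j) ≤ 4 * j * β := by gcongr
      nlinarith [mul_nonneg (Nat.cast_nonneg (α := ℝ) j) hr0]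
    have h2 : (k : ℝ) * r ≤ k * β := by
      gcongr; linarith [Nat.cast_nonneg (α := ℝ) j]
    nlinarith
  · obtain ⟨g, rfl⟩ := Nat.exists_eq_add_of_lt hrs
    rcases Nat.lt_trichotomy g 1 with hg | hg | hg
    · obtain rfl : g = 0 := by omega
      push_cast at *
      have hβr : k * β ≤ k * (2 * (s + 0 + 1)) := by gcongr; linarith
      have hβγ : β = α - γ := by rw [hγdef]; ring
      have h3 : γ * (α + β) ≤ 2.1 * k * α := by
        rcases le_total 0 γ with h | h
        · have : γ * (α + β) ≤ (1.05 * k) * (2 * α) := by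
            gcongr; linarith
          linarith
        · have : γ * (α + β) ≤ 0 := mul_nonpos_of_nonpos_of_nonneg h (by linarith)
          have : 0 ≤ k * α := by positivity
          linarith
      nlinarith
    · subst hg
      push_cast at *
      have hβr : k * β ≤ k * (2 * (s + 1 + 1)) := by gcongr; linarith
      have hγ0 : 0 ≤ γ := by rw [hγdef]; linarith
      have h3 : γ * (α + β) ≤ 2.1 * k * α := by
        have : γ * (α + β) ≤ (1.05 * k) * (2 * α) := by
          gcongr; linarith
        linarith
      rcases Nat.lt_or_ge k 2 with hk2 | hk2
      · obtain rfl : k = 1 := by omega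
        push_cast at *
        nlinarith
      · have hk2' : (2 : ℝ) ≤ k := by exact_mod_cast hk2
        have h4 : 2 * β ≤ k * β := by gcongr
        have h5 : 2 * (s + 1 + 1 : ℝ) ≤ k * (s + 1 + 1) := by gcongr
        nlinarith
    · have hg' : (2 : ℝ) ≤ g := by exact_mod_cast hg
      push_cast at *
      have hγg : (g : ℝ) ≤ γ + 1 / 1000 := by rw [hγdef]; linarith
      have hk20 : (19.98 : ℝ) ≤ k := by linarith
      have hγ1 : γ ≤ 0.1002 * k := by linarith
      have hγ0 : 0 ≤ γ := by linarith
      have hg1 : (g : ℝ) + 1 ≤ 0.152 * k := by linarith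
      have h3 : γ * (α + β) ≤ 2.1 * k * α := by
        have : γ * (α + β) ≤ (1.05 * k) * (2 * α) := by
          gcongr; linarith
        linarith
      have hr : γ * (s + g + 1) ≤ 0.1002 * k * (s + g + 1) := by gcongr
      have h4 : 4 * β * (s + g + 1) - (s + g + 1) * (s + g + 1 + 1) + s * (s + 1) - 4 * β * s
          ≤ 2 * (0.152 * k) * (s + g + 1) := by
        have h5 : (4 * (g + 1)) * β ≤ (4 * (g + 1)) * (s + 1 + 1 / 1000) := by gcongr
        have h6 : 2 * ((g + 1) * (s + g + 1)) ≤ 2 * (0.152 * k * (s + g + 1 : ℝ)) := by gcongr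
        nlinarith [mul_nonneg (Nat.cast_nonneg (α := ℝ) g) hs0]
      have hβr : k * β ≤ k * (2 * (s + g + 1)) := by gcongr; linarith
      nlinarith

/-- The lower-order terms do not affect the sign in `move_core`. -/
lemma move_core_lower_order {b α β k r s C : ℝ} (hb : 100000 ≤ b) (hk1 : 1 ≤ k) (hr0 : 0 ≤ r)
    (hs0 : 0 ≤ s) (hα0 : 0 ≤ α) (hβ0 : 0 ≤ β) (hsβ : s ≤ β) (hkb : 100000 * k ≤ b)
    (hβb : 10000 * β ≤ b) (hαβ : 0 < α + β) (core : C ≤ -(1 / 50) * k * (α + β + r)) :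
    b ^ 2 * C - b * k * (k - 1) - α * b / 2 + β * b / 2
      - 4 * (k - 3) * k * (β * b / 2) + 8 * k * b * r - 2 * r * α * b
      - (b + 2 * b * k - k) * (r * (r + 1))
      + (b - k ^ 2 + 2 * k) * (s * (s + 1)) - 2 * (2 * k - 1) * β * b * s < 0 := by
  have hb0 : 0 < b := by linarith
  have e0 : 0 ≤ b * k * (k - 1) := by
    have : 0 ≤ k - 1 := by linarith
    positivity
  have e1 : -4 * (k - 3) * k * (β * b / 2) ≤ 6 * k * β * b := by
    have : 0 ≤ k * k * β * b := by positivity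
    linarith
  have e2 : 0 ≤ (b + 2 * b * k - k) * (r * (r + 1)) := by
    have : 0 ≤ b * k := by positivity
    have : 0 ≤ b + 2 * b * k - k := by linarith
    positivity
  have e3 : (b - k ^ 2 + 2 * k) * (s * (s + 1)) ≤ (b + 1) * (β * (β + 1)) := by
    have h1 : b - k ^ 2 + 2 * k ≤ b + 1 := by linarith [sq_nonneg (k - 1)]
    have h2 : s * (s + 1) ≤ β * (β + 1) := by gcongr
    calc _ ≤ (b + 1) * (s * (s + 1)) := by gcongr
      _ ≤ _ := by gcongr
  have e4 : 0 ≤ 2 * (2 * k - 1) * β * b * s := by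
    have : 0 ≤ 2 * k - 1 := by linarith
    positivity
  have e5 : 0 ≤ 2 * r * α * b := by positivity
  have e6 : 0 ≤ α * b / 2 := by positivity
  have e7 : (b + 1) * (β * (β + 1)) ≤ b ^ 2 * k * β / 1000 := by
    have h1 : (b + 1) * (β + 1) ≤ (2 * b) * (2 * b / 10000) := by
      have : β + 1 ≤ 2 * b / 10000 := by linarith
      have : b + 1 ≤ 2 * b := by linarith
      gcongr
    have h2 : b ^ 2 * β ≤ b ^ 2 * β * k := le_mul_of_one_le_right (by positivity) hk1
    have h3 := mul_le_mul_of_nonneg_left h1 hβ0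
    have h4 : 0 ≤ b ^ 2 * β * k := by positivity
    linarith
  have e8 : 7 * k * β * b + 8 * k * b * r ≤ b ^ 2 * k * (β + r) / 1000 := by
    have : (k * b * (β + r)) * 8000 ≤ (k * b * (β + r)) * b :=
      mul_le_mul_of_nonneg_left (by linarith) (by positivity)
    have : 0 ≤ k * β * b := by positivity
    linarith
  have e9 : β * b / 2 ≤ k * β * b := by
    have : β * b ≤ k * (β * b) := le_mul_of_one_le_left (by positivity) hk1
    have : 0 ≤ β * b := by positivity
    linarith
  have e10 := mul_le_mul_of_nonneg_left core (sq_nonneg b)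
  have e11 : 0 < b ^ 2 * k * (α + β) := by positivity
  have e12 : 0 ≤ b ^ 2 * k * r := by positivity
  have e13 : 0 ≤ b ^ 2 * k * α := by positivity
  have e14 : 0 ≤ b ^ 2 * k * β := by positivity
  linarith

/-- Moving one vertex from the larger part to the smaller one and deleting `k` edges of the larger
part decreases the number of bowties. -/
lemma bowPoly_move_lt {a b x x' y p q : ℝ} {k r s : ℕ} (hb : 100000 ≤ b) (hk : 1 ≤ k)
    (hkb : 100000 * k ≤ b) (ha : a = b + k + 1) (hx : x = x' + k) (hx' : 0 ≤ x') (hy : 0 ≤ y)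
    (hxy : 100000 * (x + y) ≤ b ^ 2) (hpos : 0 < x' + y)
    (hr : r * (b + k) ≤ 2 * x') (hs : s * (b + 1) ≤ 2 * y) (hs' : 2 * y ≤ (s + 1) * (b + 1))
    (hp : sqDeg a x r ≤ p) (hq : sqDeg b y s ≤ q)
    (hu : x - y ≤ (a + b) / 4 * (1 + k / 25)) :
    bowPoly (a - 1) (b + 1) x' y (sqDeg (a - 1) x' r) (sqDeg (b + 1) y s) <
      bowPoly a b x y p q := by
  have hb0 : 0 < b := by linarith
  have hr0 : (0 : ℝ) ≤ r := Nat.cast_nonneg _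
  have hs0 : (0 : ℝ) ≤ s := Nat.cast_nonneg _
  have hk1 : (1 : ℝ) ≤ k := by exact_mod_cast hk
  have hp2 : b * (b - 2) * sqDeg a x r ≤ b * (b - 2) * p :=
    mul_le_mul_of_nonneg_left hp (mul_nonneg (by linarith) (by linarith))
  have hq2 : a * (a - 2) * sqDeg b y s ≤ a * (a - 2) * q :=
    mul_le_mul_of_nonneg_left hq (mul_nonneg (by linarith) (by linarith))
  suffices h : bowPoly (a - 1) (b + 1) x' y (sqDeg (a - 1) x' r) (sqDeg (b + 1) y s) <
      bowPoly a b x y (sqDeg a x r) (sqDeg b y s) by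
    refine h.trans_le ?_
    unfold bowPoly
    linarith
  -- the average inner degrees, both normalized by the size of the smaller part
  obtain ⟨α, hα⟩ : ∃ α, x' = α * b / 2 := ⟨2 * x' / b, by field_simp⟩
  obtain ⟨β, hβ⟩ : ∃ β, y = β * b / 2 := ⟨2 * y / b, by field_simp⟩
  have hβ0 : 0 ≤ β := by
    by_contra h; push Not at h; nlinarith
  have hα0 : 0 ≤ α := by
    by_contra h; push Not at h; nlinarith
  have hrα : (r : ℝ) ≤ α := by
    have : (r : ℝ) * b ≤ α * b := by nlinarith
    exact le_of_mul_le_mul_right this hb0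
  have hsβ : (s : ℝ) ≤ β := by
    have : (s : ℝ) * b ≤ β * b := by nlinarith
    exact le_of_mul_le_mul_right this hb0
  have hβb : 10000 * β ≤ b := by
    have : 10000 * β * b ≤ b * b := by nlinarith
    exact le_of_mul_le_mul_right this hb0
  have hβs : β ≤ s + 1 + 1 / 1000 := by
    have : β * b ≤ (s + 1 + 1 / 1000) * b := by nlinarith
    exact le_of_mul_le_mul_right this hb0
  have hγ : α - β ≤ 1 + k / 20 := by
    have : (α - β) * b ≤ (1 + k / 20) * b := by
      have h1 : (α - β) * b = 2 * (x - y) - 2 * k := by rw [hx, hα, hβ]; ring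
      have h2 : (k : ℝ) * (100000 * k) ≤ k * b := by gcongr
      rw [h1]; rw [ha] at hu
      nlinarith
    exact le_of_mul_le_mul_right this hb0
  have core := move_core hk hrα hsβ hβs hγ
  have hαβ : 0 < α + β := by
    by_contra h; push Not at h
    have : α * b + β * b ≤ 0 := by nlinarith
    linarith
  have key : bowPoly (a - 1) (b + 1) x' y (sqDeg (a - 1) x' r) (sqDeg (b + 1) y s) -
      bowPoly a b x y (sqDeg a x r) (sqDeg b y s) =
      b ^ 2 * (-(k : ℝ) * α + (α ^ 2 - β ^ 2) / 4 - 4 * k * β - 4 * k * r + 4 * α * r - r * (r + 1)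
      + s * (s + 1) - 4 * β * s) - b * k * (k - 1) - α * b / 2 + β * b / 2
      - 4 * (k - 3) * k * (β * b / 2) + 8 * k * b * r - 2 * r * α * b
      - (b + 2 * b * k - k) * (r * (r + 1))
      + (b - k ^ 2 + 2 * k) * (s * (s + 1)) - 2 * (2 * k - 1) * β * b * s := by
    rw [hx, ha, hα, hβ]; unfold bowPoly sqDeg; ring
  rw [← sub_neg, key]
  exact move_core_lower_order hb hk1 hr0 hs0 hα0 hβ0 hsβ hkb hβb hαβ core

/-- The analogue of `bowPoly_move_lt` when the larger part contains only `x < x + m` of the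
`x + m` edges to be deleted; the other `m` are deleted from the smaller part. -/
lemma bowPoly_move_lt' {a b x y y' m p q : ℝ} {s : ℕ} (hb : 100000 ≤ b) (hm : 1 ≤ m) (hx : 0 ≤ x)
    (hx2 : x ≤ x ^ 2)
    (ha : a = b + (x + m) + 1) (hy : y = y' + m) (hy' : 1 ≤ y')
    (hs : s * (b + 1) ≤ 2 * y')
    (hp : 2 * x ≤ p) (hq : sqDeg b y s ≤ q) :
    bowPoly (a - 1) (b + 1) 0 y' 0 (sqDeg (b + 1) y' s) < bowPoly a b x y p q := by
  have hs0 : (0 : ℝ) ≤ s := Nat.cast_nonneg _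
  have hb0 : 0 < b := by linarith
  have hp2 : b * (b - 2) * (2 * x) ≤ b * (b - 2) * p :=
    mul_le_mul_of_nonneg_left hp (mul_nonneg (by linarith) (by linarith))
  have hq2 : a * (a - 2) * sqDeg b y s ≤ a * (a - 2) * q :=
    mul_le_mul_of_nonneg_left hq (mul_nonneg (by linarith) (by linarith))
  suffices h : bowPoly (a - 1) (b + 1) 0 y' 0 (sqDeg (b + 1) y' s) <
      bowPoly a b x y (2 * x) (sqDeg b y s) by
    refine h.trans_le ?_
    unfold bowPoly
    linarith
  have ha0 : 100000 ≤ a := by linarith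
  have key : bowPoly (a - 1) (b + 1) 0 y' 0 (sqDeg (b + 1) y' s) -
      bowPoly a b x y (2 * x) (sqDeg b y s) =
      b * (x - x ^ 2) - 4 * (a + b - 4) * x * y + (y' - y' ^ 2) - a * m * (2 * y' + m - 1)
      + s * (-4 * m * (a * (a - 2)) - 4 * y' * (2 * a - 3)
        + (s + 1) * (b ^ 2 + b - (x + m) ^ 2 + 2 * (x + m))) := by
    rw [hy, ha]; unfold bowPoly sqDeg; ring
  have h1 : b * (x - x ^ 2) ≤ 0 := mul_nonpos_of_nonneg_of_nonpos hb0.le (by linarith)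
  have h2 : 0 ≤ 4 * (a + b - 4) * x * y := by
    have : 0 ≤ a + b - 4 := by linarith
    have : 0 ≤ y := by linarith
    positivity
  have h3 : y' - y' ^ 2 ≤ 0 := by nlinarith
  have h4 : 0 < a * m * (2 * y' + m - 1) := by
    have : 0 < 2 * y' + m - 1 := by linarith
    positivity
  have h5 : -4 * m * (a * (a - 2)) - 4 * y' * (2 * a - 3)
      + (s + 1) * (b ^ 2 + b - (x + m) ^ 2 + 2 * (x + m)) ≤ 0 := by
    have g1 : (s + 1) * (b ^ 2 + b - (x + m) ^ 2 + 2 * (x + m)) ≤ (s + 1) * (b + 1) ^ 2 := by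
      gcongr
      nlinarith [sq_nonneg (x + m - 1)]
    have g2 : s * (b + 1) * (b + 1) ≤ 2 * y' * (b + 1) := by gcongr
    have g3 : (b + 1) * (b + 1) ≤ 4 * (a * (a - 2)) := by
      have : (b + 1) * (b + 1) ≤ a * (4 * (a - 2)) := by gcongr <;> linarith
      linarith
    have g4 : 4 * (a * (a - 2)) ≤ m * (4 * (a * (a - 2))) :=
      le_mul_of_one_le_left (mul_nonneg (by norm_num)
        (mul_nonneg (by linarith) (by linarith))) hm
    have g5 : 2 * y' * (b + 1) ≤ 2 * y' * (2 * (2 * a - 3)) := by gcongr; linarith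
    linarith
  have h6 := mul_nonpos_of_nonneg_of_nonpos hs0 h5
  linarith

open Finset
open scoped Classical

noncomputable section

set_option linter.unusedSectionVars false

variable {V W α β : Type*} [Fintype V] [Fintype W] [Fintype α] [Fintype β]

/-! ### Counting labelled bowties -/

/-- The degree of `v` in `R`. -/
def dg (R : SimpleGraph V) (v : V) : ℕ := #{w | R.Adj v w}

/-- The number of ordered pairs of adjacent vertices, that is, twice the number of edges. -/
def vol (R : SimpleGraph V) : ℕ := ∑ v, dg R v

/-- The number of ordered pairs of vertex-disjoint edges of `R`, each edge being oriented. -/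
def disjPairs (R : SimpleGraph V) : ℕ :=
  #{t : (V × V) × (V × V) | R.Adj t.1.1 t.1.2 ∧ R.Adj t.2.1 t.2.2 ∧
    t.1.1 ≠ t.2.1 ∧ t.1.1 ≠ t.2.2 ∧ t.1.2 ≠ t.2.1 ∧ t.1.2 ≠ t.2.2}

/-- The graph spanned by the edges `uv` of `H` that form a triangle with `c`. -/
def link (H : SimpleGraph V) (c : V) : SimpleGraph V where
  Adj u v := H.Adj c u ∧ H.Adj c v ∧ H.Adj u v
  symm := ⟨fun _ _ h => ⟨h.2.1, h.1, h.2.2.symm⟩⟩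
  loopless := ⟨fun _ h => h.2.2.ne rfl⟩

/-- The labelled bowties `(c, (u, v), (w, z))` of `H`, with centre `c` and triangles `cuv`, `cwz`. -/
def bowties (H : SimpleGraph V) : Finset (V × (V × V) × (V × V)) :=
  {t | (link H t.1).Adj t.2.1.1 t.2.1.2 ∧ (link H t.1).Adj t.2.2.1 t.2.2.2 ∧
    t.2.1.1 ≠ t.2.2.1 ∧ t.2.1.1 ≠ t.2.2.2 ∧ t.2.1.2 ≠ t.2.2.1 ∧ t.2.1.2 ≠ t.2.2.2}

lemma link_adj {H : SimpleGraph V} {c u v : V} :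
    (link H c).Adj u v ↔ H.Adj c u ∧ H.Adj c v ∧ H.Adj u v := Iff.rfl

lemma mem_bowties {H : SimpleGraph V} {c u v w z : V} :
    (c, (u, v), (w, z)) ∈ bowties H ↔ (link H c).Adj u v ∧ (link H c).Adj w z ∧
      u ≠ w ∧ u ≠ z ∧ v ≠ w ∧ v ≠ z := by
  simp [bowties]

/-- The number of labelled bowties of `H`. -/
def bow (H : SimpleGraph V) : ℕ := #(bowties H)

lemma sum_ind_eq_dg (R : SimpleGraph V) (v : V) :
    ∑ w, (if R.Adj v w then (1 : ℤ) else 0) = dg R v := by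
  simp [dg]

lemma sum_sum_ind_eq_vol (R : SimpleGraph V) :
    ∑ v, ∑ w, (if R.Adj v w then (1 : ℤ) else 0) = vol R := by
  simp [dg, vol]

lemma vol_eq_card (R : SimpleGraph V) : vol R = #{t : V × V | R.Adj t.1 t.2} := by
  rw [vol, card_filter, Fintype.sum_prod_type]
  simp [dg]

/-- Inclusion–exclusion over the coincidences between the ends of two oriented edges. -/
theorem disjPairs_eq (R : SimpleGraph V) :
    (disjPairs R : ℤ) = (vol R : ℤ) ^ 2 + 2 * vol R - 4 * ∑ v, (dg R v : ℤ) ^ 2 := by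
  set A : V → V → ℤ := fun u v => if R.Adj u v then 1 else 0 with hA
  have hsymm : ∀ u v, A u v = A v u := fun u v => by simp [hA, R.adj_comm]
  have h1 : (disjPairs R : ℤ) = ∑ u, ∑ v, ∑ w, ∑ z,
      (A u v * A w z - (if u = w then A u v * A w z else 0)
        - (if u = z then A u v * A w z else 0) - (if v = w then A u v * A w z else 0)
        - (if v = z then A u v * A w z else 0)
        + (if u = w then (if v = z then A u v * A w z else 0) else 0)
        + (if u = z then (if v = w then A u v * A w z else 0) else 0)) := by
    rw [disjPairs, card_filter]
    push_cast
    rw [Fintype.sum_prod_type, Fintype.sum_prod_type]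
    refine sum_congr rfl fun u _ => sum_congr rfl fun v _ => ?_
    rw [Fintype.sum_prod_type]
    refine sum_congr rfl fun w _ => sum_congr rfl fun z _ => ?_
    by_cases huv : R.Adj u v
    · by_cases hwz : R.Adj w z
      · have := huv.ne
        have := hwz.ne
        simp only [hA, huv, hwz]
        by_cases h1 : u = w <;> by_cases h2 : u = z <;> by_cases h3 : v = w <;>
          by_cases h4 : v = z <;> simp_all
      · simp [hA, hwz]
    · simp [hA, huv]
  have hd : ∀ v, ∑ w, A v w = dg R v := fun v => sum_ind_eq_dg R v
  have hd' : ∀ v, ∑ w, A w v = dg R v := fun v => by simp_rw [hsymm _ v]; exact hd v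
  have hv : ∑ u, (dg R u : ℤ) = vol R := by simp [vol]
  have hAA : ∀ u v, A u v * A u v = A u v := fun u v => by simp only [hA]; split_ifs <;> rfl
  rw [h1]
  simp only [sum_add_distrib, sum_sub_distrib]
  have e1 : ∑ u, ∑ v, ∑ w, ∑ z, A u v * A w z = (vol R : ℤ) ^ 2 := by
    simp_rw [← mul_sum, hd, hv, ← sum_mul, hd, hv]; ring
  have e2 : ∑ u, ∑ v, ∑ w, ∑ z, (if u = w then A u v * A w z else 0) = ∑ v, (dg R v : ℤ) ^ 2 := by
    refine sum_congr rfl fun u _ => ?_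
    have : ∀ v, ∑ w, ∑ z, (if u = w then A u v * A w z else 0) = A u v * dg R u := fun v => by
      rw [sum_comm]; simp [← mul_sum, hd]
    simp_rw [this, ← sum_mul, hd]; ring
  have e3 : ∑ u, ∑ v, ∑ w, ∑ z, (if u = z then A u v * A w z else 0) = ∑ v, (dg R v : ℤ) ^ 2 := by
    refine sum_congr rfl fun u _ => ?_
    have : ∀ v, ∑ w, ∑ z, (if u = z then A u v * A w z else 0) = A u v * dg R u := fun v => by
      simp [← mul_sum, hd']
    simp_rw [this, ← sum_mul, hd]; ring
  have e4 : ∑ u, ∑ v, ∑ w, ∑ z, (if v = w then A u v * A w z else 0) = ∑ v, (dg R v : ℤ) ^ 2 := by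
    rw [sum_comm]
    refine sum_congr rfl fun v _ => ?_
    have : ∀ u, ∑ w, ∑ z, (if v = w then A u v * A w z else 0) = A u v * dg R v := fun u => by
      rw [sum_comm]; simp [← mul_sum, hd]
    simp_rw [this, ← sum_mul, hd']; ring
  have e5 : ∑ u, ∑ v, ∑ w, ∑ z, (if v = z then A u v * A w z else 0) = ∑ v, (dg R v : ℤ) ^ 2 := by
    rw [sum_comm]
    refine sum_congr rfl fun v _ => ?_
    have : ∀ u, ∑ w, ∑ z, (if v = z then A u v * A w z else 0) = A u v * dg R v := fun u => by
      simp [← mul_sum, hd']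
    simp_rw [this, ← sum_mul, hd']; ring
  have e6 : ∑ u, ∑ v, ∑ w, ∑ z, (if u = w then (if v = z then A u v * A w z else 0) else 0)
      = (vol R : ℤ) := by
    rw [← hv]
    refine sum_congr rfl fun u _ => ?_
    rw [← hd]
    refine sum_congr rfl fun v _ => ?_
    rw [sum_comm]; simp [hAA]
  have e7 : ∑ u, ∑ v, ∑ w, ∑ z, (if u = z then (if v = w then A u v * A w z else 0) else 0)
      = (vol R : ℤ) := by
    rw [← hv]
    refine sum_congr rfl fun u _ => ?_
    rw [← hd]
    refine sum_congr rfl fun v _ => ?_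
    simp [hsymm v u, hAA]
  rw [e1, e2, e3, e4, e5, e6, e7]
  ring

lemma bow_eq_sum_disjPairs (H : SimpleGraph V) : bow H = ∑ c, disjPairs (link H c) := by
  rw [bow, bowties, card_filter, Fintype.sum_prod_type]
  refine sum_congr rfl fun c _ => ?_
  rw [disjPairs, card_filter]

/-- The number of labelled bowties in terms of the volumes and squared degrees of the links. -/
lemma bow_eq (H : SimpleGraph V) :
    (bow H : ℤ) = ∑ c, ((vol (link H c) : ℤ) ^ 2 + 2 * vol (link H c)
      - 4 * ∑ u, (dg (link H c) u : ℤ) ^ 2) := by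
  rw [bow_eq_sum_disjPairs]
  push_cast
  exact sum_congr rfl fun c _ => disjPairs_eq _

lemma dg_mono {R S : SimpleGraph V} (h : R ≤ S) (v : V) : dg R v ≤ dg S v :=
  card_le_card fun w hw => by
    simp only [mem_filter, mem_univ, true_and] at hw ⊢
    exact h hw

lemma vol_mono {R S : SimpleGraph V} (h : R ≤ S) : vol R ≤ vol S :=
  sum_le_sum fun v _ => dg_mono h v

lemma link_mono {G H : SimpleGraph V} (h : G ≤ H) (c : V) : link G c ≤ link H c :=
  fun _ _ hab => ⟨h hab.1, h hab.2.1, h hab.2.2⟩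

lemma bowties_mono {G H : SimpleGraph V} (h : G ≤ H) : bowties G ⊆ bowties H := fun t ht => by
  simp only [bowties, mem_filter, mem_univ, true_and] at ht ⊢
  exact ⟨link_mono h _ ht.1, link_mono h _ ht.2.1, ht.2.2⟩

lemma bow_mono {G H : SimpleGraph V} (h : G ≤ H) : bow G ≤ bow H := card_le_card (bowties_mono h)

lemma dg_le_card (R : SimpleGraph V) (v : V) : dg R v ≤ Fintype.card V := card_le_univ _

lemma vol_eq_two_mul_ncard (R : SimpleGraph V) : vol R = 2 * R.edgeSet.ncard := by
  have := R.sum_degrees_eq_twice_card_edges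
  rw [← SimpleGraph.coe_edgeFinset R, Set.ncard_coe_finset, ← this, vol]
  refine sum_congr rfl fun v _ => ?_
  rw [dg, ← SimpleGraph.card_neighborFinset_eq_degree]
  congr 1
  ext w
  simp

lemma dg_iso {G : SimpleGraph V} {H : SimpleGraph W} (e : G ≃g H) (v : V) : dg H (e v) = dg G v := by
  rw [dg, dg]
  refine (card_bij (fun w _ => e w) ?_ ?_ ?_).symm
  · intro w hw
    simp only [mem_filter, mem_univ, true_and] at hw ⊢
    exact e.map_adj_iff.2 hw
  · intro a _ b _ h; exact e.injective h
  · intro w hw; exact ⟨e.symm w, by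
      simp only [mem_filter, mem_univ, true_and] at hw ⊢
      rw [← e.map_adj_iff]; simpa using hw, by simp⟩

lemma vol_iso {G : SimpleGraph V} {H : SimpleGraph W} (e : G ≃g H) : vol H = vol G := by
  rw [vol, vol, ← e.toEquiv.sum_comp]
  exact sum_congr rfl fun v _ => dg_iso e v

/-! ### Labelled bowties and copies of the bowtie -/

lemma labelledCopyCount_eq_card_univ (F : SimpleGraph W) (G : SimpleGraph V)
    [Fintype (SimpleGraph.Copy F G)] :
    G.labelledCopyCount F = #(univ : Finset (SimpleGraph.Copy F G)) := by
  rw [SimpleGraph.labelledCopyCount, Finset.card_univ]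
  convert rfl

/-- The labelled bowties are the labelled copies of `bowtie`, read off at the five vertices. -/
lemma labelledCopyCount_bowtie (H : SimpleGraph V) : H.labelledCopyCount bowtie = bow H := by
  rw [labelledCopyCount_eq_card_univ, bow]
  refine card_bij (fun f _ => (f 0, (f 1, f 2), (f 3, f 4))) ?_ ?_ ?_
  · intro f _
    have adj : ∀ i j, bowtie.Adj i j → H.Adj (f i) (f j) := fun i j h => f.toHom.map_adj h
    have ne : ∀ i j, i ≠ j → f i ≠ f j := fun i j h => f.injective.ne h
    simp only [mem_bowties, link_adj]
    refine ⟨⟨adj 0 1 ?_, adj 0 2 ?_, adj 1 2 ?_⟩, ⟨adj 0 3 ?_, adj 0 4 ?_, adj 3 4 ?_⟩,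
      ne 1 3 (by decide), ne 1 4 (by decide), ne 2 3 (by decide), ne 2 4 (by decide)⟩ <;>
      simp [bowtie]
  · intro f _ g _ h
    simp only [Prod.mk.injEq] at h
    refine SimpleGraph.Copy.ext fun i => ?_
    match i with
    | 0 => exact h.1
    | 1 => exact h.2.1.1
    | 2 => exact h.2.1.2
    | 3 => exact h.2.2.1
    | 4 => exact h.2.2.2
  · rintro ⟨c, ⟨u, v⟩, ⟨w, z⟩⟩ h
    simp only [mem_bowties, link_adj] at h
    obtain ⟨⟨h1, h2, h3⟩, ⟨h4, h5, h6⟩, n1, n2, n3, n4⟩ := h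
    have hhom : ∀ {i j}, bowtie.Adj i j → H.Adj (![c, u, v, w, z] i) (![c, u, v, w, z] j) := by
      intro i j hij
      simp only [bowtie, SimpleGraph.fromEdgeSet_adj, Set.mem_insert_iff, Set.mem_singleton_iff,
        Sym2.eq_iff] at hij
      obtain ⟨(((⟨rfl, rfl⟩ | ⟨rfl, rfl⟩) | (⟨rfl, rfl⟩ | ⟨rfl, rfl⟩) | (⟨rfl, rfl⟩ | ⟨rfl, rfl⟩) |
        (⟨rfl, rfl⟩ | ⟨rfl, rfl⟩) | (⟨rfl, rfl⟩ | ⟨rfl, rfl⟩) | (⟨rfl, rfl⟩ | ⟨rfl, rfl⟩))), -⟩ := hij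
      exacts [h1, h1.symm, h2, h2.symm, h3, h3.symm, h4, h4.symm, h5, h5.symm, h6, h6.symm]
    have hinj : Function.Injective ![c, u, v, w, z] := by
      rw [← List.nodup_ofFn]
      simp [h1.ne, h2.ne, h3.ne, h4.ne, h5.ne, h6.ne, n1, n2, n3, n4]
    exact ⟨⟨⟨![c, u, v, w, z], hhom⟩, hinj⟩, mem_univ _, rfl⟩

lemma toSubgraph_adj_apply {F : SimpleGraph W} {G : SimpleGraph V} (f : SimpleGraph.Copy F G)
    (a b : W) : f.toSubgraph.Adj (f a) (f b) ↔ F.Adj a b := by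
  refine ⟨fun h => ?_, fun h => ⟨a, b, h, rfl, rfl⟩⟩
  obtain ⟨a', b', h, ha, hb⟩ := h
  rwa [← f.injective ha, ← f.injective hb]

/-- Each copy of `F` in `G` carries as many labellings as `F` has automorphisms. -/
lemma labelledCopyCount_eq_copyCount_mul (F : SimpleGraph W) (G : SimpleGraph V) :
    G.labelledCopyCount F = G.copyCount F * Nat.card (F ≃g F) := by
  rw [labelledCopyCount_eq_card_univ, SimpleGraph.copyCount_eq_card_image_copyToSubgraph,
    card_eq_sum_card_image SimpleGraph.Copy.toSubgraph, ← smul_eq_mul, ← sum_const]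
  refine sum_congr (by congr) fun G' hG' => ?_
  obtain ⟨f₀, -, rfl⟩ := mem_image.1 hG'
  have : Finite (F ≃g F) := DFunLike.finite _
  have := Fintype.ofFinite (F ≃g F)
  rw [Nat.card_eq_fintype_card, ← Finset.card_univ]
  symm
  refine card_bij (fun σ _ => f₀.comp σ.toCopy) ?_ ?_ ?_
  · intro σ _
    simp only [mem_filter, mem_univ, true_and]
    change SimpleGraph.Subgraph.map (f₀.toHom.comp σ.toHom) ⊤ = _
    rw [SimpleGraph.Subgraph.map_comp, SimpleGraph.Subgraph.map_iso_top]
  · intro σ _ τ _ h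
    ext a
    exact f₀.injective (DFunLike.congr_fun h a)
  · intro f hf
    simp only [mem_filter, mem_univ, true_and] at hf
    have key : ∀ a, ∃ b, f₀ b = f a := fun a => by
      have : f a ∈ f.toSubgraph.verts := ⟨a, trivial, rfl⟩
      rw [hf] at this
      obtain ⟨b, -, hb⟩ := this
      exact ⟨b, hb⟩
    choose s hs using key
    have hinj : Function.Injective s := fun a b h => f.injective (by
      change f a = f b
      rw [← hs, ← hs, h])
    refine ⟨⟨Equiv.ofBijective s (Finite.injective_iff_bijective.1 hinj), ?_⟩, mem_univ _, ?_⟩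
    · intro a b
      change F.Adj (s a) (s b) ↔ F.Adj a b
      rw [← toSubgraph_adj_apply f₀, hs, hs, ← hf, toSubgraph_adj_apply]
    · exact SimpleGraph.Copy.ext hs

/-- The number of bowtie subgraphs is the number of labelled bowties up to a constant factor. -/
lemma bow_eq_copyCount_mul (G : SimpleGraph V) :
    bow G = G.copyCount bowtie * Nat.card (bowtie ≃g bowtie) := by
  rw [← labelledCopyCount_bowtie, labelledCopyCount_eq_copyCount_mul]

lemma card_aut_bowtie_pos : 0 < Nat.card (bowtie ≃g bowtie) := by
  have : Finite (bowtie ≃g bowtie) := DFunLike.finite _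
  have : Nonempty (bowtie ≃g bowtie) := ⟨SimpleGraph.Iso.refl⟩
  exact Nat.card_pos

lemma bow_le_bow_iff {G : SimpleGraph V} {H : SimpleGraph W} :
    bow G ≤ bow H ↔ G.copyCount bowtie ≤ H.copyCount bowtie := by
  rw [bow_eq_copyCount_mul, bow_eq_copyCount_mul]
  exact Nat.mul_le_mul_right_iff card_aut_bowtie_pos

lemma bow_eq_zero_iff {G : SimpleGraph V} : bow G = 0 ↔ bowtie.Free G := by
  rw [← labelledCopyCount_bowtie, SimpleGraph.labelledCopyCount_eq_zero]

lemma bow_iso {G : SimpleGraph V} {H : SimpleGraph W} (e : G ≃g H) : bow H = bow G := by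
  rw [← labelledCopyCount_bowtie, ← labelledCopyCount_bowtie, labelledCopyCount_eq_card_univ,
    labelledCopyCount_eq_card_univ]
  refine (card_bij (fun f _ => e.toCopy.comp f) ?_ ?_ ?_).symm
  · intro f _; exact mem_univ _
  · intro f _ g _ h
    exact SimpleGraph.Copy.ext fun a => e.injective (DFunLike.congr_fun h a)
  · intro f _
    exact ⟨e.symm.toCopy.comp f, mem_univ _, SimpleGraph.Copy.ext fun a => e.apply_symm_apply _⟩

section

/-! ### Joins of two graphs -/

/-- The join of two graphs: their disjoint union together with all edges between them. -/
def join (G₁ : SimpleGraph α) (G₂ : SimpleGraph β) : SimpleGraph (α ⊕ β) where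
  Adj
    | .inl u, .inl v => G₁.Adj u v
    | .inr u, .inr v => G₂.Adj u v
    | _, _ => True
  symm := ⟨by rintro (u | u) (v | v) h <;> first | exact h.symm | trivial⟩
  loopless := ⟨by rintro (u | u) h <;> exact h.ne rfl⟩

variable (G₁ : SimpleGraph α) (G₂ : SimpleGraph β)

lemma join_adj_inl_inl (u v : α) : (join G₁ G₂).Adj (.inl u) (.inl v) ↔ G₁.Adj u v := Iff.rfl
lemma join_adj_inr_inr (u v : β) : (join G₁ G₂).Adj (.inr u) (.inr v) ↔ G₂.Adj u v := Iff.rfl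
lemma join_adj_inl_inr (u : α) (v : β) : (join G₁ G₂).Adj (.inl u) (.inr v) ↔ True := Iff.rfl
lemma join_adj_inr_inl (u : α) (v : β) : (join G₁ G₂).Adj (.inr v) (.inl u) ↔ True := Iff.rfl

/-- The join does not depend on the order of the two graphs. -/
def joinComm : join G₁ G₂ ≃g join G₂ G₁ where
  toEquiv := Equiv.sumComm α β
  map_rel_iff' := by rintro (u | u) (v | v) <;> exact Iff.rfl

lemma dg_eq_sum (R : SimpleGraph V) (v : V) : (dg R v : ℤ) = ∑ w, if R.Adj v w then 1 else 0 :=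
  (sum_ind_eq_dg R v).symm

lemma dg_join_inl (u : α) : (dg (join G₁ G₂) (.inl u) : ℤ) = dg G₁ u + Fintype.card β := by
  simp only [dg_eq_sum, Fintype.sum_sum_type, join_adj_inl_inl, join_adj_inl_inr]
  simp

lemma dg_join_inr (u : β) : (dg (join G₁ G₂) (.inr u) : ℤ) = dg G₂ u + Fintype.card α := by
  simp only [dg_eq_sum, Fintype.sum_sum_type, join_adj_inr_inr, join_adj_inr_inl]
  simp [add_comm]

lemma vol_join : (vol (join G₁ G₂) : ℤ) =
    vol G₁ + vol G₂ + 2 * Fintype.card α * Fintype.card β := by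
  simp only [vol, Fintype.sum_sum_type]
  push_cast
  simp only [dg_join_inl, dg_join_inr, sum_add_distrib, sum_const, card_univ, nsmul_eq_mul]
  ring

lemma dg_link_join_inl_inl (c u : α) : (dg (link (join G₁ G₂) (.inl c)) (.inl u) : ℤ) =
    dg (link G₁ c) u + (Fintype.card β) * (if G₁.Adj c u then 1 else 0) := by
  simp only [dg_eq_sum, Fintype.sum_sum_type, link_adj, join_adj_inl_inl, join_adj_inl_inr,
    and_true]
  simp

lemma dg_link_join_inl_inr (c : α) (v : β) : (dg (link (join G₁ G₂) (.inl c)) (.inr v) : ℤ) =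
    dg G₁ c + dg G₂ v := by
  simp only [dg_eq_sum, Fintype.sum_sum_type, link_adj, join_adj_inl_inl, join_adj_inl_inr,
    join_adj_inr_inl, join_adj_inr_inr, true_and, and_true]

lemma dg_link_eq_zero {H : SimpleGraph V} {c u : V} (h : ¬ H.Adj c u) : dg (link H c) u = 0 := by
  simp [dg, link_adj, h]

/-- The labelled bowties of a join with a given centre in the first part. -/
lemma disjPairs_link_join_inl (c : α) : (disjPairs (link (join G₁ G₂) (.inl c)) : ℤ) =
    disjPairs (link G₁ c)
      + vol (link G₁ c) * (4 * Fintype.card β * ((dg G₁ c : ℤ) - 2) + 2 * vol G₂)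
      + (2 * Fintype.card β * dg G₁ c + vol G₂) ^ 2 + 2 * (2 * Fintype.card β * dg G₁ c + vol G₂)
      - 4 * Fintype.card β ^ 2 * dg G₁ c - 4 * ∑ v, (dg G₂ v : ℤ) ^ 2 - 8 * dg G₁ c * vol G₂
      - 4 * Fintype.card β * (dg G₁ c : ℤ) ^ 2 := by
  rw [disjPairs_eq, disjPairs_eq]
  set b : ℤ := (Fintype.card β : ℤ) with hb
  have hvol : (vol (link (join G₁ G₂) (.inl c)) : ℤ) =
      vol (link G₁ c) + 2 * b * dg G₁ c + vol G₂ := by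
    simp only [vol, Fintype.sum_sum_type]
    push_cast
    simp only [dg_link_join_inl_inl, dg_link_join_inl_inr, sum_add_distrib, ← mul_sum, ← dg_eq_sum, sum_const, card_univ, nsmul_eq_mul]
    ring
  have hsq : ∑ u, (dg (link (join G₁ G₂) (.inl c)) u : ℤ) ^ 2 =
      ∑ u, (dg (link G₁ c) u : ℤ) ^ 2 + 2 * b * vol (link G₁ c) + b ^ 2 * dg G₁ c
      + b * (dg G₁ c : ℤ) ^ 2 + 2 * dg G₁ c * vol G₂ + ∑ v, (dg G₂ v : ℤ) ^ 2 := by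
    simp only [Fintype.sum_sum_type, dg_link_join_inl_inl, dg_link_join_inl_inr, ← hb]
    have h1 : ∀ u, ((dg (link G₁ c) u : ℤ) + b * (if G₁.Adj c u then 1 else 0)) ^ 2 =
        (dg (link G₁ c) u : ℤ) ^ 2 + 2 * b * dg (link G₁ c) u
          + b ^ 2 * (if G₁.Adj c u then 1 else 0) := fun u => by
      by_cases h : G₁.Adj c u
      · simp only [h, if_true]; ring
      · simp [h, dg_link_eq_zero h]
    have h2 : ∀ v, ((dg G₁ c : ℤ) + dg G₂ v) ^ 2 =
        (dg G₁ c : ℤ) ^ 2 + 2 * dg G₁ c * dg G₂ v + (dg G₂ v : ℤ) ^ 2 := fun v => by ring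
    simp only [h1, h2, sum_add_distrib, ← mul_sum, ← dg_eq_sum, sum_const, card_univ, nsmul_eq_mul,
      vol, Nat.cast_sum]
    ring
  rw [hvol, hsq]
  ring

/-- The bowties of a join with centre in the first part, apart from those which use a triangle
of the first graph. -/
lemma sum_disjPairs_link_join_inl :
    ∑ c : α, (disjPairs (link (join G₁ G₂) (.inl c)) : ℤ) =
    bow G₁ + ∑ c, vol (link G₁ c) * (4 * Fintype.card β * ((dg G₁ c : ℤ) - 2) + 2 * vol G₂)
      + (4 * Fintype.card β * (Fintype.card β - 1) * ∑ c, (dg G₁ c : ℤ) ^ 2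
      - 4 * Fintype.card α * ∑ c, (dg G₂ c : ℤ) ^ 2
      + (4 * Fintype.card β - 8) * vol G₁ * vol G₂ + Fintype.card α * vol G₂ ^ 2
      + 4 * Fintype.card β * vol G₁ + 2 * Fintype.card α * vol G₂
      - 4 * Fintype.card β ^ 2 * vol G₁) := by
  set b : ℤ := (Fintype.card β : ℤ) with hb
  have h1 : ∀ c, (disjPairs (link (join G₁ G₂) (.inl c)) : ℤ) =
      disjPairs (link G₁ c)
        + vol (link G₁ c) * (4 * b * ((dg G₁ c : ℤ) - 2) + 2 * vol G₂)
        + ((4 * b * (b - 1)) * (dg G₁ c : ℤ) ^ 2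
        + (4 * b * vol G₂ + 4 * b - 4 * b ^ 2 - 8 * vol G₂) * dg G₁ c
        + (vol G₂ ^ 2 + 2 * vol G₂ - 4 * ∑ v, (dg G₂ v : ℤ) ^ 2)) := fun c => by
    rw [disjPairs_link_join_inl]; ring
  simp only [h1, sum_add_distrib, sum_const, card_univ, nsmul_eq_mul]
  rw [bow_eq_sum_disjPairs, ← mul_sum, ← mul_sum]
  have h2 : ∑ c, (dg G₁ c : ℤ) = vol G₁ := by simp [vol]
  rw [h2]
  push_cast
  ring

lemma disjPairs_iso {G : SimpleGraph V} {H : SimpleGraph W}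
    (e : G ≃g H) : (disjPairs H : ℤ) = disjPairs G := by
  rw [disjPairs_eq, disjPairs_eq, vol_iso e, ← e.toEquiv.sum_comp]
  congr 2
  exact sum_congr rfl fun v _ => by rw [← dg_iso e v]; rfl

lemma disjPairs_link_iso {G : SimpleGraph V}
    {H : SimpleGraph W} (e : G ≃g H) (c : V) :
    (disjPairs (link H (e c)) : ℤ) = disjPairs (link G c) :=
  disjPairs_iso ⟨e.toEquiv, by
    intro a b
    exact and_congr e.map_adj_iff (and_congr e.map_adj_iff e.map_adj_iff)⟩

/-- The number of labelled bowties in a join. -/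
lemma bow_join : (bow (join G₁ G₂) : ℝ) = bow G₁ + bow G₂
    + ∑ c, (vol (link G₁ c) : ℝ) * (4 * Fintype.card β * ((dg G₁ c : ℝ) - 2) + 2 * vol G₂)
    + ∑ c, (vol (link G₂ c) : ℝ) * (4 * Fintype.card α * ((dg G₂ c : ℝ) - 2) + 2 * vol G₁)
    + 4 * bowPoly (Fintype.card α) (Fintype.card β) (vol G₁ / 2) (vol G₂ / 2)
      (∑ c, (dg G₁ c : ℝ) ^ 2) (∑ c, (dg G₂ c : ℝ) ^ 2) := by
  have h1 := sum_disjPairs_link_join_inl G₁ G₂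
  have h2 := sum_disjPairs_link_join_inl G₂ G₁
  have h3 : ∀ c, (disjPairs (link (join G₂ G₁) (.inl c)) : ℤ) =
      disjPairs (link (join G₁ G₂) (.inr c)) := fun c =>
    disjPairs_link_iso (joinComm G₁ G₂) (.inr c)
  simp_rw [h3] at h2
  have h4 : (bow (join G₁ G₂) : ℤ) = ∑ c : α, (disjPairs (link (join G₁ G₂) (.inl c)) : ℤ)
      + ∑ c : β, (disjPairs (link (join G₁ G₂) (.inr c)) : ℤ) := by
    rw [bow_eq_sum_disjPairs]; push_cast; rw [Fintype.sum_sum_type]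
  rw [h1, h2] at h4
  have h5 := congrArg (Int.cast : ℤ → ℝ) h4
  push_cast at h5
  rw [h5]
  unfold bowPoly
  ring

lemma two_le_dg_of_vol_link_ne_zero {H : SimpleGraph V} {c : V} (h : vol (link H c) ≠ 0) :
    2 ≤ dg H c := by
  rw [vol_eq_card, Finset.card_ne_zero] at h
  obtain ⟨⟨u, v⟩, huv⟩ := h
  simp only [mem_filter, mem_univ, true_and, link_adj] at huv
  rw [dg, ← card_pair huv.2.2.ne]
  refine card_le_card fun w => ?_
  simp only [mem_insert, mem_singleton, mem_filter, mem_univ, true_and]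
  rintro (rfl | rfl)
  exacts [huv.1, huv.2.1]

lemma vol_link_mul_nonneg (G : SimpleGraph V) (c : V) (m k : ℕ) :
    (0 : ℝ) ≤ vol (link G c) * (4 * m * ((dg G c : ℝ) - 2) + 2 * k) := by
  by_cases h : vol (link G c) = 0
  · simp [h]
  · have : (2 : ℝ) ≤ dg G c := by exact_mod_cast two_le_dg_of_vol_link_ne_zero h
    have : (0 : ℝ) ≤ (dg G c : ℝ) - 2 := by linarith
    positivity

lemma bow_eq_zero_of_vol_link {G : SimpleGraph V} (h : ∀ c, vol (link G c) = 0) : bow G = 0 := by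
  have h' : ∀ c v, dg (link G c) v = 0 := fun c v => by
    have := h c
    rw [vol, sum_eq_zero_iff] at this
    exact this v (mem_univ v)
  have := bow_eq G
  simp only [h, h'] at this
  simpa using this

/-- A lower bound for the number of bowties of a join, attained by joins of triangle-free graphs. -/
lemma bowPoly_le_bow_join :
    4 * bowPoly (Fintype.card α) (Fintype.card β) (vol G₁ / 2) (vol G₂ / 2)
      (∑ c, (dg G₁ c : ℝ) ^ 2) (∑ c, (dg G₂ c : ℝ) ^ 2) ≤ bow (join G₁ G₂) := by
  have h1 := sum_nonneg fun c (_ : c ∈ univ) =>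
    vol_link_mul_nonneg G₁ c (Fintype.card β) (vol G₂)
  have h2 := sum_nonneg fun c (_ : c ∈ univ) =>
    vol_link_mul_nonneg G₂ c (Fintype.card α) (vol G₁)
  rw [bow_join]
  have : (0 : ℝ) ≤ bow G₁ := Nat.cast_nonneg _
  have : (0 : ℝ) ≤ bow G₂ := Nat.cast_nonneg _
  linarith

lemma bow_join_of_triangleFree (h₁ : ∀ c, vol (link G₁ c) = 0) (h₂ : ∀ c, vol (link G₂ c) = 0) :
    (bow (join G₁ G₂) : ℝ) =
    4 * bowPoly (Fintype.card α) (Fintype.card β) (vol G₁ / 2) (vol G₂ / 2)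
      (∑ c, (dg G₁ c : ℝ) ^ 2) (∑ c, (dg G₂ c : ℝ) ^ 2) := by
  rw [bow_join, bow_eq_zero_of_vol_link h₁, bow_eq_zero_of_vol_link h₂]
  simp [h₁, h₂]

/-- Convexity: the sum of squared degrees is at least what near-regularity would give. -/
lemma sqDeg_le_sum_sq (G : SimpleGraph V) (r : ℕ) :
    sqDeg (Fintype.card V) (vol G / 2) r ≤ ∑ v, (dg G v : ℝ) ^ 2 := by
  have h : ∀ v, (0 : ℝ) ≤ (dg G v : ℝ) ^ 2 - (2 * r + 1) * dg G v + r * (r + 1) := fun v => by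
    rcases le_or_gt (dg G v) r with h | h
    · have : (dg G v : ℝ) ≤ r := by exact_mod_cast h
      nlinarith
    · have : (r : ℝ) + 1 ≤ dg G v := by exact_mod_cast h
      nlinarith
  have := sum_nonneg fun v (_ : v ∈ univ) => h v
  simp only [sum_add_distrib, sum_sub_distrib, ← mul_sum, sum_const, card_univ, nsmul_eq_mul] at this
  have h2 : ∑ c, (dg G c : ℝ) = vol G := by simp [vol]
  rw [h2] at this
  unfold sqDeg
  linarith

end

/-! ### Triangle-free near-regular graphs -/

/-- The graph on `ZMod m` in which `u` is joined to `u ± 3, u ± 5, …, u ± (2 * s + 1)` and, when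
`u ∈ K`, also to `u + 1`. -/
def oddCirculant (m s : ℕ) (K : Finset (ZMod m)) : SimpleGraph (ZMod m) where
  Adj u v := u ≠ v ∧ ((∃ i < s, v = u + (2 * i + 3 : ℕ) ∨ u = v + (2 * i + 3 : ℕ)) ∨
    (v = u + 1 ∧ u ∈ K) ∨ (u = v + 1 ∧ v ∈ K))
  symm := ⟨by
    rintro u v ⟨hne, h⟩
    refine ⟨hne.symm, ?_⟩
    rcases h with ⟨i, hi, h⟩ | h | h
    · exact .inl ⟨i, hi, h.symm⟩
    · exact .inr (.inr h)
    · exact .inr (.inl h)⟩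
  loopless := ⟨fun _ h => h.1 rfl⟩

/-- The signed differences occurring at a vertex `u` of `oddCirculant m s K`. -/
def oddDiffs {m : ℕ} (s : ℕ) (K : Finset (ZMod m)) (u : ZMod m) : Finset ℤ :=
  ((range s).image (fun i : ℕ => (2 * i + 3 : ℤ)) ∪ (range s).image (fun i : ℕ => -(2 * i + 3 : ℤ)))
    ∪ ((if u ∈ K then {1} else ∅) ∪ (if u - 1 ∈ K then {-1} else ∅))

lemma mem_oddDiffs {m s : ℕ} {K : Finset (ZMod m)} {u : ZMod m} {d : ℤ} :
    d ∈ oddDiffs s K u ↔ (∃ i < s, d = 2 * i + 3 ∨ d = -(2 * i + 3)) ∨ (d = 1 ∧ u ∈ K) ∨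
      (d = -1 ∧ u - 1 ∈ K) := by
  have h1 : d ∈ (if u ∈ K then ({1} : Finset ℤ) else ∅) ↔ d = 1 ∧ u ∈ K := by
    split_ifs with h <;> simp [h]
  have h2 : d ∈ (if u - 1 ∈ K then ({-1} : Finset ℤ) else ∅) ↔ d = -1 ∧ u - 1 ∈ K := by
    split_ifs with h <;> simp [h]
  rw [oddDiffs, mem_union, mem_union, mem_union, h1, h2]
  simp only [mem_image, mem_range]
  constructor
  · rintro ((⟨i, hi, rfl⟩ | ⟨i, hi, rfl⟩) | h)
    · exact .inl ⟨i, hi, .inl rfl⟩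
    · exact .inl ⟨i, hi, .inr rfl⟩
    · exact .inr h
  · rintro (⟨i, hi, rfl | rfl⟩ | h)
    · exact .inl (.inl ⟨i, hi, rfl⟩)
    · exact .inl (.inr ⟨i, hi, rfl⟩)
    · exact .inr h

lemma oddDiffs_spec {m s : ℕ} {K : Finset (ZMod m)} {u : ZMod m} {d : ℤ}
    (h : d ∈ oddDiffs s K u) : d % 2 = 1 ∧ |d| ≤ 2 * s + 1 := by
  rw [mem_oddDiffs] at h
  rw [abs_le]
  rcases h with ⟨i, hi, rfl | rfl⟩ | ⟨rfl, -⟩ | ⟨rfl, -⟩ <;> omega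

lemma card_oddDiffs {m s : ℕ} (K : Finset (ZMod m)) (u : ZMod m) :
    #(oddDiffs s K u) = 2 * s + ((if u ∈ K then 1 else 0) + (if u - 1 ∈ K then 1 else 0)) := by
  rw [oddDiffs, card_union_of_disjoint, card_union_of_disjoint, card_union_of_disjoint,
    card_image_of_injective, card_image_of_injective, card_range]
  · split_ifs <;> simp <;> omega
  · intro i j h; simpa using h
  · intro i j h; simpa using h
  · rw [disjoint_left]
    intro d h1 h2
    split_ifs at h1 h2 <;> simp_all
  · rw [disjoint_left]
    intro d h1 h2
    simp only [mem_image, mem_range] at h1 h2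
    obtain ⟨i, -, rfl⟩ := h1
    obtain ⟨j, -, h2⟩ := h2
    omega
  · rw [disjoint_left]
    intro d h1 h2
    simp only [mem_union, mem_image, mem_range] at h1 h2
    have h3 : d = 1 ∨ d = -1 := by split_ifs at h2 <;> simp at h2 <;> tauto
    rcases h1 with ⟨i, -, rfl⟩ | ⟨i, -, rfl⟩ <;> omega

lemma intCast_eq_zero_of_abs_lt {m : ℕ} {d : ℤ} (h : (d : ZMod m) = 0) (hd : |d| < m) : d = 0 := by
  rw [ZMod.intCast_zmod_eq_zero_iff_dvd] at h
  exact Int.eq_zero_of_abs_lt_dvd h hd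

lemma oddCirculant_adj_iff {m s : ℕ} (hm : 2 * s + 1 < m) (K : Finset (ZMod m)) (u v : ZMod m) :
    (oddCirculant m s K).Adj u v ↔ ∃ d ∈ oddDiffs s K u, v = u + (d : ZMod m) := by
  constructor
  · rintro ⟨-, ⟨i, hi, rfl | rfl⟩ | ⟨rfl, h⟩ | ⟨rfl, h⟩⟩
    · exact ⟨2 * i + 3, mem_oddDiffs.2 (.inl ⟨i, hi, .inl rfl⟩), by push_cast; ring⟩
    · exact ⟨-(2 * i + 3), mem_oddDiffs.2 (.inl ⟨i, hi, .inr rfl⟩), by push_cast; ring⟩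
    · exact ⟨1, mem_oddDiffs.2 (.inr (.inl ⟨rfl, h⟩)), by push_cast; ring⟩
    · exact ⟨-1, mem_oddDiffs.2 (.inr (.inr ⟨rfl, by simpa using h⟩)), by push_cast; ring⟩
  · rintro ⟨d, hd, rfl⟩
    have hs := oddDiffs_spec hd
    refine ⟨fun h => ?_, ?_⟩
    · have : (d : ZMod m) = 0 := by simpa using h.symm
      have := intCast_eq_zero_of_abs_lt this (by omega)
      omega
    · rcases mem_oddDiffs.1 hd with ⟨i, hi, rfl | rfl⟩ | ⟨rfl, h⟩ | ⟨rfl, h⟩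
      · exact .inl ⟨i, hi, .inl (by push_cast; ring)⟩
      · exact .inl ⟨i, hi, .inr (by push_cast; ring)⟩
      · exact .inr (.inl ⟨by push_cast; ring, h⟩)
      · exact .inr (.inr ⟨by push_cast; ring, by push_cast; rwa [← sub_eq_add_neg]⟩)

lemma dg_oddCirculant {m s : ℕ} [NeZero m] (hm : 4 * s + 2 < m) (K : Finset (ZMod m)) (u : ZMod m) :
    dg (oddCirculant m s K) u =
      2 * s + ((if u ∈ K then 1 else 0) + (if u - 1 ∈ K then 1 else 0)) := by
  rw [← card_oddDiffs, dg, ← card_image_of_injOn (s := oddDiffs s K u)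
    (f := fun d : ℤ => u + (d : ZMod m))]
  · congr 1
    ext v
    simp only [mem_filter, mem_univ, true_and, mem_image]
    rw [oddCirculant_adj_iff (by omega)]
    simp only [eq_comm]
  · intro d hd e he h
    have h1 : ((d - e : ℤ) : ZMod m) = 0 := by
      push_cast; simpa [sub_eq_zero] using h
    have hd' := (oddDiffs_spec hd).2
    have he' := (oddDiffs_spec he).2
    rw [abs_le] at hd' he'
    have := intCast_eq_zero_of_abs_lt h1 (by rw [abs_lt]; omega)
    omega

/-- A sum of three odd numbers is not zero. -/
lemma vol_link_oddCirculant {m s : ℕ} [NeZero m] (hm : 6 * s + 3 < m) (K : Finset (ZMod m))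
    (c : ZMod m) : vol (link (oddCirculant m s K) c) = 0 := by
  by_contra h
  rw [vol_eq_card, ← Ne, Finset.card_ne_zero] at h
  obtain ⟨⟨u, v⟩, huv⟩ := h
  simp only [mem_filter, mem_univ, true_and, link_adj] at huv
  obtain ⟨h1, h2, h3⟩ := huv
  have h2 := h2.symm
  rw [oddCirculant_adj_iff (by omega)] at h1 h2 h3
  obtain ⟨d, hd, rfl⟩ := h1
  obtain ⟨e, he, rfl⟩ := h3
  obtain ⟨f, hf, h⟩ := h2
  have hd := oddDiffs_spec hd
  have he := oddDiffs_spec he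
  have hf := oddDiffs_spec hf
  simp only [abs_le] at hd he hf
  have h0 : ((d + e + f : ℤ) : ZMod m) = 0 := by
    push_cast
    linear_combination -h
  have := intCast_eq_zero_of_abs_lt h0 (by rw [abs_lt]; omega)
  omega

/-- The first `f` even residues modulo `m`. -/
def evenInitial (m f : ℕ) : Finset (ZMod m) := (range f).image (fun i : ℕ => ((2 * i : ℕ) : ZMod m))

lemma mem_evenInitial {m f : ℕ} [NeZero m] (hf : 2 * f ≤ m) {u : ZMod m} :
    u ∈ evenInitial m f ↔ u.val % 2 = 0 ∧ u.val < 2 * f := by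
  simp only [evenInitial, mem_image, mem_range]
  constructor
  · rintro ⟨i, hi, rfl⟩
    have hlt : 2 * i < m := by omega
    rw [ZMod.val_natCast, Nat.mod_eq_of_lt hlt]
    omega
  · rintro ⟨h1, h2⟩
    refine ⟨u.val / 2, by omega, ?_⟩
    rw [show 2 * (u.val / 2) = u.val by omega, ZMod.natCast_zmod_val]

lemma card_evenInitial {m f : ℕ} [NeZero m] (hf : 2 * f ≤ m) : #(evenInitial m f) = f := by
  rw [evenInitial, card_image_of_injOn, card_range]
  intro i hi j hj h
  simp only [coe_range, Set.mem_Iio] at hi hj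
  have := congrArg ZMod.val h
  simp only at this
  rw [ZMod.val_natCast, ZMod.val_natCast, Nat.mod_eq_of_lt (by omega),
    Nat.mod_eq_of_lt (by omega)] at this
  omega

lemma sub_one_notMem_evenInitial {m f : ℕ} [NeZero m] (hm : 1 < m) (hf : 2 * f ≤ m) {u : ZMod m}
    (hu : u ∈ evenInitial m f) : u - 1 ∉ evenInitial m f := by
  intro h
  rw [mem_evenInitial hf] at hu h
  have : Fact (1 < m) := ⟨hm⟩
  rcases Nat.lt_or_ge ((u - 1).val + 1) m with h1 | h1
  · have : (u - 1 + 1).val = (u - 1).val + 1 := by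
      rw [ZMod.val_add, ZMod.val_one, Nat.mod_eq_of_lt h1]
    rw [sub_add_cancel] at this
    omega
  · have := ZMod.val_lt (u - 1)
    omega

lemma vol_oddCirculant {m s : ℕ} [NeZero m] (hm : 4 * s + 2 < m) (K : Finset (ZMod m)) :
    vol (oddCirculant m s K) = 2 * (m * s + #K) := by
  have h : ∑ u : ZMod m, (if u - 1 ∈ K then 1 else 0) = ∑ u : ZMod m, if u ∈ K then 1 else 0 :=
    (Equiv.subRight (1 : ZMod m)).sum_comp fun u => if u ∈ K then 1 else 0
  simp only [vol, dg_oddCirculant hm, sum_add_distrib, h]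
  simp [ZMod.card]
  ring

/-- There are triangle-free graphs with any (not too large) number `e` of edges whose degrees are as
equal as possible; `r` is the smaller of the two occurring degrees. -/
lemma exists_triangleFree_nearRegular {m e : ℕ} [NeZero m] (hm : 1000 ≤ m)
    (he : 100 * e ≤ m ^ 2) :
    ∃ (G : SimpleGraph (ZMod m)) (r : ℕ), vol G = 2 * e ∧ (∀ c, vol (link G c) = 0) ∧
      r * m ≤ 2 * e ∧ 2 * e ≤ (r + 1) * m ∧ ∑ v, (dg G v : ℝ) ^ 2 = sqDeg m e r := by
  suffices h : ∃ (G : SimpleGraph (ZMod m)) (r : ℕ), vol G = 2 * e ∧ (∀ c, vol (link G c) = 0) ∧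
      ∀ v, dg G v = r ∨ dg G v = r + 1 by
    obtain ⟨G, r, h1, h2, h3⟩ := h
    refine ⟨G, r, h1, h2, ?_, ?_, ?_⟩
    · rw [← h1, vol]
      calc r * m = ∑ v : ZMod m, r := by simp [ZMod.card, mul_comm]
        _ ≤ _ := sum_le_sum fun v _ => by have := h3 v; omega
    · rw [← h1, vol]
      calc _ ≤ ∑ v : ZMod m, (r + 1) := sum_le_sum fun v _ => by have := h3 v; omega
        _ = _ := by simp [ZMod.card, mul_comm]
    · have h4 : ∀ v, (dg G v : ℝ) ^ 2 = (2 * r + 1) * dg G v - r * (r + 1) := fun v => by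
        rcases h3 v with h | h <;> rw [h] <;> push_cast <;> ring
      have h5 : ∑ v, (dg G v : ℝ) = 2 * e := by
        rw [← Nat.cast_sum]; change ((vol G : ℕ) : ℝ) = _; rw [h1]; push_cast; ring
      simp only [h4, sum_sub_distrib, ← mul_sum, h5, sum_const, card_univ, ZMod.card, nsmul_eq_mul]
      unfold sqDeg
      ring
  have hs : 100 * (e / m) ≤ m := by
    by_contra h
    push Not at h
    have h1 : m * (100 * (e / m)) ≤ 100 * e := by
      have := Nat.mul_div_le e m
      linarith
    nlinarith
  have hdm : m * (e / m) + e % m = e := Nat.div_add_mod e m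
  have hlt : e % m < m := Nat.mod_lt _ (by omega)
  set s := e / m
  set f := e % m
  -- `m * s` edges come from the differences `±3, …, ±(2 * s + 1)`, and `f` further ones from the
  -- difference `±1`. They form a matching if `2 * f ≤ m`, and the complement of one otherwise.
  rcases Nat.lt_or_ge m (2 * f) with hf | hf
  · have hf' : 2 * (m - f) ≤ m := by omega
    refine ⟨oddCirculant m s (evenInitial m (m - f))ᶜ, 2 * s + 1, ?_,
      vol_link_oddCirculant (by omega) _, fun v => ?_⟩
    · rw [vol_oddCirculant (by omega), card_compl, ZMod.card, card_evenInitial hf']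
      omega
    · rw [dg_oddCirculant (by omega)]
      simp only [mem_compl]
      have := sub_one_notMem_evenInitial (u := v) (by omega) hf'
      by_cases h1 : v ∈ evenInitial m (m - f) <;> by_cases h2 : v - 1 ∈ evenInitial m (m - f) <;>
        simp [h1, h2] <;> tauto
  · refine ⟨oddCirculant m s (evenInitial m f), 2 * s, ?_,
      vol_link_oddCirculant (by omega) _, fun v => ?_⟩
    · rw [vol_oddCirculant (by omega), card_evenInitial hf]
      omega
    · rw [dg_oddCirculant (by omega)]
      have := sub_one_notMem_evenInitial (u := v) (by omega) hf
      by_cases h1 : v ∈ evenInitial m f <;> by_cases h2 : v - 1 ∈ evenInitial m f <;>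
        simp [h1, h2] <;> tauto

/-! ### Optimal joins are balanced -/

/-- `H` has the fewest bowties among the graphs on its vertex set with the same number of edges. -/
def Opt (H : SimpleGraph V) : Prop := ∀ H' : SimpleGraph V, vol H' = vol H → bow H ≤ bow H'

lemma Opt.bow_le {H : SimpleGraph V} (hH : Opt H) {H' : SimpleGraph W}
    (hc : Fintype.card W = Fintype.card V) (hv : vol H' = vol H) : bow H ≤ bow H' := by
  obtain ⟨e⟩ := Fintype.card_eq.1 hc.symm
  rw [bow_iso (SimpleGraph.Iso.comap e H')]
  exact hH _ (by rw [← hv, ← vol_iso (SimpleGraph.Iso.comap e H')])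

lemma Opt.iso {H : SimpleGraph V} (hH : Opt H) {H' : SimpleGraph W} (e : H ≃g H') : Opt H' :=
  fun K hK => by
    rw [bow_iso e]
    exact hH.bow_le (Fintype.card_congr e.toEquiv).symm (by rw [hK, vol_iso e])

/-- A join of two triangle-free near-regular graphs. -/
lemma exists_nearRegular_join {a b x y : ℕ} (ha : 1000 ≤ a) (hb : 1000 ≤ b)
    (hx : 100 * x ≤ a ^ 2) (hy : 100 * y ≤ b ^ 2) :
    ∃ (W : Type) (_ : Fintype W) (H : SimpleGraph W) (r s : ℕ), Fintype.card W = a + b ∧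
      vol H = 2 * (x + y + a * b) ∧ r * a ≤ 2 * x ∧ s * b ≤ 2 * y ∧ 2 * y ≤ (s + 1) * b ∧
      (bow H : ℝ) = 4 * bowPoly a b x y (sqDeg a x r) (sqDeg b y s) := by
  have : NeZero a := ⟨by omega⟩
  have : NeZero b := ⟨by omega⟩
  obtain ⟨G₁, r, h1, h2, h3, -, h5⟩ := exists_triangleFree_nearRegular ha hx
  obtain ⟨G₂, s, g1, g2, g3, g4, g5⟩ := exists_triangleFree_nearRegular hb hy
  refine ⟨ZMod a ⊕ ZMod b, inferInstance, join G₁ G₂, r, s, by simp [ZMod.card], ?_, h3, g3, g4, ?_⟩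
  · have := vol_join G₁ G₂
    rw [h1, g1, ZMod.card, ZMod.card] at this
    zify
    rw [this]
    push_cast
    ring
  · rw [bow_join_of_triangleFree _ _ h2 g2, h1, g1, h5, g5, ZMod.card, ZMod.card]
    push_cast
    ring_nf

/-- The arithmetic core of `Opt.card_le_of_join`: the lower bound `bowPoly` for a join with parts of
sizes `a`, `b` and `x`, `y` inner edges cannot stay below the values of all near-regular joins if
`a ≥ b + 2`. -/
lemma card_le_of_bowPoly_le {a b x y : ℕ} {p q : ℝ} (hp : ∀ r : ℕ, sqDeg a x r ≤ p)
    (hq : ∀ r : ℕ, sqDeg b y r ≤ q) (hb : 100000 ≤ b) (hab : 100000 * a ≤ 100001 * b)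
    (hxyN : 100000 * (x + y) ≤ b ^ 2) (hE : (a + b) ^ 2 < 2 * (2 * (x + y + a * b)))
    (hcmp : ∀ {a' b' x' y' : ℕ}, 1000 ≤ a' → 1000 ≤ b' → 100 * x' ≤ a' ^ 2 → 100 * y' ≤ b' ^ 2 →
      a' + b' = a + b → x' + y' + a' * b' = x + y + a * b →
      ∃ r s : ℕ, r * a' ≤ 2 * x' ∧ s * b' ≤ 2 * y' ∧ 2 * y' ≤ (s + 1) * b' ∧
        bowPoly a b x y p q ≤ bowPoly a' b' x' y' (sqDeg a' x' r) (sqDeg b' y' s)) :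
    a ≤ b + 1 := by
  by_contra hcon
  push Not at hcon
  obtain ⟨k, hk⟩ := Nat.exists_eq_add_of_lt hcon
  have hbR : (100000 : ℝ) ≤ b := by exact_mod_cast hb
  obtain ⟨K, hKk⟩ : ∃ K, K = k + 1 := ⟨_, rfl⟩
  have hK : 1 ≤ K := by omega
  have haK : a = b + K + 1 := by omega
  have hKR : (1 : ℝ) ≤ K := by exact_mod_cast hK
  have haR : (a : ℝ) = b + K + 1 := by rw [haK]; push_cast; ring
  have hKb : 100000 * K ≤ b := by omega
  have hKbR : (100000 : ℝ) * K ≤ b := by exact_mod_cast hKb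
  have hxyR : (100000 : ℝ) * (x + y) ≤ b ^ 2 := by exact_mod_cast hxyN
  have hab2 : b ^ 2 ≤ a ^ 2 := by gcongr; omega
  have hKxy : K + 1 ≤ x + y := by
    have h1 : (K + 1) ^ 2 < 4 * (x + y) := by
      rw [haK] at hE; nlinarith
    have h2 : 4 * K ≤ (K + 1) ^ 2 := by zify; nlinarith [sq_nonneg ((K : ℤ) - 1)]
    omega
  -- the inner edges are distributed almost evenly
  have hu : (x : ℝ) - y ≤ (a + b) / 4 * (1 + K / 25) := by
    by_contra hu
    push Not at hu
    have hu2 : (b : ℝ) / 2 ≤ x - y := by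
      have : (b : ℝ) / 2 * 1 ≤ (a + b) / 4 * (1 + K / 25) :=
        mul_le_mul (by linarith) (by linarith) (by norm_num) (by positivity)
      linarith
    obtain ⟨t, ht1, ht2⟩ : ∃ t : ℕ, 2 * t ≤ b ∧ b ≤ 2 * t + 1 := ⟨b / 2, by omega, by omega⟩
    have ht1R : (2 : ℝ) * t ≤ b := by exact_mod_cast ht1
    have ht2R : (b : ℝ) ≤ 2 * t + 1 := by exact_mod_cast ht2
    have htx : t ≤ x := by
      have : (t : ℝ) ≤ x := by
        have : (0 : ℝ) ≤ y := Nat.cast_nonneg _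
        linarith
      exact_mod_cast this
    obtain ⟨x', rfl⟩ := Nat.exists_eq_add_of_le htx
    obtain ⟨r, s, hr, hs, hs', hle⟩ := hcmp (a' := a) (b' := b) (x' := x') (y' := y + t)
      (by omega) (by omega) (by omega) (by nlinarith) rfl (by ring)
    have hrR : (r : ℝ) * a ≤ 2 * x' := by exact_mod_cast hr
    have := bowPoly_shift_lt (a := a) (b := b) (k := K) (x := (t + x' : ℕ)) (y := y) (t := t)
      (r := r) (p := p) (q := q) (p' := sqDeg a x' r) (q' := sqDeg b (y + t : ℕ) s) hbR hKR hKbR haR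
      (Nat.cast_nonneg _) hxyR ht1R (by linarith) (Nat.cast_nonneg _)
      (by push_cast; linarith [Nat.cast_nonneg (α := ℝ) t]) ?_ ?_ hu
    · have e1 : ((t + x' : ℕ) : ℝ) - t = x' := by push_cast; ring
      have e2 : ((y + t : ℕ) : ℝ) = y + t := by push_cast; ring
      rw [e1, ← e2] at this
      exact absurd hle (not_le.2 this)
    -- The near-regular graph has `t ≈ a / 2` edges fewer, which lowers the degrees by about one, so
    -- the tangent at `r + 1` is the one to compare with.
    · have := hp (r + 1)
      unfold sqDeg at this ⊢
      push_cast at this ⊢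
      linarith
    · rcases s with _ | s
      · have := hq 0
        unfold sqDeg at this ⊢
        push_cast at this ⊢
        linarith [Nat.cast_nonneg (α := ℝ) y]
      · have := hq s
        have h1 : ((s : ℝ) + 1) * (b - 2 * t) ≥ 0 :=
          mul_nonneg (by positivity) (by linarith)
        unfold sqDeg at this ⊢
        push_cast at this ⊢
        linarith
  -- moving one vertex frees `K` edges; they are taken from the larger part as far as possible
  rcases Nat.lt_or_ge x K with hxK | hxK
  · obtain ⟨m, hm⟩ := Nat.exists_eq_add_of_lt hxK
    obtain ⟨y', hy'⟩ : ∃ y', y = y' + (m + 1) := ⟨y - (m + 1), by omega⟩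
    obtain ⟨r, s, hr, hs, hs', hle⟩ := hcmp (a' := a - 1) (b' := b + 1) (x' := 0) (y' := y')
      (by omega) (by omega) (by omega) (by nlinarith) (by omega)
      (by rw [haK, hy', hm]; simp only [Nat.add_sub_cancel]; ring)
    have hr0 : r = 0 := by
      have : r * (a - 1) = 0 := by omega
      rcases Nat.mul_eq_zero.1 this with h | h <;> omega
    have ha1 : ((a - 1 : ℕ) : ℝ) = a - 1 := by rw [Nat.cast_sub (by omega)]; simp
    refine absurd hle (not_le.2 ?_)
    have := bowPoly_move_lt' (a := a) (b := b) (x := x) (y := y) (y' := y') (m := (m + 1 : ℕ))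
      (p := p) (q := q) (s := s) hbR (by exact_mod_cast (by omega : 1 ≤ m + 1)) (Nat.cast_nonneg _)
      (by exact_mod_cast Nat.le_self_pow (by norm_num) x)
      (by rw [haR, hm]; push_cast; ring) (by rw [hy']; push_cast; ring)
      (by exact_mod_cast (by omega : 1 ≤ y')) (by exact_mod_cast hs) ?_ (hq s)
    · have e1 : sqDeg ((a - 1 : ℕ) : ℝ) ((0 : ℕ) : ℝ) (r : ℝ) = 0 := by subst hr0; simp [sqDeg]
      have e2 : ((b + 1 : ℕ) : ℝ) = b + 1 := by push_cast; ring
      rw [e1, e2, ha1, Nat.cast_zero]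
      exact this
    · have := hp 0
      unfold sqDeg at this
      push_cast at this
      linarith
  · obtain ⟨x', rfl⟩ := Nat.exists_eq_add_of_le hxK
    obtain ⟨r, s, hr, hs, hs', hle⟩ := hcmp (a' := a - 1) (b' := b + 1) (x' := x') (y' := y)
      (by omega) (by omega) (by rw [haK, Nat.add_sub_cancel]; nlinarith) (by nlinarith) (by omega)
      (by rw [haK]; simp only [Nat.add_sub_cancel]; ring)
    have ha1 : ((a - 1 : ℕ) : ℝ) = a - 1 := by rw [Nat.cast_sub (by omega)]; simp
    refine absurd hle (not_le.2 ?_)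
    have := bowPoly_move_lt (a := a) (b := b) (x := (K + x' : ℕ)) (x' := x') (y := y)
      (p := p) (q := q) (k := K) (r := r) (s := s) hbR hK hKbR haR (by push_cast; ring)
      (Nat.cast_nonneg _) (Nat.cast_nonneg _) hxyR
      (by exact_mod_cast (by omega : 0 < x' + y))
      (by
        have : (r : ℝ) * ((a - 1 : ℕ) : ℝ) ≤ 2 * x' := by exact_mod_cast hr
        rw [ha1, haR] at this; linarith)
      (by exact_mod_cast hs) (by exact_mod_cast hs') (hp r) (hq s) hu
    have e2 : ((b + 1 : ℕ) : ℝ) = b + 1 := by push_cast; ring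
    rw [ha1, e2]
    exact this

/-- In an optimal join with slightly more than `n ^ 2 / 4` edges, the sizes of the two parts
differ by at most one. -/
theorem Opt.card_le_of_join {G₁ : SimpleGraph α} {G₂ : SimpleGraph β} (hH : Opt (join G₁ G₂))
    (hb : 100000 ≤ Fintype.card β)
    (hab : 100000 * Fintype.card α ≤ 100001 * Fintype.card β)
    (hxy : 50000 * (vol G₁ + vol G₂) ≤ Fintype.card β ^ 2)
    (hE : (Fintype.card α + Fintype.card β) ^ 2 < 2 * vol (join G₁ G₂)) :
    Fintype.card α ≤ Fintype.card β + 1 := by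
  have hlow := bowPoly_le_bow_join G₁ G₂
  have hvol := vol_join G₁ G₂
  have hp := sqDeg_le_sum_sq G₁
  have hq := sqDeg_le_sum_sq G₂
  obtain ⟨x, hx⟩ : ∃ x, vol G₁ = 2 * x := ⟨_, vol_eq_two_mul_ncard G₁⟩
  obtain ⟨y, hy⟩ : ∃ y, vol G₂ = 2 * y := ⟨_, vol_eq_two_mul_ncard G₂⟩
  set a := Fintype.card α with ha
  set b := Fintype.card β with hb'
  set p := ∑ c, (dg G₁ c : ℝ) ^ 2
  set q := ∑ c, (dg G₂ c : ℝ) ^ 2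
  rw [hx, hy] at hlow hvol hxy
  rw [hx] at hp
  rw [hy] at hq
  have hvol' : vol (join G₁ G₂) = 2 * (x + y + a * b) := by
    zify; rw [hvol]; push_cast; ring
  rw [hvol'] at hE
  have hx2 : ((2 * x : ℕ) : ℝ) / 2 = x := by push_cast; ring
  have hy2 : ((2 * y : ℕ) : ℝ) / 2 = y := by push_cast; ring
  rw [hx2, hy2] at hlow
  rw [hx2] at hp
  rw [hy2] at hq
  refine card_le_of_bowPoly_le hp hq hb hab (by linarith) hE ?_
  intro a' b' x' y' h1 h2 h3 h4 h5 h6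
  obtain ⟨W, _, H, r, s, hW, hv, hr, hs, hs', hbow⟩ := exists_nearRegular_join h1 h2 h3 h4
  refine ⟨r, s, hr, hs, hs', ?_⟩
  have h7 : bow (join G₁ G₂) ≤ bow H :=
    hH.bow_le (by rw [hW, h5, Fintype.card_sum]) (by rw [hv, hvol', h6])
  have h8 : (bow (join G₁ G₂) : ℝ) ≤ bow H := by exact_mod_cast h7
  rw [hbow] at h8
  linarith

/-! ### Adding and deleting an edge -/

/-- `H` together with the edge `uv`. -/
def addEdge (H : SimpleGraph V) (u v : V) : SimpleGraph V := H ⊔ SimpleGraph.edge u v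

/-- `H` without the edge `uv`. -/
def delEdge (H : SimpleGraph V) (u v : V) : SimpleGraph V := H \ SimpleGraph.edge u v

lemma addEdge_adj {H : SimpleGraph V} {u v : V} (huv : u ≠ v) {a b : V} :
    (addEdge H u v).Adj a b ↔ H.Adj a b ∨ (a = u ∧ b = v) ∨ (a = v ∧ b = u) := by
  simp only [addEdge, SimpleGraph.sup_adj, SimpleGraph.edge_adj]
  constructor
  · rintro (h | ⟨h, -⟩)
    · exact .inl h
    · tauto
  · rintro (h | h | h)
    · exact .inl h
    · refine .inr ⟨by tauto, ?_⟩
      rw [h.1, h.2]; exact huv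
    · refine .inr ⟨by tauto, ?_⟩
      rw [h.1, h.2]; exact huv.symm

lemma delEdge_adj {H : SimpleGraph V} {u v a b : V} :
    (delEdge H u v).Adj a b ↔ H.Adj a b ∧ ¬ ((a = u ∧ b = v) ∨ (a = v ∧ b = u)) := by
  simp only [delEdge, SimpleGraph.sdiff_adj, SimpleGraph.edge_adj]
  constructor
  · rintro ⟨h, h'⟩
    exact ⟨h, fun h'' => h' ⟨by tauto, h.ne⟩⟩
  · rintro ⟨h, h'⟩
    exact ⟨h, fun h'' => h' (by tauto)⟩

lemma delEdge_le (H : SimpleGraph V) (u v : V) : delEdge H u v ≤ H := sdiff_le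

lemma vol_addEdge {H : SimpleGraph V} {u v : V} (huv : u ≠ v) (h : ¬ H.Adj u v) :
    vol (addEdge H u v) = vol H + 2 := by
  have : ({t : V × V | (addEdge H u v).Adj t.1 t.2} : Finset (V × V)) =
      insert (u, v) (insert (v, u) ({t : V × V | H.Adj t.1 t.2} : Finset (V × V))) := by
    ext ⟨a, b⟩
    simp only [mem_filter, mem_univ, true_and, mem_insert, addEdge_adj huv, Prod.mk.injEq]
    tauto
  rw [vol_eq_card, this, card_insert_of_notMem, card_insert_of_notMem, vol_eq_card]
  · simpa [H.adj_comm] using h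
  · simp [h, huv]

lemma addEdge_delEdge {H : SimpleGraph V} {u v : V} (h : H.Adj u v) :
    addEdge (delEdge H u v) u v = H := by
  rw [addEdge, delEdge, sdiff_sup_cancel]
  intro a b hab
  rw [SimpleGraph.edge_adj] at hab
  rcases hab.1 with ⟨rfl, rfl⟩ | ⟨rfl, rfl⟩
  · exact h
  · exact h.symm

lemma vol_delEdge {H : SimpleGraph V} {u v : V} (h : H.Adj u v) :
    vol (delEdge H u v) + 2 = vol H := by
  rw [← vol_addEdge h.ne, addEdge_delEdge h]
  simp [delEdge_adj]

/-- The number of oriented edges in the link of `c` that avoid `x` and `y`. -/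
def avoid (H : SimpleGraph V) (c x y : V) : ℕ :=
  #{t : V × V | (link H c).Adj t.1 t.2 ∧ t.1 ≠ x ∧ t.1 ≠ y ∧ t.2 ≠ x ∧ t.2 ≠ y}

lemma avoid_le_vol (H : SimpleGraph V) (c x y : V) : avoid H c x y ≤ vol (link H c) := by
  rw [vol_eq_card]
  exact card_le_card fun t ht => by
    simp only [mem_filter, mem_univ, true_and] at ht ⊢
    exact ht.1

/-- The common neighbours of `u` and `v`. -/
def commonNbrs (H : SimpleGraph V) (u v : V) : Finset V := {z | H.Adj u z ∧ H.Adj v z}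

lemma mem_commonNbrs {H : SimpleGraph V} {u v z : V} :
    z ∈ commonNbrs H u v ↔ H.Adj u z ∧ H.Adj v z := by simp [commonNbrs]

/-- Exchanging the two triangles of a labelled bowtie. -/
def swapTri (t : V × (V × V) × (V × V)) : V × (V × V) × (V × V) := (t.1, t.2.2, t.2.1)

/-- The new bowties created by the edge `uv`: one of the two triangles is `uvz`, the other one meets
it in the centre, which is one of `u`, `v`, `z`. -/
theorem bow_addEdge_le {H : SimpleGraph V} {u v : V} (huv : u ≠ v) (hn : ¬ H.Adj u v) :
    bow (addEdge H u v) ≤ bow H + 4 * ∑ z ∈ commonNbrs H u v,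
      (avoid H u v z + avoid H v u z + avoid H z u v) := by
  set H' := addEdge H u v with hH'
  have adj : ∀ {a b}, H'.Adj a b ↔ H.Adj a b ∨ (a = u ∧ b = v) ∨ (a = v ∧ b = u) :=
    addEdge_adj huv
  -- labelled bowties whose first triangle contains `uv`
  set P : Finset (V × (V × V) × (V × V)) := (bowties H').filter fun t =>
    (u = t.1 ∨ u = t.2.1.1 ∨ u = t.2.1.2) ∧ (v = t.1 ∨ v = t.2.1.1 ∨ v = t.2.1.2) with hP
  have hcov : bowties H' ⊆ bowties H ∪ P ∪ P.image swapTri := by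
    rintro ⟨c, ⟨x, y⟩, ⟨p, q⟩⟩ ht
    by_contra hcon
    simp only [mem_union, not_or] at hcon
    obtain ⟨⟨h1, h2⟩, h3⟩ := hcon
    have h2' : ¬ ((u = c ∨ u = x ∨ u = y) ∧ (v = c ∨ v = x ∨ v = y)) := fun h =>
      h2 (by rw [hP, mem_filter]; exact ⟨ht, h⟩)
    have h3' : ¬ ((u = c ∨ u = p ∨ u = q) ∧ (v = c ∨ v = p ∨ v = q)) := fun h =>
      h3 (mem_image.2 ⟨(c, (p, q), (x, y)), by
        rw [hP, mem_filter]
        refine ⟨?_, h⟩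
        rw [mem_bowties] at ht ⊢
        exact ⟨ht.2.1, ht.1, ht.2.2.1.symm, ht.2.2.2.2.1.symm, ht.2.2.2.1.symm, ht.2.2.2.2.2.symm⟩,
        rfl⟩)
    apply h1
    rw [mem_bowties] at ht ⊢
    simp only [link_adj, adj] at ht ⊢
    refine ⟨⟨ht.1.1.resolve_right ?_, ht.1.2.1.resolve_right ?_, ht.1.2.2.resolve_right ?_⟩,
      ⟨ht.2.1.1.resolve_right ?_, ht.2.1.2.1.resolve_right ?_, ht.2.1.2.2.resolve_right ?_⟩, ht.2.2⟩
    · rintro (⟨rfl, rfl⟩ | ⟨rfl, rfl⟩) <;> simp at h2'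
    · rintro (⟨rfl, rfl⟩ | ⟨rfl, rfl⟩) <;> simp at h2'
    · rintro (⟨rfl, rfl⟩ | ⟨rfl, rfl⟩) <;> simp at h2'
    · rintro (⟨rfl, rfl⟩ | ⟨rfl, rfl⟩) <;> simp at h3'
    · rintro (⟨rfl, rfl⟩ | ⟨rfl, rfl⟩) <;> simp at h3'
    · rintro (⟨rfl, rfl⟩ | ⟨rfl, rfl⟩) <;> simp at h3'
  have hPcard : #P ≤ 2 * ∑ z ∈ commonNbrs H u v,
      (avoid H u v z + avoid H v u z + avoid H z u v) := by
    set S : V → V → V → Finset (V × V) := fun c x y =>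
      {t : V × V | (link H c).Adj t.1 t.2 ∧ t.1 ≠ x ∧ t.1 ≠ y ∧ t.2 ≠ x ∧ t.2 ≠ y} with hS
    have hSc : ∀ c x y, #(S c x y) = avoid H c x y := fun _ _ _ => rfl
    have hsub : P ⊆ (commonNbrs H u v).biUnion fun z =>
        ((S u v z).image fun t => (u, (v, z), t)) ∪ ((S u v z).image fun t => (u, (z, v), t)) ∪
        (((S v u z).image fun t => (v, (u, z), t)) ∪ ((S v u z).image fun t => (v, (z, u), t))) ∪
        (((S z u v).image fun t => (z, (u, v), t)) ∪ ((S z u v).image fun t => (z, (v, u), t))) := by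
      rintro ⟨c, ⟨x, y⟩, ⟨p, q⟩⟩ ht
      rw [hP, mem_filter, mem_bowties] at ht
      obtain ⟨⟨h1, h2, h3, h4, h5, h6⟩, h7, h8⟩ := ht
      simp only [link_adj, adj] at h1 h2
      have hne : ∀ w, (w = c ∨ w = x ∨ w = y) → w ≠ p ∧ w ≠ q := by
        rintro w (rfl | rfl | rfl)
        · exact ⟨(adj.2 h2.1).ne, (adj.2 h2.2.1).ne⟩
        · exact ⟨h3, h4⟩
        · exact ⟨h5, h6⟩
      have hl : H.Adj c p ∧ H.Adj c q ∧ H.Adj p q := by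
        refine ⟨h2.1.resolve_right ?_, h2.2.1.resolve_right ?_, h2.2.2.resolve_right ?_⟩
        · rintro (⟨-, h⟩ | ⟨-, h⟩)
          · exact (hne v h8).1 h.symm
          · exact (hne u h7).1 h.symm
        · rintro (⟨-, h⟩ | ⟨-, h⟩)
          · exact (hne v h8).2 h.symm
          · exact (hne u h7).2 h.symm
        · rintro (⟨h, -⟩ | ⟨h, -⟩)
          · exact (hne u h7).1 h.symm
          · exact (hne v h8).1 h.symm
      have hcx : H'.Adj c x := adj.2 h1.1
      have hcy : H'.Adj c y := adj.2 h1.2.1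
      have hxy : H'.Adj x y := adj.2 h1.2.2
      have hcn : ∀ {z}, z ≠ u → z ≠ v → H'.Adj u z → H'.Adj v z → z ∈ commonNbrs H u v := by
        intro z hzu hzv h h'
        rw [adj] at h h'
        rw [mem_commonNbrs]
        have hz : ∀ {a : V}, ¬ ((a = u ∧ z = v) ∨ (a = v ∧ z = u)) := fun h =>
          h.elim (fun h => hzv h.2) fun h => hzu h.2
        exact ⟨h.resolve_right hz, h'.resolve_right hz⟩
      simp only [mem_biUnion, mem_union, mem_image, hS, mem_filter, mem_univ, true_and, Prod.exists,
        Prod.mk.injEq, link_adj]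
      rcases h7 with rfl | rfl | rfl <;> rcases h8 with rfl | rfl | rfl
      · exact absurd rfl huv
      · exact ⟨y, hcn hcy.ne' hxy.ne' hcy hxy, .inl (.inl (.inl ⟨p, q, ⟨hl, h3.symm, h5.symm, h4.symm, h6.symm⟩, by simp⟩))⟩
      · exact ⟨x, hcn hcx.ne' hxy.ne hcx hxy.symm, .inl (.inl (.inr ⟨p, q, ⟨hl, h5.symm, h3.symm, h6.symm, h4.symm⟩, by simp⟩))⟩
      · exact ⟨y, hcn hxy.ne' hcy.ne' hxy hcy, .inl (.inr (.inl ⟨p, q, ⟨hl, h3.symm, h5.symm, h4.symm, h6.symm⟩, by simp⟩))⟩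
      · exact absurd rfl huv
      · exact ⟨c, hcn hcx.ne hcy.ne hcx.symm hcy.symm, .inr (.inl ⟨p, q, ⟨hl, h3.symm, h5.symm, h4.symm, h6.symm⟩, by simp⟩)⟩
      · exact ⟨x, hcn hxy.ne hcx.ne' hxy.symm hcx, .inl (.inr (.inr ⟨p, q, ⟨hl, h5.symm, h3.symm, h6.symm, h4.symm⟩, by simp⟩))⟩
      · exact ⟨c, hcn hcy.ne hcx.ne hcy.symm hcx.symm, .inr (.inr ⟨p, q, ⟨hl, h5.symm, h3.symm, h6.symm, h4.symm⟩, by simp⟩)⟩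
      · exact absurd rfl huv
    refine (card_le_card hsub).trans (card_biUnion_le.trans ?_)
    rw [mul_sum]
    refine sum_le_sum fun z _ => ?_
    refine (card_union_le _ _).trans ?_
    have e1 := (card_union_le (((S u v z).image fun t => (u, (v, z), t)) ∪
      ((S u v z).image fun t => (u, (z, v), t)))
      (((S v u z).image fun t => (v, (u, z), t)) ∪ ((S v u z).image fun t => (v, (z, u), t))))
    have e2 := card_union_le ((S u v z).image fun t => (u, (v, z), t))
      ((S u v z).image fun t => (u, (z, v), t))
    have e3 := card_union_le ((S v u z).image fun t => (v, (u, z), t))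
      ((S v u z).image fun t => (v, (z, u), t))
    have e4 := card_union_le ((S z u v).image fun t => (z, (u, v), t))
      ((S z u v).image fun t => (z, (v, u), t))
    have f : ∀ c x y a b d : V, #((S c x y).image fun t => (a, (b, d), t)) ≤ avoid H c x y :=
      fun c x y a b d => card_image_le
    have := f u v z u v z
    have := f u v z u z v
    have := f v u z v u z
    have := f v u z v z u
    have := f z u v z u v
    have := f z u v z v u
    omega
  have h1 := card_le_card hcov
  have h2 := card_union_le (bowties H ∪ P) (P.image swapTri)
  have h3 := card_union_le (bowties H) P
  have h4 : #(P.image swapTri) ≤ #P := card_image_le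
  unfold bow
  omega

lemma bow_add_card_le {G H : SimpleGraph V} (h : G ≤ H) {T : Finset (V × (V × V) × (V × V))}
    (hT : T ⊆ bowties H) (hd : ∀ t ∈ T, t ∉ bowties G) : bow G + #T ≤ bow H := by
  rw [bow, bow, ← card_union_of_disjoint]
  · exact card_le_card (union_subset (bowties_mono h) hT)
  · rw [disjoint_right]; exact hd

/-- The exchange inequality: in an optimal graph, replacing an edge `xy` by a non-edge `uv` destroys
at most as many bowties as it creates. -/
theorem Opt.exchange {H : SimpleGraph V} (hH : Opt H) {x y u v : V} (hxy : H.Adj x y)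
    (huv : u ≠ v) (hn : ¬ H.Adj u v) {T : Finset (V × (V × V) × (V × V))}
    (hT : T ⊆ bowties H) (hd : ∀ t ∈ T, t ∉ bowties (delEdge H x y)) :
    #T ≤ 4 * ∑ z ∈ commonNbrs (delEdge H x y) u v, (avoid (delEdge H x y) u v z
      + avoid (delEdge H x y) v u z + avoid (delEdge H x y) z u v) := by
  have hn' : ¬ (delEdge H x y).Adj u v := fun h => hn (delEdge_le _ _ _ h)
  have h1 := bow_addEdge_le huv hn'
  have h2 := bow_add_card_le (delEdge_le H x y) hT hd
  have h3 := hH (addEdge (delEdge H x y) u v) (by rw [vol_addEdge huv hn', vol_delEdge hxy])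
  omega

section

/-! ### Optimal graphs have few bowties and few triangles -/

lemma sqDeg_zero (m : ℝ) : sqDeg m 0 0 = 0 := by simp [sqDeg]

/-- An upper bound for the bowties of a near-regular join whose second part is edgeless. -/
lemma four_mul_bowPoly_le {n a b x r δ : ℝ} (hδ : δ ≤ 1 / 10000) (hn : 1 ≤ δ * n) (hn1 : 10000 ≤ n)
    (hxn : x ≤ 2 * δ * n ^ 2) (hx0 : 0 ≤ x) (hr0 : 0 ≤ r) (hb0 : 0 ≤ b) (hrR : r * a ≤ 2 * x)
    (hbaR : b ≤ a) (habR : a + b = n) :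
    4 * bowPoly a b x 0 (sqDeg a x r) 0 ≤ δ * n ^ 5 := by
  have hn0 : 0 ≤ n := by linarith
  have hδ0 : 0 ≤ δ := by
    by_contra h
    nlinarith
  have ha0 : 0 ≤ a := hb0.trans hbaR
  have h9 : r * (r * a) ≤ r * (2 * x) := mul_le_mul_of_nonneg_left hrR hr0
  have h10 : x * (r * a) ≤ x * (2 * x) := mul_le_mul_of_nonneg_left hrR hx0
  have h11 : 0 ≤ r * x := mul_nonneg hr0 hx0
  have h12 : 0 ≤ a * a * (r * (r + 1)) := by positivity
  have hp0 : 0 ≤ sqDeg a x r := by unfold sqDeg; linarith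
  have hp1 : a * sqDeg a x r ≤ 8 * x ^ 2 + 2 * x * a := by unfold sqDeg; linarith
  have hp2 : b ^ 2 * sqDeg a x r ≤ b * (8 * x ^ 2 + 2 * x * a) := by
    calc b ^ 2 * sqDeg a x r = b * (b * sqDeg a x r) := by ring
      _ ≤ b * (a * sqDeg a x r) := by gcongr
      _ ≤ _ := by gcongr
  have h1 : bowPoly a b x 0 (sqDeg a x r) 0 ≤ b * (9 * x ^ 2 + 2 * x * a + 3 * x) := by
    have h2 : 0 ≤ b * sqDeg a x r := mul_nonneg hb0 hp0
    have h3 : 0 ≤ b ^ 2 * x := by positivity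
    unfold bowPoly
    linarith
  have hb2 : b ≤ n / 2 := by linarith
  have ha2 : a ≤ n := by linarith
  have h2 : b * (9 * x ^ 2 + 2 * x * a + 3 * x) ≤
      n / 2 * (9 * (2 * δ * n ^ 2) ^ 2 + 2 * (2 * δ * n ^ 2) * n + 3 * (2 * δ * n ^ 2)) := by
    gcongr
  have h3 : δ * (δ * n ^ 4) ≤ 1 / 10000 * (δ * n ^ 4) := by gcongr
  have h4 : (δ * n ^ 3) * 10000 ≤ (δ * n ^ 3) * n := by gcongr
  have h5 : (δ * n ^ 2) * (10000 * 1) ≤ (δ * n ^ 2) * (n * n) := by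
    gcongr; linarith
  have h6 : 0 ≤ δ * n ^ 5 := by positivity
  have h7 : n / 2 * (9 * (2 * δ * n ^ 2) ^ 2 + 2 * (2 * δ * n ^ 2) * n + 3 * (2 * δ * n ^ 2)) ≤
      n / 2 * (46 / 10000 * (δ * n ^ 4)) := by
    gcongr; linarith
  linarith

/-- Comparison with a near-regular join all of whose inner edges lie in one part. -/
theorem Opt.bow_le_mul {H : SimpleGraph V} (hH : Opt H) {e : ℕ} (he : vol H = 2 * e) {δ : ℝ}
    (hδ : δ ≤ 1 / 10000) (hn : 1 ≤ δ * Fintype.card V) (h4 : Fintype.card V ^ 2 ≤ 4 * e)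
    (hE : (e : ℝ) ≤ (1 / 4 + δ) * Fintype.card V ^ 2) :
    (bow H : ℝ) ≤ δ * Fintype.card V ^ 5 := by
  obtain ⟨n, hn'⟩ : ∃ n, n = Fintype.card V := ⟨_, rfl⟩
  rw [← hn'] at hn h4 hE ⊢
  have hn0 : (0 : ℝ) ≤ n := Nat.cast_nonneg _
  have hδ0 : 0 < δ := by
    by_contra h
    nlinarith
  have hn1 : (10000 : ℝ) ≤ n := by linarith [mul_le_mul_of_nonneg_right hδ hn0]
  have hnN : 10000 ≤ n := by exact_mod_cast hn1
  obtain ⟨b, hb⟩ : ∃ b, b = n / 2 := ⟨_, rfl⟩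
  obtain ⟨a, ha⟩ : ∃ a, a = n - n / 2 := ⟨_, rfl⟩
  have hab : a + b = n := by omega
  have hba : b ≤ a := by omega
  have hab1 : a ≤ b + 1 := by omega
  have habe : a * b ≤ e := by
    have : 4 * (a * b) ≤ n ^ 2 := by rw [← hab]; zify; nlinarith [sq_nonneg ((a : ℤ) - b)]
    omega
  obtain ⟨x, hx⟩ := Nat.exists_eq_add_of_le habe
  have habR : (a : ℝ) + b = n := by exact_mod_cast hab
  have hbaR : (b : ℝ) ≤ a := by exact_mod_cast hba
  have hab1R : (a : ℝ) ≤ b + 1 := by exact_mod_cast hab1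
  have hxR : (e : ℝ) = a * b + x := by exact_mod_cast hx
  have hxn : (x : ℝ) ≤ 2 * δ * n ^ 2 := by
    have h1 : (n : ℝ) ^ 2 ≤ 4 * (a * b) + 1 := by rw [← habR]; nlinarith
    have h2 : 1 ≤ δ * (n : ℝ) ^ 2 := by
      calc 1 ≤ δ * n := hn
        _ ≤ δ * n * n := le_mul_of_one_le_right (by positivity) (by linarith)
        _ = δ * (n : ℝ) ^ 2 := by ring
    have h3 : (1 / 4 + δ) * (n : ℝ) ^ 2 = n ^ 2 / 4 + δ * n ^ 2 := by ring
    linarith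
  have hx100 : 100 * x ≤ a ^ 2 := by
    have h1 : (n : ℝ) ≤ 2 * a := by linarith
    have : (100 : ℝ) * x ≤ a ^ 2 := by
      have : δ * (n : ℝ) ^ 2 ≤ 1 / 10000 * n ^ 2 := by gcongr
      nlinarith
    exact_mod_cast this
  obtain ⟨W, _, G, r, s, hW, hv, hr, hs, -, hbow⟩ :=
    exists_nearRegular_join (a := a) (b := b) (x := x) (y := 0) (by omega) (by omega) hx100 (by simp)
  have hs0 : s = 0 := by
    have : s * b = 0 := by omega
    rcases Nat.mul_eq_zero.1 this with h | h <;> omega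
  have hle : (bow H : ℝ) ≤ bow G := by
    exact_mod_cast hH.bow_le (by rw [hW, hab, hn']) (by rw [hv, he, hx]; ring)
  refine hle.trans ?_
  rw [hbow]
  subst hs0
  rw [Nat.cast_zero, sqDeg_zero]
  exact four_mul_bowPoly_le hδ hn hn1 hxn (Nat.cast_nonneg _) (Nat.cast_nonneg _)
    (Nat.cast_nonneg _) (by exact_mod_cast hr) hbaR habR

lemma vol_le_card_sq (R : SimpleGraph V) : vol R ≤ Fintype.card V ^ 2 := by
  rw [vol, sq]
  exact (sum_le_card_nsmul univ _ _ fun v _ => dg_le_card R v).trans (by simp)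

lemma sum_dg_sq_le (R : SimpleGraph V) : ∑ v, dg R v ^ 2 ≤ Fintype.card V * vol R := by
  rw [vol, mul_sum]
  refine sum_le_sum fun v _ => ?_
  rw [sq]
  exact Nat.mul_le_mul_right _ (dg_le_card R v)

/-- Most pairs of edges are disjoint, as far as lower-order terms do not matter. -/
lemma sq_vol_le (R : SimpleGraph V) :
    vol R ^ 2 ≤ disjPairs R + 4 * (Fintype.card V * vol R) := by
  have h1 := disjPairs_eq R
  have h2 := sum_dg_sq_le R
  zify at h2 ⊢
  nlinarith

/-- Six times the number of triangles of `H`. -/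
def tri (H : SimpleGraph V) : ℕ := ∑ c, vol (link H c)

lemma tri_le (H : SimpleGraph V) : tri H ≤ Fintype.card V ^ 3 := by
  rw [tri, pow_succ']
  exact (sum_le_card_nsmul univ _ _ fun v _ => vol_le_card_sq _).trans (by simp)

lemma sq_tri_le (H : SimpleGraph V) :
    tri H ^ 2 ≤ Fintype.card V * (bow H + 4 * Fintype.card V ^ 4) := by
  have h1 : tri H ^ 2 ≤ Fintype.card V * ∑ c, vol (link H c) ^ 2 := sq_sum_le_card_mul_sum_sq
  have h2 : ∑ c, vol (link H c) ^ 2 ≤ bow H + 4 * (Fintype.card V * tri H) := by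
    rw [bow_eq_sum_disjPairs, tri, mul_sum, mul_sum, ← sum_add_distrib]
    exact sum_le_sum fun c _ => sq_vol_le _
  have h3 := tri_le H
  refine h1.trans (Nat.mul_le_mul_left _ (h2.trans ?_))
  have : Fintype.card V * tri H ≤ Fintype.card V * Fintype.card V ^ 3 := Nat.mul_le_mul_left _ h3
  rw [pow_succ']
  omega

/-- Few bowties mean few triangles: by the Cauchy–Schwarz inequality, `tri H ^ 2` is at most about
`n * bow H`. -/
theorem Opt.tri_le {H : SimpleGraph V} (hH : Opt H) {e : ℕ} (he : vol H = 2 * e) {δ η : ℝ}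
    (hδ : δ ≤ 1 / 10000) (hη : 0 ≤ η) (hδη : 5 * δ ≤ η ^ 2) (hn : 1 ≤ δ * Fintype.card V)
    (h4 : Fintype.card V ^ 2 ≤ 4 * e)
    (hE : (e : ℝ) ≤ (1 / 4 + δ) * Fintype.card V ^ 2) :
    (tri H : ℝ) ≤ η * Fintype.card V ^ 3 := by
  have h1 := hH.bow_le_mul he hδ hn h4 hE
  have h2 : (tri H : ℝ) ^ 2 ≤ Fintype.card V * (bow H + 4 * Fintype.card V ^ 4) := by
    exact_mod_cast sq_tri_le H
  set n : ℝ := (Fintype.card V : ℝ)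
  have hn0 : 0 ≤ n := Nat.cast_nonneg _
  refine abs_le_of_sq_le_sq' ?_ (by positivity) |>.2
  calc (tri H : ℝ) ^ 2 ≤ n * (bow H + 4 * n ^ 4) := h2
    _ ≤ n * (δ * n ^ 5 + 4 * n ^ 4) := by gcongr
    _ ≤ n * (δ * n ^ 5 + 4 * n ^ 4 * (δ * n)) := by
        have : 4 * n ^ 4 ≤ 4 * n ^ 4 * (δ * n) := le_mul_of_one_le_right (by positivity) hn
        gcongr
    _ = 5 * δ * n ^ 6 := by ring
    _ ≤ η ^ 2 * n ^ 6 := by gcongr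
    _ = (η * n ^ 3) ^ 2 := by ring

/-! ### Two-colourings with few monochromatic edges -/

/-- The edges of `H` inside the two colour classes of `χ`. -/
def inner (H : SimpleGraph V) (χ : V → Bool) : SimpleGraph V where
  Adj u v := H.Adj u v ∧ χ u = χ v
  symm := ⟨fun _ _ h => ⟨h.1.symm, h.2.symm⟩⟩
  loopless := ⟨fun _ h => h.1.ne rfl⟩

/-- The edges of `H` between the two colour classes of `χ`. -/
def cross (H : SimpleGraph V) (χ : V → Bool) : SimpleGraph V where
  Adj u v := H.Adj u v ∧ χ u ≠ χ v
  symm := ⟨fun _ _ h => ⟨h.1.symm, h.2.symm⟩⟩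
  loopless := ⟨fun _ h => h.1.ne rfl⟩

/-- The non-edges of `H` between the two colour classes of `χ`. -/
def gaps (H : SimpleGraph V) (χ : V → Bool) : SimpleGraph V where
  Adj u v := ¬ H.Adj u v ∧ χ u ≠ χ v
  symm := ⟨fun _ _ h => ⟨fun h' => h.1 h'.symm, h.2.symm⟩⟩
  loopless := ⟨fun _ h => h.2 rfl⟩

variable (H : SimpleGraph V) (χ : V → Bool)

variable {H χ} in
lemma inner_adj {u v : V} : (inner H χ).Adj u v ↔ H.Adj u v ∧ χ u = χ v := Iff.rfl

variable {H χ} in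
lemma cross_adj {u v : V} : (cross H χ).Adj u v ↔ H.Adj u v ∧ χ u ≠ χ v := Iff.rfl

variable {H χ} in
lemma gaps_adj {u v : V} : (gaps H χ).Adj u v ↔ ¬ H.Adj u v ∧ χ u ≠ χ v := Iff.rfl

lemma dg_inner_add_dg_cross (v : V) : dg (inner H χ) v + dg (cross H χ) v = dg H v := by
  rw [dg, dg, dg, ← card_union_of_disjoint]
  · congr 1
    ext w
    simp only [mem_union, mem_filter, mem_univ, true_and, inner_adj, cross_adj]
    tauto
  · rw [disjoint_left]
    intro w hw hw'
    simp only [mem_filter, mem_univ, true_and, inner_adj, cross_adj] at hw hw'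
    exact hw'.2 hw.2

lemma dg_cross_add_dg_gaps (v : V) :
    dg (cross H χ) v + dg (gaps H χ) v = #{w | χ v ≠ χ w} := by
  rw [dg, dg, ← card_union_of_disjoint]
  · congr 1
    ext w
    simp only [mem_union, mem_filter, mem_univ, true_and, gaps_adj, cross_adj]
    tauto
  · rw [disjoint_left]
    intro w hw hw'
    simp only [mem_filter, mem_univ, true_and, gaps_adj, cross_adj] at hw hw'
    exact hw'.1 hw.1

lemma vol_inner_add_vol_cross : vol (inner H χ) + vol (cross H χ) = vol H := by
  rw [vol, vol, vol, ← sum_add_distrib]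
  exact sum_congr rfl fun v _ => dg_inner_add_dg_cross H χ v

lemma card_true_add_card_false (χ : V → Bool) :
    #{v | χ v = true} + #{v | χ v = false} = Fintype.card V := by
  rw [← Finset.card_univ, ← card_filter_add_card_filter_not (s := univ) (fun v => χ v = true)]
  simp

lemma vol_cross_add_vol_gaps : vol (cross H χ) + vol (gaps H χ) =
    2 * (#{v | χ v = true} * #{v | χ v = false}) := by
  rw [vol, vol, ← sum_add_distrib, sum_congr rfl fun v _ => dg_cross_add_dg_gaps H χ v,
    ← sum_filter_add_sum_filter_not univ (fun v => χ v = true)]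
  rw [sum_congr rfl (g := fun _ => #{v | χ v = false}) fun v hv => ?_, sum_const,
    sum_congr rfl (g := fun _ => #{v | χ v = true}) fun v hv => ?_, sum_const]
  · simp only [smul_eq_mul, Bool.not_eq_true]; ring
  · simp only [mem_filter, mem_univ, true_and, Bool.not_eq_true] at hv
    congr 1; ext w; simp [hv]
  · simp only [mem_filter, mem_univ, true_and] at hv
    congr 1; ext w; simp [hv]

lemma vol_eq_add_two_mul_dg (R : SimpleGraph V) (v : V) :
    vol R = #{t : V × V | R.Adj t.1 t.2 ∧ t.1 ≠ v ∧ t.2 ≠ v} + 2 * dg R v := by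
  have h1 : #{t : V × V | R.Adj t.1 t.2 ∧ t.1 = v} = dg R v := by
    refine card_bij (fun t _ => t.2) ?_ ?_ ?_
    · simp only [mem_filter, mem_univ, true_and]
      rintro ⟨a, b⟩ ⟨h, rfl⟩; exact h
    · simp only [mem_filter, mem_univ, true_and]
      rintro ⟨a, b⟩ ⟨h, rfl⟩ ⟨a', b'⟩ ⟨h', rfl⟩ hb
      simp_all
    · intro b hb
      exact ⟨(v, b), by simpa using hb, rfl⟩
  have h2 : #{t : V × V | R.Adj t.1 t.2 ∧ t.2 = v} = dg R v := by
    refine card_bij (fun t _ => t.1) ?_ ?_ ?_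
    · simp only [mem_filter, mem_univ, true_and]
      rintro ⟨a, b⟩ ⟨h, rfl⟩; exact h.symm
    · simp only [mem_filter, mem_univ, true_and]
      rintro ⟨a, b⟩ ⟨h, rfl⟩ ⟨a', b'⟩ ⟨h', rfl⟩ hb
      simp_all
    · intro b hb
      exact ⟨(b, v), by simpa [R.adj_comm] using hb, rfl⟩
  rw [vol_eq_card, two_mul]
  nth_rw 1 [← h1]
  rw [← h2, ← card_union_of_disjoint, ← card_union_of_disjoint]
  · congr 1
    ext t
    simp only [mem_union, mem_filter, mem_univ, true_and]
    tauto
  · rw [disjoint_left]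
    intro t ht
    simp only [mem_union, mem_filter, mem_univ, true_and] at ht ⊢
    tauto
  · rw [disjoint_left]
    rintro ⟨a, b⟩ ht
    simp only [mem_filter, mem_univ, true_and] at ht ⊢
    rintro ⟨h, rfl⟩
    exact h.ne ht.2

lemma vol_add_of_agree {R S : SimpleGraph V} {v : V}
    (h : ∀ a b, a ≠ v → b ≠ v → (R.Adj a b ↔ S.Adj a b)) :
    vol R + 2 * dg S v = vol S + 2 * dg R v := by
  rw [vol_eq_add_two_mul_dg R v, vol_eq_add_two_mul_dg S v]
  have : ({t : V × V | R.Adj t.1 t.2 ∧ t.1 ≠ v ∧ t.2 ≠ v} : Finset (V × V)) =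
      ({t : V × V | S.Adj t.1 t.2 ∧ t.1 ≠ v ∧ t.2 ≠ v} : Finset (V × V)) := by
    ext t
    simp only [mem_filter, mem_univ, true_and]
    exact ⟨fun ⟨h1, h2, h3⟩ => ⟨(h _ _ h2 h3).1 h1, h2, h3⟩,
      fun ⟨h1, h2, h3⟩ => ⟨(h _ _ h2 h3).2 h1, h2, h3⟩⟩
  rw [this]
  omega

/-- Averaging over the colourings that separate the neighbourhood of a vertex from the rest. -/
lemma sum_vol_inner_nbhd : (∑ x, (vol (inner H fun v => decide (H.Adj x v)) : ℤ)) =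
    2 * tri H + Fintype.card V * vol H - 2 * ∑ v, (dg H v : ℤ) ^ 2 := by
  set A : V → V → ℤ := fun u v => if H.Adj u v then 1 else 0 with hA
  have hd : ∀ u, ∑ v, A u v = dg H u := fun u => sum_ind_eq_dg H u
  have hd' : ∀ u, ∑ v, A v u = dg H u := fun u => by
    rw [← hd]; exact sum_congr rfl fun v _ => by simp [hA, H.adj_comm]
  have h1 : ∀ x, (vol (inner H fun v => decide (H.Adj x v)) : ℤ) =
      ∑ u, ∑ v, (2 * (A x u * A x v * A u v) + A u v - A u v * A x u - A u v * A x v) := by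
    intro x
    rw [← sum_sum_ind_eq_vol]
    refine sum_congr rfl fun u _ => sum_congr rfl fun v _ => ?_
    simp only [inner, hA]
    by_cases h1 : H.Adj u v <;> by_cases h2 : H.Adj x u <;> by_cases h3 : H.Adj x v <;>
      simp [h1, h2, h3]
  have h2 : (tri H : ℤ) = ∑ x, ∑ u, ∑ v, A x u * A x v * A u v := by
    rw [tri]
    push_cast
    refine sum_congr rfl fun x _ => ?_
    rw [← sum_sum_ind_eq_vol]
    refine sum_congr rfl fun u _ => sum_congr rfl fun v _ => ?_
    simp only [link_adj, hA]
    by_cases h1 : H.Adj u v <;> by_cases h2 : H.Adj x u <;> by_cases h3 : H.Adj x v <;>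
      simp [h1, h2, h3]
  have h3 : ∑ x : V, ∑ u, ∑ v, A u v = Fintype.card V * vol H := by
    simp [hd, vol]
  have h4 : ∑ x : V, ∑ u, ∑ v, A u v * A x u = ∑ v, (dg H v : ℤ) ^ 2 := by
    rw [sum_comm]
    refine sum_congr rfl fun u _ => ?_
    simp_rw [← sum_mul, hd]
    rw [← mul_sum, hd', sq]
  have h5 : ∑ x : V, ∑ u, ∑ v, A u v * A x v = ∑ v, (dg H v : ℤ) ^ 2 := by
    simp_rw [sum_comm (s := univ (α := V)) (t := univ) (f := fun u v => A u v * A _ v)]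
    rw [sum_comm]
    refine sum_congr rfl fun u _ => ?_
    simp_rw [← sum_mul, hd']
    rw [← mul_sum, hd', sq]
  simp_rw [h1, sum_sub_distrib, sum_add_distrib, ← mul_sum]
  rw [← h2, h3, h4, h5]
  ring

lemma exists_colouring [Nonempty V] (h : Fintype.card V ^ 2 ≤ 2 * vol H) :
    ∃ χ : V → Bool, Fintype.card V * vol (inner H χ) ≤ 2 * tri H := by
  obtain ⟨x, -, hx⟩ := exists_min_image univ
    (fun x => vol (inner H fun v => decide (H.Adj x v))) univ_nonempty
  refine ⟨fun v => decide (H.Adj x v), ?_⟩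
  have h1 := sum_vol_inner_nbhd H
  have h2 := card_nsmul_le_sum univ _ _ fun y hy => hx y hy
  have h3 : (vol H : ℤ) ^ 2 ≤ Fintype.card V * ∑ v, (dg H v : ℤ) ^ 2 := by
    rw [vol]; push_cast; exact sq_sum_le_card_mul_sum_sq
  rw [smul_eq_mul, Finset.card_univ] at h2
  refine h2.trans ?_
  have hn : (0 : ℤ) < Fintype.card V := by exact_mod_cast Fintype.card_pos
  zify at h ⊢
  rw [h1]
  have : (Fintype.card V : ℤ) * (Fintype.card V * vol H - 2 * ∑ v, (dg H v : ℤ) ^ 2) ≤ 0 := by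
    have : (0 : ℤ) ≤ vol H := by positivity
    nlinarith
  have := nonpos_of_mul_nonpos_right this hn
  linarith

/-- A colouring with the fewest monochromatic edges: no vertex has more neighbours of its own
colour than of the other one. -/
theorem exists_max_cut [Nonempty V] (h : Fintype.card V ^ 2 ≤ 2 * vol H) :
    ∃ χ : V → Bool, Fintype.card V * vol (inner H χ) ≤ 2 * tri H ∧
      ∀ v, dg (inner H χ) v ≤ dg (cross H χ) v := by
  obtain ⟨χ₀, h₀⟩ := exists_colouring H h
  obtain ⟨χ, -, hχ⟩ := exists_min_image univ (fun χ : V → Bool => vol (inner H χ)) univ_nonempty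
  refine ⟨χ, (Nat.mul_le_mul_left _ (hχ χ₀ (mem_univ _))).trans h₀, fun v => ?_⟩
  have h1 := hχ (Function.update χ v (!χ v)) (mem_univ _)
  have h2 := vol_add_of_agree (R := inner H (Function.update χ v (!χ v))) (S := inner H χ) (v := v)
    fun a b ha hb => by simp [inner, Function.update_of_ne ha, Function.update_of_ne hb]
  have h3 : dg (inner H (Function.update χ v (!χ v))) v = dg (cross H χ) v := by
    rw [dg, dg]
    congr 1
    ext w
    simp only [mem_filter, mem_univ, true_and, inner_adj, cross_adj, Function.update_self]
    refine and_congr_right fun hw => ?_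
    rw [Function.update_of_ne hw.ne']
    cases χ v <;> cases χ w <;> simp
  omega

end

/-! ### All degrees inside the colour classes are small -/

/-- `χ` exhibits `H` as a graph close to a balanced complete bipartite graph: the colour classes have
almost equal sizes, few edges lie inside them, still fewer edges are missing between them, and no
vertex has many neighbours of its own colour. -/
structure NearBip (H : SimpleGraph V) (χ : V → Bool) : Prop where
  card_ge : 10 ^ 8 ≤ Fintype.card V
  class_ge : ∀ b, 49 * Fintype.card V ≤ 100 * #{v | χ v = b}
  vol_inner_le : 10 ^ 16 * vol (inner H χ) ≤ Fintype.card V ^ 2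
  vol_gaps_lt : vol (gaps H χ) + 2 ≤ vol (inner H χ)
  dg_inner_le : ∀ v, 10 ^ 4 * dg (inner H χ) v ≤ Fintype.card V

/-- Some edge at `v` lies in at least the average number of the bowties centred at `v`. -/
lemma exists_mul_card_fiber_ge (H : SimpleGraph V) (v : V) (hv : disjPairs (link H v) ≠ 0) :
    ∃ x, H.Adj v x ∧ disjPairs (link H v) ≤
      Fintype.card V * #{t ∈ bowties H | t.1 = v ∧ t.2.1.1 = x} := by
  have h1 : disjPairs (link H v) = ∑ x, #{t ∈ bowties H | t.1 = v ∧ t.2.1.1 = x} := by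
    rw [disjPairs]
    trans #{t ∈ bowties H | t.1 = v}
    · refine card_bij (fun t _ => (v, t)) ?_ ?_ ?_
      · rintro ⟨⟨a, b⟩, c, d⟩ ht
        simpa [mem_bowties] using ht
      · intro a _ b _ h
        simpa using h
      · rintro ⟨c, ⟨a, b⟩, ⟨d, e⟩⟩ ht
        simp only [mem_filter, mem_bowties] at ht
        obtain ⟨ht, rfl⟩ := ht
        exact ⟨((a, b), (d, e)), by simpa using ht, rfl⟩
    · rw [card_eq_sum_card_fiberwise (f := fun t => t.2.1.1) (t := univ) (by simp)]
      simp_rw [filter_filter]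
  have h2 : ∃ x, disjPairs (link H v) ≤
      Fintype.card V * #{t ∈ bowties H | t.1 = v ∧ t.2.1.1 = x} := by
    by_contra hcon
    push Not at hcon
    have h3 := sum_lt_sum_of_nonempty (s := univ) ⟨v, mem_univ v⟩ fun x _ => hcon x
    rw [← mul_sum, ← h1, sum_const, smul_eq_mul, Finset.card_univ] at h3
    exact lt_irrefl _ h3
  obtain ⟨x, h2⟩ := h2
  refine ⟨x, ?_, h2⟩
  have h3 : #{t ∈ bowties H | t.1 = v ∧ t.2.1.1 = x} ≠ 0 := fun h => hv (by rw [h] at h2; simpa using h2)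
  rw [Finset.card_ne_zero] at h3
  obtain ⟨⟨c, ⟨a, b⟩, ⟨d, e⟩⟩, ht⟩ := h3
  simp only [mem_filter, mem_bowties] at ht
  obtain ⟨ht, rfl, rfl⟩ := ht
  exact ht.1.1

/-- If some non-edge lies in few triangles of the neighbourhoods of its ends, then every vertex of an
optimal graph is the centre of few bowties: exchange its heaviest edge for that non-edge. -/
lemma Opt.disjPairs_link_le {H : SimpleGraph V} (hH : Opt H) {u w : V} (huw : u ≠ w)
    (hn : ¬ H.Adj u w) (v : V) : disjPairs (link H v) ≤ Fintype.card V *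
      (4 * (Fintype.card V * (vol (link H u) + vol (link H w)) + tri H)) := by
  by_cases hv : disjPairs (link H v) = 0
  · simp [hv]
  obtain ⟨x, hvx, hx⟩ := exists_mul_card_fiber_ge H v hv
  refine hx.trans (Nat.mul_le_mul_left _ ?_)
  refine (hH.exchange hvx huw hn (filter_subset _ _) ?_).trans (Nat.mul_le_mul_left _ ?_)
  · rintro ⟨c, ⟨a, b⟩, ⟨d, e⟩⟩ ht h
    simp only [mem_filter, mem_bowties] at ht h
    obtain ⟨-, rfl, rfl⟩ := ht
    have := h.1.1
    rw [delEdge_adj] at this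
    exact this.2 (.inl ⟨rfl, rfl⟩)
  · have hle : ∀ c a b, avoid (delEdge H v x) c a b ≤ vol (link H c) := fun c a b =>
      (avoid_le_vol _ _ _ _).trans (vol_mono (link_mono (delEdge_le _ _ _) _))
    calc _ ≤ ∑ z ∈ commonNbrs (delEdge H v x) u w,
          (vol (link H u) + vol (link H w) + vol (link H z)) :=
          sum_le_sum fun z _ => by have := hle u w z; have := hle w u z; have := hle z u w; omega
      _ ≤ ∑ z, (vol (link H u) + vol (link H w) + vol (link H z)) :=
          sum_le_sum_of_subset (subset_univ _)
      _ = _ := by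
          rw [sum_add_distrib, sum_const, Finset.card_univ, smul_eq_mul, tri]

/-- A non-edge whose two ends lie in few triangles. -/
lemma exists_cheap_nonedge (H : SimpleGraph V) {s : ℝ} (hs0 : 0 < s) (hs : s ≤ 1 / 100)
    (hn : 100 ≤ Fintype.card V) (ht : (tri H : ℝ) ≤ s ^ 2 * Fintype.card V ^ 3)
    (hv : (vol H : ℝ) ≤ 3 / 4 * Fintype.card V ^ 2) :
    ∃ u w, u ≠ w ∧ ¬ H.Adj u w ∧ (vol (link H u) : ℝ) ≤ s * Fintype.card V ^ 2 ∧
      (vol (link H w) : ℝ) ≤ s * Fintype.card V ^ 2 := by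
  by_contra hcon
  push Not at hcon
  have hnR : (100 : ℝ) ≤ Fintype.card V := by exact_mod_cast hn
  set n : ℝ := (Fintype.card V : ℝ) with hn'
  set Q : Finset V := {v | (vol (link H v) : ℝ) ≤ s * n ^ 2} with hQ
  have hcount : (#Q : ℝ) + #Qᶜ = n := by
    rw [hn', ← card_add_card_compl Q]; push_cast; rfl
  have h1 : (#Qᶜ : ℝ) * (s * n ^ 2) ≤ s ^ 2 * n ^ 3 := by
    refine le_trans ?_ ht
    rw [tri]
    push_cast
    rw [← nsmul_eq_mul]
    refine (card_nsmul_le_sum Qᶜ (fun v => (vol (link H v) : ℝ)) _ fun v hv => ?_).trans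
      (sum_le_sum_of_subset_of_nonneg (subset_univ _) fun v _ _ => Nat.cast_nonneg _)
    simp only [hQ, mem_compl, mem_filter, mem_univ, true_and, not_le] at hv
    exact hv.le
  have h2 : (#Qᶜ : ℝ) ≤ s * n := by
    have h3 : 0 < s * n ^ 2 := by positivity
    refine le_of_mul_le_mul_right ?_ h3
    linarith
  have h3 : 99 / 100 * n ≤ #Q := by
    have : s * n ≤ 1 / 100 * n := by gcongr
    linarith
  -- the vertices in few triangles would form a clique that is too large
  have h4 : #Q * (#Q - 1) ≤ vol H := by
    rw [vol]
    refine le_trans ?_ (sum_le_sum_of_subset (subset_univ Q))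
    rw [← smul_eq_mul]
    refine card_nsmul_le_sum _ _ _ fun v hv => ?_
    rw [← card_erase_of_mem hv, dg]
    refine card_le_card fun w hw => ?_
    simp only [mem_filter, mem_univ, true_and]
    by_contra hvw
    rw [mem_erase] at hw
    have := hcon v w hw.1.symm hvw (by simpa [hQ] using hv)
    have h5 : (vol (link H w) : ℝ) ≤ s * n ^ 2 := by simpa [hQ] using hw.2
    linarith
  have hQ1 : 1 ≤ #Q := by
    have : (0 : ℝ) < #Q := by linarith
    exact_mod_cast this
  have h5 : (#Q : ℝ) * (#Q - 1) ≤ vol H := by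
    have : ((#Q * (#Q - 1) : ℕ) : ℝ) ≤ vol H := by exact_mod_cast h4
    rwa [Nat.cast_mul, Nat.cast_sub hQ1, Nat.cast_one] at this
  nlinarith

/-- Each pair of neighbours of `v`, one of either colour, spans a triangle or is a gap. -/
lemma dg_inner_mul_dg_cross_le (H : SimpleGraph V) (χ : V → Bool) (v : V) :
    dg (inner H χ) v * dg (cross H χ) v ≤ vol (link H v) + vol (gaps H χ) := by
  rw [dg, dg, ← card_product, vol_eq_card, vol_eq_card]
  refine (card_le_card ?_).trans (card_union_le _ _)
  rintro ⟨a, b⟩ hab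
  rw [mem_product] at hab
  simp only [mem_filter, mem_univ, true_and, inner_adj, cross_adj] at hab
  simp only [mem_union, mem_filter, mem_univ, true_and, link_adj, gaps_adj]
  by_cases h : H.Adj a b
  · exact .inl ⟨hab.1.1, hab.2.1, h⟩
  · exact .inr ⟨h, hab.1.2 ▸ hab.2.2⟩

/-- In a maximum cut, vertices of large inner degree lie in many triangles. -/
lemma sq_dg_inner_le {H : SimpleGraph V} {χ : V → Bool}
    (h : ∀ v, dg (inner H χ) v ≤ dg (cross H χ) v) (v : V) :
    dg (inner H χ) v ^ 2 ≤ vol (link H v) + vol (gaps H χ) := by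
  rw [sq]
  exact (Nat.mul_le_mul_left _ (h v)).trans (dg_inner_mul_dg_cross_le H χ v)

/-- As the complete bipartite graph has at most `n ^ 2 / 4` edges, inner edges outnumber the gaps. -/
lemma vol_gaps_add_two_le {H : SimpleGraph V} {χ : V → Bool} {e : ℕ} (he : vol H = 2 * e)
    (h : Fintype.card V ^ 2 < 4 * e) : vol (gaps H χ) + 2 ≤ vol (inner H χ) := by
  have h1 := vol_inner_add_vol_cross H χ
  have h2 := vol_cross_add_vol_gaps H χ
  have h3 := card_true_add_card_false χ
  have h4 := vol_eq_two_mul_ncard (inner H χ)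
  have h5 := vol_eq_two_mul_ncard (gaps H χ)
  generalize #{v | χ v = true} = a at *
  generalize #{v | χ v = false} = b at *
  have : 4 * (a * b) ≤ Fintype.card V ^ 2 := by
    rw [← h3]; zify; nlinarith [sq_nonneg ((a : ℤ) - b)]
  omega

lemma class_ge_of_vol_inner_le {H : SimpleGraph V} {χ : V → Bool} {e : ℕ} (he : vol H = 2 * e)
    (h : Fintype.card V ^ 2 < 4 * e) (hD : 10 ^ 16 * vol (inner H χ) ≤ Fintype.card V ^ 2) (b : Bool) :
    49 * Fintype.card V ≤ 100 * #{v | χ v = b} := by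
  have h1 := vol_inner_add_vol_cross H χ
  have h2 := vol_cross_add_vol_gaps H χ
  have h3 := card_true_add_card_false χ
  have key : ∀ a b n : ℕ, a + b = n → 10 ^ 16 * n ^ 2 ≤ 10 ^ 16 * (4 * (a * b)) + 2 * n ^ 2 →
      49 * n ≤ 100 * a := by
    rintro a b n rfl h
    by_contra hc
    push Not at hc
    zify at h hc
    nlinarith
  have h4 : 10 ^ 16 * Fintype.card V ^ 2 ≤
      10 ^ 16 * (4 * (#{v | χ v = true} * #{v | χ v = false})) + 2 * Fintype.card V ^ 2 := by
    omega
  cases b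
  · exact key _ _ _ ((add_comm _ _).trans h3) (by rwa [mul_comm #{v | χ v = false}])
  · exact key _ _ _ h3 h4

/-- Optimal graphs with slightly more than `n ^ 2 / 4` edges are close to balanced complete
bipartite graphs. The bound on `δ` is far from sharp: a square root is lost in each of the steps from
bowties to triangles, to a cheap non-edge, to the links of all vertices, and to the inner degrees. -/
theorem Opt.exists_nearBip {H : SimpleGraph V} (hH : Opt H) {e : ℕ} (he : vol H = 2 * e) {δ : ℝ}
    (hδ : δ ≤ 1 / 10 ^ 82) (hn : 1 ≤ δ * Fintype.card V)
    (h4 : Fintype.card V ^ 2 < 4 * e) (hE : (e : ℝ) ≤ (1 / 4 + δ) * Fintype.card V ^ 2) :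
    ∃ χ, NearBip H χ := by
  have hδ' : δ ≤ 1 / 10000 := hδ.trans (by norm_num)
  have htri := hH.tri_le he (η := (1 / 10 ^ 20) ^ 2) hδ' (by positivity)
    (by nlinarith) hn h4.le hE
  have hnR : (10 : ℝ) ^ 82 ≤ Fintype.card V := by
    have := mul_le_mul_of_nonneg_right hδ (Nat.cast_nonneg (α := ℝ) (Fintype.card V))
    linarith
  have hnN : 10 ^ 82 ≤ Fintype.card V := by exact_mod_cast hnR
  have : Nonempty V := Fintype.card_pos_iff.1 (by omega)
  obtain ⟨χ, hχ, hcut⟩ := exists_max_cut H (by rw [he]; omega)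
  obtain ⟨u, w, huw, hnadj, hu, hw⟩ := exists_cheap_nonedge H (s := 1 / 10 ^ 20) (by positivity)
    (by norm_num) (by omega) htri (by
      rw [he]; push_cast
      have : δ * (Fintype.card V : ℝ) ^ 2 ≤ 1 / 10000 * (Fintype.card V : ℝ) ^ 2 := by gcongr
      linarith [sq_nonneg (Fintype.card V : ℝ)])
  have hgap := vol_gaps_add_two_le (χ := χ) he h4
  have hgapR : (vol (gaps H χ) : ℝ) + 2 ≤ vol (inner H χ) := by exact_mod_cast hgap
  have hχR : (Fintype.card V : ℝ) * vol (inner H χ) ≤ 2 * tri H := by exact_mod_cast hχ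
  have hlink : ∀ v, (vol (link H v) : ℝ) ^ 2 ≤ Fintype.card V *
      (4 * (Fintype.card V * (vol (link H u) + vol (link H w)) + tri H)) +
      4 * (Fintype.card V * Fintype.card V ^ 2) := fun v => by
    have h1 := hH.disjPairs_link_le huw hnadj v
    have h2 := sq_vol_le (link H v)
    have h3 := Nat.mul_le_mul_left (Fintype.card V) (vol_le_card_sq (link H v))
    have h5 : vol (link H v) ^ 2 ≤ Fintype.card V *
      (4 * (Fintype.card V * (vol (link H u) + vol (link H w)) + tri H)) +
      4 * (Fintype.card V * Fintype.card V ^ 2) := by omega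
    exact_mod_cast h5
  have hsq : ∀ v, (dg (inner H χ) v : ℝ) ^ 2 ≤ vol (link H v) + vol (gaps H χ) := fun v => by
    exact_mod_cast sq_dg_inner_le hcut v
  have hin : (vol (inner H χ) : ℝ) ≤ 2 / 10 ^ 40 * Fintype.card V ^ 2 := by
    have h0 : (0 : ℝ) < Fintype.card V := by linarith
    refine le_of_mul_le_mul_left ?_ h0
    linarith
  have hinN : 10 ^ 16 * vol (inner H χ) ≤ Fintype.card V ^ 2 := by
    have : (10 : ℝ) ^ 16 * vol (inner H χ) ≤ Fintype.card V ^ 2 := by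
      linarith [sq_nonneg (Fintype.card V : ℝ)]
    exact_mod_cast this
  refine ⟨χ, by omega, class_ge_of_vol_inner_le he h4 hinN, hinN, hgap, fun v => ?_⟩
  suffices h : (10 : ℝ) ^ 4 * dg (inner H χ) v ≤ (Fintype.card V : ℝ) by exact_mod_cast h
  set n : ℝ := (Fintype.card V : ℝ)
  have hn0 : 0 ≤ n := Nat.cast_nonneg _
  have h1 : (vol (link H v) : ℝ) ≤ 1 / 10 ^ 9 * n ^ 2 := by
    refine abs_le_of_sq_le_sq' ?_ (by positivity) |>.2
    calc (vol (link H v) : ℝ) ^ 2 ≤ _ := hlink v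
      _ ≤ n * (4 * (n * (1 / 10 ^ 20 * n ^ 2 + 1 / 10 ^ 20 * n ^ 2) + (1 / 10 ^ 20) ^ 2 * n ^ 3)) +
          4 * (n * n ^ 2) := by gcongr
      _ ≤ n * (4 * (n * (1 / 10 ^ 20 * n ^ 2 + 1 / 10 ^ 20 * n ^ 2) + (1 / 10 ^ 20) ^ 2 * n ^ 3)) +
          4 * ((1 / 10 ^ 82 * n) * n * n ^ 2) := by
          have : n ≤ 1 / 10 ^ 82 * n * n := le_mul_of_one_le_left hn0 (by linarith)
          gcongr
      _ = (8 / 10 ^ 20 + 4 / 10 ^ 40 + 4 / 10 ^ 82) * n ^ 4 := by ring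
      _ ≤ (1 / 10 ^ 9) ^ 2 * n ^ 4 := by gcongr; norm_num
      _ = _ := by ring
  refine abs_le_of_sq_le_sq' ?_ hn0 |>.2
  have := hsq v
  rw [mul_pow]
  linarith [sq_nonneg n]

/-! ### Common neighbours of typical vertices -/

lemma card_class_le_common (H : SimpleGraph V) (χ : V → Bool) {b : Bool} {S : Finset V}
    (hS : ∀ x ∈ S, χ x ≠ b) :
    #{a | χ a = b} ≤ #{a | χ a = b ∧ ∀ x ∈ S, H.Adj x a} + ∑ x ∈ S, dg (gaps H χ) x := by
  refine (card_le_card (t := ({a | χ a = b ∧ ∀ x ∈ S, H.Adj x a} : Finset V) ∪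
    S.biUnion fun x => {a | (gaps H χ).Adj x a}) fun a ha => ?_).trans
    ((card_union_le _ _).trans (Nat.add_le_add_left card_biUnion_le _))
  simp only [mem_filter, mem_univ, true_and, mem_union, mem_biUnion, gaps_adj] at ha ⊢
  by_cases h : ∀ x ∈ S, H.Adj x a
  · exact .inl ⟨ha, h⟩
  · push Not at h
    obtain ⟨x, hx, hxa⟩ := h
    exact .inr ⟨x, hx, hxa, ha ▸ hS x hx⟩

/-- At most five vertices of one colour that miss few vertices of the other colour have many common
neighbours. -/
lemma NearBip.card_common_ge {H : SimpleGraph V} {χ : V → Bool} (h : NearBip H χ) {b : Bool}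
    {S : Finset V} (hS : ∀ x ∈ S, χ x ≠ b) (hg : ∀ x ∈ S, 50 * dg (gaps H χ) x ≤ Fintype.card V)
    (hc : #S ≤ 5) : 39 * Fintype.card V ≤ 100 * #{a | χ a = b ∧ ∀ x ∈ S, H.Adj x a} := by
  have h1 := card_class_le_common H χ hS
  have h2 := h.class_ge b
  have h3 : 50 * ∑ x ∈ S, dg (gaps H χ) x ≤ 5 * Fintype.card V := by
    rw [mul_sum]
    exact (sum_le_card_nsmul _ _ _ hg).trans (Nat.mul_le_mul_right _ hc)
  omega

/-! ### Deleting inner edges one by one -/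

lemma bow_delEdge_add_card (G : SimpleGraph V) (p q : V) :
    bow (delEdge G p q) + #{t ∈ bowties G | t ∉ bowties (delEdge G p q)} = bow G := by
  rw [bow, bow, ← card_filter_add_card_filter_not (s := bowties G)
    (fun t => t ∈ bowties (delEdge G p q))]
  congr 2
  ext t
  simp only [mem_filter]
  exact ⟨fun ht => ⟨bowties_mono (delEdge_le _ _ _) ht, ht⟩, fun ht => ht.2⟩

/-- Two of the three vertices of each triangle have the same colour, so every bowtie contains an
inner edge, which has two orientations. -/
lemma two_le_card_inner_of_mem (G : SimpleGraph V) (χ : V → Bool) {s : V × (V × V) × (V × V)}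
    (hs : s ∈ bowties G) :
    2 ≤ #{t : V × V | (inner G χ).Adj t.1 t.2 ∧ s ∉ bowties (delEdge G t.1 t.2)} := by
  obtain ⟨c, ⟨u, v⟩, w, z⟩ := s
  have key : ∀ p q, (inner G χ).Adj p q →
      (∀ G' : SimpleGraph V, (link G' c).Adj u v → G'.Adj p q) →
      2 ≤ #{t : V × V | (inner G χ).Adj t.1 t.2 ∧
        (c, (u, v), w, z) ∉ bowties (delEdge G t.1 t.2)} := by
    intro p q hpq hG
    have hne : (p, q) ≠ (q, p) := fun h => hpq.ne (Prod.ext_iff.1 h).1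
    rw [← card_pair hne]
    refine card_le_card fun t ht => ?_
    rw [mem_insert, mem_singleton] at ht
    rw [mem_filter]
    refine ⟨mem_univ _, ?_⟩
    rcases ht with rfl | rfl
    · refine ⟨hpq, fun hm => ?_⟩
      exact (delEdge_adj.1 (hG _ (mem_bowties.1 hm).1)).2 (.inl ⟨rfl, rfl⟩)
    · refine ⟨hpq.symm, fun hm => ?_⟩
      exact (delEdge_adj.1 (hG _ (mem_bowties.1 hm).1)).2 (.inr ⟨rfl, rfl⟩)
  obtain ⟨h4, h5, h6⟩ := (mem_bowties.1 hs).1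
  by_cases hcu : χ c = χ u
  · exact key c u ⟨h4, hcu⟩ fun G' h => h.1
  by_cases hcv : χ c = χ v
  · exact key c v ⟨h5, hcv⟩ fun G' h => h.2.1
  · refine key u v ⟨h6, ?_⟩ fun G' h => h.2.2
    revert hcu hcv
    cases χ c <;> cases χ u <;> cases χ v <;> simp

/-- Some inner edge lies in at least the average number of bowties. -/
lemma exists_delEdge_bow_le (G : SimpleGraph V) (χ : V → Bool) (h : vol (inner G χ) ≠ 0) :
    ∃ p q, (inner G χ).Adj p q ∧
      vol (inner G χ) * bow (delEdge G p q) + 2 * bow G ≤ vol (inner G χ) * bow G := by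
  set r : V × V → V × (V × V) × (V × V) → Prop := fun t s => s ∉ bowties (delEdge G t.1 t.2)
    with hr
  obtain ⟨N, hN⟩ : ∃ N : V × V → ℕ, N = fun t => #(bipartiteAbove r (bowties G) t) := ⟨_, rfl⟩
  have h0 : 2 * bow G ≤ ∑ t : V × V with (inner G χ).Adj t.1 t.2, N t := by
    rw [hN, sum_card_bipartiteAbove_eq_sum_card_bipartiteBelow r, bow, mul_comm, ← smul_eq_mul]
    refine card_nsmul_le_sum _ _ _ fun s hs => ?_
    refine (two_le_card_inner_of_mem G χ hs).trans_eq ?_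
    rw [bipartiteBelow, filter_filter]
  have h1 : #{t : V × V | (inner G χ).Adj t.1 t.2} = vol (inner G χ) := (vol_eq_card _).symm
  have h2 : ∀ t, bow (delEdge G t.1 t.2) + N t = bow G := fun t => by
    rw [hN]; exact bow_delEdge_add_card G t.1 t.2
  obtain ⟨t, ht, h3⟩ : ∃ t ∈ ({t : V × V | (inner G χ).Adj t.1 t.2} : Finset (V × V)),
      2 * bow G ≤ vol (inner G χ) * N t := by
    by_contra hcon
    push Not at hcon
    have h4 := sum_lt_sum_of_nonempty (by rw [← card_ne_zero, h1]; exact h) hcon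
    rw [← mul_sum, sum_const, smul_eq_mul, h1] at h4
    exact absurd h0 (not_le.2 (lt_of_mul_lt_mul_left h4 (Nat.zero_le _)))
  rw [mem_filter] at ht
  refine ⟨t.1, t.2, ht.2, ?_⟩
  have h4 : bow (delEdge G t.1 t.2) + N t = bow G := h2 t
  calc vol (inner G χ) * bow (delEdge G t.1 t.2) + 2 * bow G
      ≤ vol (inner G χ) * bow (delEdge G t.1 t.2) + vol (inner G χ) * N t :=
        Nat.add_le_add_left h3 _
    _ = _ := by rw [← mul_add, h4]

lemma inner_delEdge {G : SimpleGraph V} {χ : V → Bool} {p q : V} :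
    inner (delEdge G p q) χ = delEdge (inner G χ) p q := by
  ext a b
  simp only [inner_adj, delEdge_adj]
  tauto

/-- Deleting `k` inner edges greedily destroys at least the proportion `k / D` of the bowties, where
`D` is the number of inner edges. -/
theorem exists_delete_inner (G : SimpleGraph V) (χ : V → Bool) {D : ℕ} (hD : vol (inner G χ) = 2 * D)
    (k : ℕ) (hk : k ≤ D) : ∃ G' : SimpleGraph V, vol G' + 2 * k = vol G ∧
      vol (inner G' χ) + 2 * k = vol (inner G χ) ∧ D * bow G' ≤ (D - k) * bow G := by
  induction k with
  | zero => exact ⟨G, rfl, rfl, le_rfl⟩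
  | succ k ih =>
    obtain ⟨G', h1, h2, h3⟩ := ih (by omega)
    obtain ⟨p, q, hpq, h4⟩ := exists_delEdge_bow_le G' χ (by omega)
    obtain ⟨m, rfl⟩ := Nat.exists_eq_add_of_le hk
    have h5 : vol (inner G' χ) = 2 * (m + 1) := by omega
    have h6 := vol_delEdge hpq.1
    have h7 := vol_delEdge hpq
    refine ⟨delEdge G' p q, by omega, by rw [inner_delEdge]; omega, ?_⟩
    rw [h5] at h4
    have e1 : k + 1 + m - (k + 1) = m := by omega
    have e2 : k + 1 + m - k = m + 1 := by omega
    rw [e2] at h3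
    rw [e1]
    have h8 : (m + 1) * bow (delEdge G' p q) ≤ m * bow G' := by nlinarith
    refine le_of_mul_le_mul_left ?_ (Nat.succ_pos m)
    calc (m + 1) * ((k + 1 + m) * bow (delEdge G' p q))
        = (k + 1 + m) * ((m + 1) * bow (delEdge G' p q)) := by ring
      _ ≤ (k + 1 + m) * (m * bow G') := Nat.mul_le_mul_left _ h8
      _ = m * ((k + 1 + m) * bow G') := by ring
      _ ≤ m * ((m + 1) * bow G) := Nat.mul_le_mul_left _ h3
      _ = (m + 1) * (m * bow G) := by ring

/-! ### Replacing a vertex -/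

/-- The vertices of a labelled bowtie. -/
def supp (t : V × (V × V) × (V × V)) : Finset V :=
  {t.1, t.2.1.1, t.2.1.2, t.2.2.1, t.2.2.2}

lemma card_supp_le (t : V × (V × V) × (V × V)) : #(supp t) ≤ 5 := card_le_five

/-- Applying a map to the vertices of a labelled bowtie. -/
def mapTuple (φ : V → V) (t : V × (V × V) × (V × V)) : V × (V × V) × (V × V) :=
  (φ t.1, (φ t.2.1.1, φ t.2.1.2), (φ t.2.2.1, φ t.2.2.2))

lemma mapTuple_mem {G H : SimpleGraph V} {φ : V → V} {t : V × (V × V) × (V × V)} (ht : t ∈ bowties G)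
    (hinj : ∀ p ∈ supp t, ∀ q ∈ supp t, p ≠ q → φ p ≠ φ q)
    (hadj : ∀ p ∈ supp t, ∀ q ∈ supp t, G.Adj p q → H.Adj (φ p) (φ q)) :
    mapTuple φ t ∈ bowties H := by
  obtain ⟨c, ⟨u, v⟩, w, z⟩ := t
  have hc : c ∈ supp (c, (u, v), w, z) := by simp [supp]
  have hu : u ∈ supp (c, (u, v), w, z) := by simp [supp]
  have hv : v ∈ supp (c, (u, v), w, z) := by simp [supp]
  have hw : w ∈ supp (c, (u, v), w, z) := by simp [supp]
  have hz : z ∈ supp (c, (u, v), w, z) := by simp [supp]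
  rw [mem_bowties] at ht
  obtain ⟨⟨h1, h2, h3⟩, ⟨h4, h5, h6⟩, h7, h8, h9, h10⟩ := ht
  exact mem_bowties.2 ⟨⟨hadj _ hc _ hu h1, hadj _ hc _ hv h2, hadj _ hu _ hv h3⟩,
    ⟨hadj _ hc _ hw h4, hadj _ hc _ hz h5, hadj _ hw _ hz h6⟩, hinj _ hu _ hw h7,
    hinj _ hu _ hz h8, hinj _ hv _ hw h9, hinj _ hv _ hz h10⟩

lemma mapTuple_congr {φ ψ : V → V} {t : V × (V × V) × (V × V)} (h : ∀ p ∈ supp t, φ p = ψ p) :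
    mapTuple φ t = mapTuple ψ t := by
  obtain ⟨c, ⟨u, v⟩, w, z⟩ := t
  simp only [mapTuple, Prod.mk.injEq]
  refine ⟨h _ ?_, ⟨h _ ?_, h _ ?_⟩, h _ ?_, h _ ?_⟩ <;> simp [supp]

lemma supp_mapTuple (φ : V → V) (t : V × (V × V) × (V × V)) :
    supp (mapTuple φ t) = (supp t).image φ := by
  simp [supp, mapTuple, image_insert]

/-- Delete all edges at `v₀` and join `v₀` to the vertices of `B` instead. -/
def rewire (H : SimpleGraph V) (v₀ : V) (B : Finset V) : SimpleGraph V where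
  Adj p q := (H.Adj p q ∧ p ≠ v₀ ∧ q ≠ v₀) ∨ (p ≠ q ∧ ((p = v₀ ∧ q ∈ B) ∨ (q = v₀ ∧ p ∈ B)))
  symm := ⟨fun _ _ h => h.elim (fun h => .inl ⟨h.1.symm, h.2.2, h.2.1⟩)
    fun h => .inr ⟨h.1.symm, h.2.symm⟩⟩
  loopless := ⟨fun _ h => h.elim (fun h => h.1.ne rfl) fun h => h.1 rfl⟩

lemma rewire_adj {H : SimpleGraph V} {v₀ : V} {B : Finset V} {p q : V} : (rewire H v₀ B).Adj p q ↔
    (H.Adj p q ∧ p ≠ v₀ ∧ q ≠ v₀) ∨ (p ≠ q ∧ ((p = v₀ ∧ q ∈ B) ∨ (q = v₀ ∧ p ∈ B))) := Iff.rfl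

lemma dg_rewire {H : SimpleGraph V} {v₀ : V} {B : Finset V} (hB : v₀ ∉ B) :
    dg (rewire H v₀ B) v₀ = #B := by
  rw [dg]
  congr 1
  ext w
  simp only [mem_filter, mem_univ, true_and, rewire_adj]
  constructor
  · rintro (h | ⟨h, h' | h'⟩)
    · exact absurd rfl h.2.1
    · exact h'
    · exact absurd h'.1.symm h
  · intro hw
    exact .inr ⟨fun h => hB (h ▸ hw), .inl hw⟩

lemma vol_rewire {H : SimpleGraph V} {v₀ : V} {B : Finset V} (hB : v₀ ∉ B) :
    vol (rewire H v₀ B) + 2 * dg H v₀ = vol H + 2 * #B := by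
  rw [← dg_rewire (H := H) hB]
  refine vol_add_of_agree fun a b ha hb => ?_
  rw [rewire_adj]
  tauto

/-- If any few vertices of `B` have many common neighbours, then a bowtie through the rewired vertex
`v₀` yields many bowties of `H`: replace `v₀` by such a common neighbour. Hence `v₀` lies in few
bowties. -/
lemma card_new_bowties_le {H : SimpleGraph V} {v₀ : V} {B : Finset V} {m : ℕ}
    (hm : ∀ S ⊆ B, #S ≤ 5 → m + 5 ≤ #{a | ∀ x ∈ S, H.Adj x a}) :
    m * #(bowties (rewire H v₀ B) \ bowties H) ≤ 5 * bow H := by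
  set N := bowties (rewire H v₀ B) \ bowties H with hN
  set cand : V × (V × V) × (V × V) → Finset V := fun t =>
    ({a | ∀ x ∈ supp t ∩ B, H.Adj x a} : Finset V) \ supp t with hcand
  have h1 : m * #N ≤ ∑ t ∈ N, #(cand t) := by
    rw [mul_comm, ← smul_eq_mul]
    refine card_nsmul_le_sum _ _ _ fun t _ => ?_
    have h2 := hm (supp t ∩ B) inter_subset_right ((card_le_card inter_subset_left).trans
      (card_supp_le t))
    have h3 := le_card_sdiff (supp t) ({a | ∀ x ∈ supp t ∩ B, H.Adj x a} : Finset V)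
    have h4 := card_supp_le t
    simp only [hcand]
    omega
  have hv : ∀ t ∈ N, v₀ ∈ supp t := by
    intro t ht
    by_contra hv
    rw [hN, Finset.mem_sdiff] at ht
    refine ht.2 ?_
    have := mapTuple_mem (φ := id) (H := H) ht.1 (fun p _ q _ h => h) fun p hp q hq h => by
      rcases h with h | ⟨-, ⟨rfl, -⟩ | ⟨rfl, -⟩⟩
      · exact h.1
      · exact absurd hp hv
      · exact absurd hq hv
    exact this
  have h2 : ∑ t ∈ N, #(cand t) ≤ ∑ t ∈ bowties H, #(supp t) := by
    rw [← card_sigma, ← card_sigma]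
    refine card_le_card_of_injOn (fun x => ⟨mapTuple (Function.update id v₀ x.2) x.1, x.2⟩) ?_ ?_
    · rintro ⟨t, a⟩ hta
      simp only [coe_sigma, Set.mem_sigma_iff, mem_coe, hcand, Finset.mem_sdiff, mem_filter, mem_univ,
        true_and] at hta ⊢
      obtain ⟨ht, ha, hat⟩ := hta
      have hv0 := hv t ht
      rw [hN, Finset.mem_sdiff] at ht
      refine ⟨mapTuple_mem ht.1 ?_ ?_, ?_⟩
      · intro p hp q hq hpq
        by_cases hp0 : p = v₀
        · subst hp0
          rw [Function.update_self, Function.update_of_ne hpq.symm]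
          rintro rfl
          exact hat hq
        · rw [Function.update_of_ne hp0]
          by_cases hq0 : q = v₀
          · subst hq0
            rw [Function.update_self]
            rintro rfl
            exact hat hp
          · rw [Function.update_of_ne hq0]
            exact hpq
      · intro p hp q hq h
        rcases h with h | ⟨hpq, ⟨rfl, hqB⟩ | ⟨rfl, hpB⟩⟩
        · rw [Function.update_of_ne h.2.1, Function.update_of_ne h.2.2]
          exact h.1
        · rw [Function.update_self, Function.update_of_ne hpq.symm]
          exact (ha q (mem_inter.2 ⟨hq, hqB⟩)).symm
        · rw [Function.update_self, Function.update_of_ne hpq]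
          exact ha p (mem_inter.2 ⟨hp, hpB⟩)
      · rw [supp_mapTuple]
        exact mem_image.2 ⟨v₀, hv0, Function.update_self _ _ _⟩
    · rintro ⟨t, a⟩ hta ⟨t', a'⟩ hta' h
      simp only [Sigma.mk.injEq, heq_eq_eq] at h
      obtain ⟨h, rfl⟩ := h
      have inv : ∀ s : V × (V × V) × (V × V), a ∉ supp s →
          mapTuple (Function.update id a v₀) (mapTuple (Function.update id v₀ a) s) = s := by
        intro s hs
        have e : mapTuple (Function.update id a v₀) (mapTuple (Function.update id v₀ a) s) =
          mapTuple (fun p => Function.update id a v₀ (Function.update id v₀ a p)) s := rfl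
        have e' : mapTuple id s = s := rfl
        rw [e]
        conv_rhs => rw [← e']
        refine mapTuple_congr fun p hp => ?_
        by_cases hp0 : p = v₀
        · subst hp0
          rw [Function.update_self, Function.update_self]
          rfl
        · rw [Function.update_of_ne hp0]
          have : p ≠ a := fun h => hs (h ▸ hp)
          exact Function.update_of_ne this _ _
      simp only [coe_sigma, Set.mem_sigma_iff, mem_coe, hcand, Finset.mem_sdiff] at hta hta'
      have := inv t hta.2.2
      rw [h, inv t' hta'.2.2] at this
      rw [this]
  refine h1.trans (h2.trans ?_)
  rw [bow, mul_comm, ← smul_eq_mul]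
  exact sum_le_card_nsmul _ _ _ fun t _ => card_supp_le t

/-! ### No vertex misses many vertices of the other colour -/

/-- A vertex that misses few vertices of the other colour. -/
def Typical (H : SimpleGraph V) (χ : V → Bool) (v : V) : Prop :=
  50 * dg (gaps H χ) v ≤ Fintype.card V

lemma NearBip.common_of_list {H : SimpleGraph V} {χ : V → Bool} (h : NearBip H χ) {b : Bool}
    {S : Finset V} (hS : ∀ x ∈ S, χ x = b) (hg : ∀ x ∈ S, Typical H χ x) (hc : #S ≤ 5) :
    39 * Fintype.card V ≤ 100 * #{a | ∀ x ∈ S, H.Adj x a} := by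
  refine (h.card_common_ge (b := !b) (fun x hx => ?_) hg hc).trans
    (Nat.mul_le_mul_left _ (card_le_card fun a ha => ?_))
  · rw [hS x hx]; cases b <;> simp
  · rw [mem_filter] at ha ⊢
    exact ⟨ha.1, ha.2.2⟩

/-- Two different inner edges of the same colour with typical ends lie in a common bowtie. -/
lemma NearBip.bow_pos_of_two_edges {H : SimpleGraph V} {χ : V → Bool} (h : NearBip H χ) {b : Bool}
    {p q p' q' : V} (hpq : H.Adj p q) (hpq' : H.Adj p' q')
    (hc : ∀ x ∈ ({p, q, p', q'} : Finset V), χ x = b)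
    (ht : ∀ x ∈ ({p, q, p', q'} : Finset V), Typical H χ x)
    (h1 : (p', q') ≠ (p, q)) (h2 : (p', q') ≠ (q, p)) : bow H ≠ 0 := by
  have hn := h.card_ge
  have many : ∀ S ⊆ ({p, q, p', q'} : Finset V), 3 ≤ #{a | ∀ x ∈ S, H.Adj x a} := by
    intro S hS
    have := h.common_of_list (b := b) (S := S) (fun x hx => hc x (hS hx))
      (fun x hx => ht x (hS hx)) ((card_le_card hS).trans (card_le_four.trans (by norm_num)))
    omega
  -- edges `xy` and `xy'` with a common end
  have share : ∀ x y y' : V, x ∈ ({p, q, p', q'} : Finset V) → y ∈ ({p, q, p', q'} : Finset V) →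
      y' ∈ ({p, q, p', q'} : Finset V) → H.Adj x y → H.Adj x y' → y ≠ y' → bow H ≠ 0 := by
    intro x y y' hx hy hy' hxy hxy' hne
    have m1 := many {x, y, y'} (by
      intro z hz
      simp only [mem_insert, mem_singleton] at hz
      rcases hz with rfl | rfl | rfl <;> assumption)
    obtain ⟨z, hz, z', hz', hzz⟩ := one_lt_card.1 (by omega : 1 < #{a | ∀ w ∈ ({x, y, y'} : Finset V), H.Adj w a})
    simp only [mem_filter, mem_univ, true_and, mem_insert, mem_singleton, forall_eq_or_imp,
      forall_eq] at hz hz'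
    rw [bow, card_ne_zero]
    exact ⟨(x, (y, z), (y', z')), mem_bowties.2 ⟨⟨hxy, hz.1, hz.2.1⟩, ⟨hxy', hz'.1, hz'.2.2⟩, hne,
      hz'.2.1.ne, hz.2.2.ne', hzz⟩⟩
  have m1 : p ∈ ({p, q, p', q'} : Finset V) := by simp
  have m2 : q ∈ ({p, q, p', q'} : Finset V) := by simp
  have m3 : p' ∈ ({p, q, p', q'} : Finset V) := by simp
  have m4 : q' ∈ ({p, q, p', q'} : Finset V) := by simp
  by_cases e1 : p = p'
  · subst e1
    exact share p q q' m1 m2 m4 hpq hpq' fun e => h1 (by rw [e])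
  by_cases e2 : p = q'
  · subst e2
    exact share p q p' m1 m2 m3 hpq hpq'.symm fun e => h2 (by rw [e])
  by_cases e3 : q = p'
  · subst e3
    exact share q p q' m2 m1 m4 hpq.symm hpq' fun e => h2 (by rw [e])
  by_cases e4 : q = q'
  · subst e4
    exact share q p p' m2 m1 m3 hpq.symm hpq'.symm fun e => h1 (by rw [e])
  have m := many _ (Subset.refl _)
  obtain ⟨z, hz⟩ := card_pos.1 (by omega : 0 < #{a | ∀ w ∈ ({p, q, p', q'} : Finset V), H.Adj w a})
  simp only [mem_filter, mem_univ, true_and, mem_insert, mem_singleton, forall_eq_or_imp,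
    forall_eq] at hz
  rw [bow, card_ne_zero]
  exact ⟨(z, (p, q), (p', q')), mem_bowties.2 ⟨⟨hz.1.symm, hz.2.1.symm, hpq⟩,
    ⟨hz.2.2.1.symm, hz.2.2.2.symm, hpq'⟩, e1, e2, e3, e4⟩⟩

lemma card_not_typical_le (H : SimpleGraph V) (χ : V → Bool) :
    #{v | ¬ Typical H χ v} * Fintype.card V ≤ 50 * vol (gaps H χ) := by
  rw [vol, mul_sum, ← smul_eq_mul]
  refine (card_nsmul_le_sum _ (fun v => 50 * dg (gaps H χ) v) _ fun v hv => ?_).trans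
    (sum_le_sum_of_subset (subset_univ _))
  simp only [mem_filter, mem_univ, true_and, Typical, not_le] at hv
  exact hv.le

lemma dg_le_vol (R : SimpleGraph V) (v : V) : dg R v ≤ vol R :=
  single_le_sum (f := fun v => dg R v) (fun _ _ => Nat.zero_le _) (mem_univ v)

lemma card_fst_mem (R : SimpleGraph V) (S : Finset V) :
    #{t : V × V | R.Adj t.1 t.2 ∧ t.1 ∈ S} = ∑ v ∈ S, dg R v := by
  rw [card_filter, Fintype.sum_prod_type, ← sum_filter_add_sum_filter_not univ (fun v => v ∈ S)]
  have h1 : ∑ v with v ∉ S, ∑ w, (if R.Adj v w ∧ v ∈ S then 1 else 0) = 0 := by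
    refine sum_eq_zero fun v hv => sum_eq_zero fun w _ => ?_
    simp only [mem_filter, mem_univ, true_and] at hv
    simp [hv]
  rw [h1, add_zero]
  refine sum_congr (by ext; simp) fun v hv => ?_
  simp only [dg, card_filter]
  exact sum_congr rfl fun w _ => by simp [hv]

lemma card_snd_mem (R : SimpleGraph V) (S : Finset V) :
    #{t : V × V | R.Adj t.1 t.2 ∧ t.2 ∈ S} = ∑ v ∈ S, dg R v := by
  rw [← card_fst_mem]
  refine card_bij (fun t _ => t.swap) ?_ ?_ ?_
  · intro t ht
    simp only [mem_filter, mem_univ, true_and] at ht ⊢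
    exact ⟨ht.1.symm, ht.2⟩
  · intro t _ t' _ h
    exact Prod.swap_injective h
  · intro t ht
    simp only [mem_filter, mem_univ, true_and] at ht ⊢
    exact ⟨t.swap, ⟨ht.1.symm, ht.2⟩, Prod.swap_swap t⟩

/-- If some vertex misses many vertices of the other colour, then there are many gaps, hence many
inner edges with typical ends, hence bowties. -/
lemma NearBip.bow_ne_zero {H : SimpleGraph V} {χ : V → Bool} (h : NearBip H χ) {v₀ : V}
    (hv₀ : ¬ Typical H χ v₀) : bow H ≠ 0 := by
  have hn := h.card_ge
  have h1 := card_not_typical_le H χ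
  set S : Finset V := {v | ¬ Typical H χ v} with hS
  have h2 : 10 ^ 4 * ∑ v ∈ S, dg (inner H χ) v ≤ #S * Fintype.card V := by
    rw [mul_sum, ← smul_eq_mul (#S)]
    exact sum_le_card_nsmul _ _ _ fun v _ => h.dg_inner_le v
  set P : Finset (V × V) := {t | (inner H χ).Adj t.1 t.2 ∧ t.1 ∉ S ∧ t.2 ∉ S} with hP
  have h3 : vol (inner H χ) ≤ #P + (∑ v ∈ S, dg (inner H χ) v + ∑ v ∈ S, dg (inner H χ) v) := by
    nth_rw 2 [← card_fst_mem]
    rw [← card_snd_mem, vol_eq_card]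
    refine (card_le_card fun t ht => ?_).trans ((card_union_le _ _).trans
      (Nat.add_le_add_left (card_union_le _ _) _))
    simp only [mem_filter, mem_univ, true_and, mem_union, hP] at ht ⊢
    tauto
  have h4 := h.vol_gaps_lt
  have h5 := dg_le_vol (gaps H χ) v₀
  rw [Typical, not_le] at hv₀
  have h6 : 5 ≤ #P := by omega
  -- Oriented edges are counted, so three of them with one colour come from two different edges.
  have h7 : ∃ b, 3 ≤ #{t ∈ P | χ t.1 = b} := by
    by_contra hcon
    push Not at hcon
    have h8 := hcon true
    have h9 := hcon false
    rw [← card_filter_add_card_filter_not (s := P) (fun t => χ t.1 = true)] at h6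
    simp only [Bool.not_eq_true] at h6
    omega
  obtain ⟨b, hb⟩ := h7
  obtain ⟨⟨p, q⟩, hpq⟩ := card_pos.1 (by omega : 0 < #{t ∈ P | χ t.1 = b})
  obtain ⟨⟨p', q'⟩, hpq', hne⟩ := exists_mem_notMem_of_card_lt_card
    (lt_of_le_of_lt (card_le_two (a := (p, q)) (b := (q, p))) (by omega : 2 < #{t ∈ P | χ t.1 = b}))
  simp only [hP, mem_filter, mem_univ, true_and, inner_adj, hS, not_not] at hpq hpq'
  simp only [mem_insert, mem_singleton, not_or] at hne
  refine h.bow_pos_of_two_edges (b := b) hpq.1.1.1 hpq'.1.1.1 ?_ ?_ hne.1 hne.2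
  · simp only [mem_insert, mem_singleton, forall_eq_or_imp, forall_eq]
    exact ⟨hpq.2, hpq.1.1.2 ▸ hpq.2, hpq'.2, hpq'.1.1.2 ▸ hpq'.2⟩
  · simp only [mem_insert, mem_singleton, forall_eq_or_imp, forall_eq]
    exact ⟨hpq.1.2.1, hpq.1.2.2, hpq'.1.2.1, hpq'.1.2.2⟩

/-- In an optimal graph all vertices are typical: joining an atypical vertex to the typical vertices
of the other colour instead of its neighbours hardly creates bowties, and it allows us to delete
many inner edges. -/
theorem NearBip.typical {H : SimpleGraph V} {χ : V → Bool} (h : NearBip H χ) (hH : Opt H) (v₀ : V) :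
    Typical H χ v₀ := by
  by_contra hv₀
  have hpos := h.bow_ne_zero hv₀
  have hn := h.card_ge
  have hgap := h.vol_gaps_lt
  set B : Finset V := {x | χ v₀ ≠ χ x ∧ Typical H χ x} with hB
  have hvB : v₀ ∉ B := by simp [hB]
  obtain ⟨m, hm⟩ : ∃ m, m = 3 * Fintype.card V / 10 := ⟨_, rfl⟩
  have hnew := card_new_bowties_le (H := H) (v₀ := v₀) (B := B) (m := m) fun S hSB hS5 => by
    have := h.common_of_list (b := !χ v₀) (S := S) (fun x hx => by
      have := hSB hx
      simp only [hB, mem_filter, mem_univ, true_and] at this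
      revert this
      cases χ x <;> cases χ v₀ <;> simp) (fun x hx => by
      have := hSB hx
      simp only [hB, mem_filter, mem_univ, true_and] at this
      exact this.2) hS5
    omega
  set G := rewire H v₀ B with hG
  -- the number of edges won
  have hBcard : #{w | χ v₀ ≠ χ w} ≤ #B + #{v | ¬ Typical H χ v} := by
    refine (card_le_card fun w hw => ?_).trans (card_union_le _ _)
    simp only [hB, mem_union, mem_filter, mem_univ, true_and] at hw ⊢
    tauto
  have h1 := card_not_typical_le H χ
  have h2 := dg_cross_add_dg_gaps H χ v₀
  have h3 := dg_inner_add_dg_cross H χ v₀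
  have h4 := h.dg_inner_le v₀
  have h5 := h.vol_inner_le
  have hW : 10 ^ 6 * #{v | ¬ Typical H χ v} ≤ Fintype.card V := by
    have : 10 ^ 6 * #{v | ¬ Typical H χ v} * Fintype.card V ≤ Fintype.card V * Fintype.card V := by
      rw [mul_assoc, ← sq]
      omega
    exact Nat.le_of_mul_le_mul_right this (by omega)
  rw [Typical, not_le] at hv₀
  obtain ⟨s, hs⟩ : ∃ s, #B = dg H v₀ + s := Nat.exists_eq_add_of_le (by omega)
  have hs' : Fintype.card V ≤ 100 * s := by omega
  have hvolG : vol G = vol H + 2 * s := by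
    have := vol_rewire (H := H) hvB
    rw [hG]
    omega
  -- the colouring still has few inner edges
  have hinner : inner G χ ≤ inner H χ := by
    rintro p q ⟨hpq, hc⟩
    rw [hG, rewire_adj] at hpq
    rcases hpq with hpq | ⟨-, ⟨rfl, hq⟩ | ⟨rfl, hp⟩⟩
    · exact ⟨hpq.1, hc⟩
    · simp only [hB, mem_filter, mem_univ, true_and] at hq
      exact absurd hc hq.1
    · simp only [hB, mem_filter, mem_univ, true_and] at hp
      exact absurd hc.symm hp.1
  obtain ⟨D, hD⟩ : ∃ D, vol (inner G χ) = 2 * D := ⟨_, vol_eq_two_mul_ncard _⟩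
  have h6 := vol_mono hinner
  have hsD : s ≤ D := by
    have a1 := vol_inner_add_vol_cross G χ
    have a2 := vol_cross_add_vol_gaps G χ
    have a3 := vol_inner_add_vol_cross H χ
    have a4 := vol_cross_add_vol_gaps H χ
    omega
  obtain ⟨G', g1, -, g3⟩ := exists_delete_inner G χ hD s hsD
  have g4 := hH G' (by omega)
  have g5 : bow G ≤ bow H + #(bowties G \ bowties H) := by
    rw [bow, bow, ← card_union_of_disjoint disjoint_sdiff, union_sdiff_self_eq_union]
    exact card_le_card subset_union_right
  -- compare the two effects
  have k1 : D * bow H ≤ (D - s) * (bow H + #(bowties G \ bowties H)) :=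
    (Nat.mul_le_mul_left _ g4).trans (g3.trans (Nat.mul_le_mul_left _ g5))
  obtain ⟨r, rfl⟩ := Nat.exists_eq_add_of_le hsD
  generalize #(bowties G \ bowties H) = N at *
  rw [Nat.add_sub_cancel_left] at k1
  have k2 : s * bow H ≤ r * N := by nlinarith
  have k3 : m * s * bow H ≤ 5 * r * bow H := by
    calc m * s * bow H = m * (s * bow H) := by ring
      _ ≤ m * (r * N) := Nat.mul_le_mul_left _ k2
      _ = r * (m * N) := by ring
      _ ≤ r * (5 * bow H) := Nat.mul_le_mul_left _ hnew
      _ = 5 * r * bow H := by ring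
  have k4 : m * s ≤ 5 * r := Nat.le_of_mul_le_mul_right k3 (Nat.pos_of_ne_zero hpos)
  have k5 : Fintype.card V * Fintype.card V ≤ 5 * m * (100 * s) := Nat.mul_le_mul (by omega) hs'
  have k6 : 5 * m * (100 * s) = 500 * (m * s) := by ring
  rw [sq] at h5
  have : 0 < Fintype.card V * Fintype.card V := Nat.mul_pos (by omega) (by omega)
  omega

/-! ### No edge between the colour classes is missing -/

lemma vol_link_le (G : SimpleGraph V) (χ : V → Bool) (c : V) : vol (link G c) ≤
    2 * (dg (inner G χ) c * Fintype.card V) + vol (inner G χ) := by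
  set N : Finset V := {w | (inner G χ).Adj c w} with hN
  have h : ({t : V × V | (link G c).Adj t.1 t.2} : Finset (V × V)) ⊆
      ((N ×ˢ univ) ∪ (univ ×ˢ N)) ∪ ({t : V × V | (inner G χ).Adj t.1 t.2} : Finset (V × V)) := by
    rintro ⟨p, q⟩ ht
    simp only [mem_filter, mem_univ, true_and, link_adj, mem_union, mem_product, and_true, hN,
      inner_adj] at ht ⊢
    by_cases h1 : χ c = χ p
    · exact .inl (.inl ⟨ht.1, h1⟩)
    by_cases h2 : χ c = χ q
    · exact .inl (.inr ⟨ht.2.1, h2⟩)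
    · refine .inr ⟨ht.2.2, ?_⟩
      revert h1 h2
      cases χ c <;> cases χ p <;> cases χ q <;> simp
  have h1 := card_le_card h
  have h2 := card_union_le ((N ×ˢ univ) ∪ (univ ×ˢ N))
    ({t : V × V | (inner G χ).Adj t.1 t.2} : Finset (V × V))
  have h3 := card_union_le (N ×ˢ (univ : Finset V)) ((univ : Finset V) ×ˢ N)
  have h4 : #N = dg (inner G χ) c := rfl
  rw [← vol_eq_card] at h1
  rw [← vol_eq_card] at h2
  rw [card_product, card_product, Finset.card_univ, h4, mul_comm (Fintype.card V)] at h3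
  omega

/-- If all neighbours of `c` of its own colour are avoided, only inner edges remain. -/
lemma avoid_le_vol_inner {G : SimpleGraph V} {χ : V → Bool} {c x y : V}
    (h : ∀ w, (inner G χ).Adj c w → w = x ∨ w = y) : avoid G c x y ≤ vol (inner G χ) := by
  rw [avoid, vol_eq_card]
  refine card_le_card ?_
  rintro ⟨p, q⟩ ht
  simp only [mem_filter, mem_univ, true_and, link_adj, inner_adj] at ht ⊢
  refine ⟨ht.1.2.2, ?_⟩
  have h1 : χ c ≠ χ p := fun e => (h p ⟨ht.1.1, e⟩).elim ht.2.1 ht.2.2.1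
  have h2 : χ c ≠ χ q := fun e => (h q ⟨ht.1.2.1, e⟩).elim ht.2.2.2.1 ht.2.2.2.2
  revert h1 h2
  cases χ c <;> cases χ p <;> cases χ q <;> simp

lemma commonNbrs_subset {G : SimpleGraph V} {χ : V → Bool} {u v : V} (huv : χ u ≠ χ v) :
    commonNbrs G u v ⊆ ({w | (inner G χ).Adj u w} : Finset V) ∪
      ({w | (inner G χ).Adj v w} : Finset V) := by
  intro z hz
  rw [mem_commonNbrs] at hz
  simp only [mem_union, mem_filter, mem_univ, true_and, inner_adj]
  by_cases h : χ u = χ z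
  · exact .inl ⟨hz.1, h⟩
  · refine .inr ⟨hz.2, ?_⟩
    revert h huv
    cases χ u <;> cases χ v <;> cases χ z <;> simp

lemma card_commonNbrs_le {G : SimpleGraph V} {χ : V → Bool} {u v : V} (huv : χ u ≠ χ v) :
    #(commonNbrs G u v) ≤ dg (inner G χ) u + dg (inner G χ) v :=
  (card_le_card (commonNbrs_subset huv)).trans (card_union_le _ _)

/-- An inner edge at a vertex of inner degree `d` lies in many bowties centred at that vertex, whose
second triangle uses one of the other `d - 1` inner edges. -/
lemma NearBip.card_star_bowties_ge {H : SimpleGraph V} {χ : V → Bool} (h : NearBip H χ)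
    (ht : ∀ v, Typical H χ v) {x y : V} (hxy : (inner H χ).Adj x y) :
    (dg (inner H χ) x - 1) * Fintype.card V ^ 2 ≤
      10 * #{t ∈ bowties H | t.1 = x ∧ t.2.1.1 = y} := by
  set N : Finset V := ({w | (inner H χ).Adj x w} : Finset V).erase y with hN
  have hNc : #N = dg (inner H χ) x - 1 := card_erase_of_mem (by simpa using hxy)
  set C : V → Finset V := fun y' => {a | ∀ w ∈ ({x, y, y'} : Finset V), H.Adj w a} with hC
  have h1 : ∑ y' ∈ N, #(C y').offDiag ≤ #{t ∈ bowties H | t.1 = x ∧ t.2.1.1 = y} := by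
    rw [← card_sigma]
    refine card_le_card_of_injOn (fun s => (x, (y, s.2.1), (s.1, s.2.2))) ?_ ?_
    · rintro ⟨y', z, z'⟩ hs
      simp only [coe_sigma, Set.mem_sigma_iff, mem_coe, hN, hC, mem_offDiag, mem_erase, mem_filter,
        mem_univ, true_and, mem_insert, mem_singleton, forall_eq_or_imp, forall_eq,
        mem_bowties, and_true] at hs ⊢
      obtain ⟨⟨hne, hy'⟩, hz, hz', hzz⟩ := hs
      exact ⟨⟨hxy.1, hz.1, hz.2.1⟩, ⟨hy'.1, hz'.1, hz'.2.2⟩, hne.symm, hz'.2.1.ne, hz.2.2.ne', hzz⟩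
    · rintro ⟨y', z, z'⟩ - ⟨y'', w, w'⟩ - h
      simp only [Prod.mk.injEq, true_and] at h
      obtain ⟨rfl, rfl, rfl⟩ := h
      rfl
  have h2 : ∀ y' ∈ N, Fintype.card V ^ 2 ≤ 10 * #(C y').offDiag := by
    intro y' hy'
    simp only [hN, mem_erase, mem_filter, mem_univ, true_and] at hy'
    have h3 := h.common_of_list (b := χ x) (S := {x, y, y'}) (by
      simp only [mem_insert, mem_singleton, forall_eq_or_imp, forall_eq, true_and]
      exact ⟨hxy.2.symm, hy'.2.2.symm⟩) (fun w _ => ht w) (card_le_three.trans (by norm_num))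
    have h4 := h.card_ge
    have h5 : #(C y').offDiag = #(C y') * #(C y') - #(C y') := offDiag_card _
    have h6 : 39 * Fintype.card V ≤ 100 * #(C y') := h3
    generalize #(C y') = m at h5 h6
    rw [h5]
    have h7 : m ≤ m * m := Nat.le_mul_self m
    zify [h7] at h4 h6 ⊢
    nlinarith
  have h3 := card_nsmul_le_sum N _ _ h2
  rw [hNc, smul_eq_mul, ← mul_sum] at h3
  omega

/-- If some vertex has two neighbours of its own colour, exchanging an inner edge at a vertex of
maximum inner degree for a gap decreases the number of bowties. -/
lemma NearBip.dg_inner_le_one {H : SimpleGraph V} {χ : V → Bool} (h : NearBip H χ) (hH : Opt H)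
    (ht : ∀ v, Typical H χ v) {u v : V} (huv : (gaps H χ).Adj u v) (w : V) :
    dg (inner H χ) w ≤ 1 := by
  obtain ⟨x, -, hx⟩ := exists_max_image univ (fun x => dg (inner H χ) x) ⟨w, mem_univ w⟩
  by_contra hw
  have hΔ : 2 ≤ dg (inner H χ) x := by have := hx w (mem_univ _); omega
  obtain ⟨y, hy⟩ := card_pos.1 (by rw [← dg]; omega : 0 < #{w | (inner H χ).Adj x w})
  simp only [mem_filter, mem_univ, true_and] at hy
  have h1 := h.card_star_bowties_ge ht hy
  have h2 := hH.exchange (u := u) (v := v) hy.1 (fun e => huv.2 (by rw [e])) huv.1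
    (filter_subset (fun t => t.1 = x ∧ t.2.1.1 = y) (bowties H)) (by
      rintro ⟨c, ⟨a, b⟩, ⟨d, e⟩⟩ ht h
      simp only [mem_filter, mem_bowties] at ht h
      obtain ⟨-, rfl, rfl⟩ := ht
      exact (delEdge_adj.1 h.1.1).2 (.inl ⟨rfl, rfl⟩))
  set G := delEdge H x y with hG
  set Δ := dg (inner H χ) x with hΔ'
  have hi : inner G χ ≤ inner H χ := fun a b hab => ⟨delEdge_le _ _ _ hab.1, hab.2⟩
  have hd : ∀ w, dg (inner G χ) w ≤ Δ := fun w => (dg_mono hi w).trans (hx w (mem_univ _))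
  have hv : vol (inner G χ) ≤ Δ * Fintype.card V := by
    rw [vol, mul_comm, ← smul_eq_mul]
    exact sum_le_card_nsmul _ _ _ fun w _ => hd w
  have hl : ∀ c, vol (link G c) ≤ 3 * (Δ * Fintype.card V) := fun c => by
    have := vol_link_le G χ c
    have := Nat.mul_le_mul_right (Fintype.card V) (hd c)
    omega
  have h3 : ∑ z ∈ commonNbrs G u v, (avoid G u v z + avoid G v u z + avoid G z u v) ≤
      (2 * Δ) * (9 * (Δ * Fintype.card V)) := by
    refine (sum_le_card_nsmul _ _ (9 * (Δ * Fintype.card V)) fun z _ => ?_).trans ?_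
    · have := (avoid_le_vol G u v z).trans (hl u)
      have := (avoid_le_vol G v u z).trans (hl v)
      have := (avoid_le_vol G z u v).trans (hl z)
      omega
    · rw [smul_eq_mul]
      have := card_commonNbrs_le (G := G) huv.2
      have := hd u
      have := hd v
      exact Nat.mul_le_mul_right _ (by omega)
  have h4 := h.dg_inner_le x
  have hn := h.card_ge
  rw [← hΔ'] at h4
  have h5 : (Δ - 1) * Fintype.card V ^ 2 ≤ 720 * (Δ * Δ * Fintype.card V) := by
    calc (Δ - 1) * Fintype.card V ^ 2 ≤ 10 * (4 * ((2 * Δ) * (9 * (Δ * Fintype.card V)))) := by omega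
      _ = _ := by ring
  clear_value Δ
  obtain ⟨d, rfl⟩ : ∃ d, Δ = d + 2 := ⟨Δ - 2, by omega⟩
  generalize Fintype.card V = n at *
  have e : d + 2 - 1 = d + 1 := by omega
  rw [e] at h5
  have h6 : (d + 1) * n ≤ 720 * ((d + 2) * (d + 2)) := by
    refine Nat.le_of_mul_le_mul_right ?_ (by omega : 0 < n)
    calc (d + 1) * n * n = (d + 1) * n ^ 2 := by ring
      _ ≤ _ := h5
      _ = _ := by ring
  nlinarith

/-- If the inner edges form a matching, an inner edge `pq` forms bowties with all the other inner
edges, except for those that are separated from it by gaps. -/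
lemma NearBip.card_matching_bowties_ge {H : SimpleGraph V} {χ : V → Bool} (h : NearBip H χ)
    (ht : ∀ v, Typical H χ v) (hd : ∀ v, dg (inner H χ) v ≤ 1) {p q : V}
    (hpq : (inner H χ).Adj p q) :
    3 * Fintype.card V * (vol (inner H χ) - 2) ≤ 20 * #{t ∈ bowties H |
      (t.1 = p ∧ t.2.1.1 = q) ∨ (t.1 = q ∧ t.2.1.1 = p) ∨ t.2.1 = (p, q)} := by
  have hn := h.card_ge
  have huniq : ∀ {a b b'}, (inner H χ).Adj a b → (inner H χ).Adj a b' → b = b' := fun {a b b'} h h' =>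
    card_le_one.1 (hd a) b (by simpa using h) b' (by simpa using h')
  set T := {t ∈ bowties H | (t.1 = p ∧ t.2.1.1 = q) ∨ (t.1 = q ∧ t.2.1.1 = p) ∨ t.2.1 = (p, q)}
    with hT
  set F : Finset (V × V) := (({t | (inner H χ).Adj t.1 t.2} : Finset (V × V)).erase (p, q)).erase
    (q, p) with hF
  have hFc : #F = vol (inner H χ) - 2 := by
    rw [hF, card_erase_of_mem, card_erase_of_mem, vol_eq_card]
    · omega
    · simpa using hpq
    · simp [hpq.symm, hpq.ne']
  have hFne : ∀ {a b}, (a, b) ∈ F → (inner H χ).Adj a b ∧ p ≠ a ∧ p ≠ b ∧ q ≠ a ∧ q ≠ b := by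
    intro a b hab
    simp only [hF, mem_erase, mem_filter, mem_univ, true_and, ne_eq, Prod.mk.injEq] at hab
    obtain ⟨h1, h2, h3⟩ := hab
    refine ⟨h3, ?_, ?_, ?_, ?_⟩
    · rintro rfl; exact h2 ⟨rfl, huniq h3 hpq⟩
    · rintro rfl; exact h1 ⟨huniq h3.symm hpq, rfl⟩
    · rintro rfl; exact h1 ⟨rfl, huniq h3 hpq.symm⟩
    · rintro rfl; exact h2 ⟨huniq h3.symm hpq.symm, rfl⟩
  set R : Finset (V × V) := F.filter fun t => (gaps H χ).Adj p t.1 ∨ (gaps H χ).Adj p t.2 with hR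
  set S : Finset (V × V) := F.filter fun t => (gaps H χ).Adj q t.1 ∨ (gaps H χ).Adj q t.2 with hS
  -- inner edges separated from a vertex by gaps
  have hsep : ∀ w, #(F.filter fun t => (gaps H χ).Adj w t.1 ∨ (gaps H χ).Adj w t.2) ≤
      2 * dg (gaps H χ) w := by
    intro w
    rw [filter_or, two_mul]
    refine (card_union_le _ _).trans (Nat.add_le_add ?_ ?_)
    · refine card_le_card_of_injOn (fun t => t.1) ?_ ?_
      · rintro t ht
        simp only [mem_coe, mem_filter, mem_univ, true_and] at ht ⊢
        exact ht.2
      · rintro ⟨a, b⟩ h1 ⟨a', b'⟩ h2 (rfl : a = a')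
        simp only [mem_coe, mem_filter] at h1 h2
        rw [huniq (hFne h1.1).1 (hFne h2.1).1]
    · refine card_le_card_of_injOn (fun t => t.2) ?_ ?_
      · rintro t ht
        simp only [mem_coe, mem_filter, mem_univ, true_and] at ht ⊢
        exact ht.2
      · rintro ⟨a, b⟩ h1 ⟨a', b'⟩ h2 (rfl : b = b')
        simp only [mem_coe, mem_filter] at h1 h2
        rw [huniq (hFne h1.1).1.symm (hFne h2.1).1.symm]
  have hpqg : 2 * (dg (gaps H χ) p + dg (gaps H χ) q) ≤ vol (gaps H χ) := by
    have e1 := card_fst_mem (gaps H χ) {p, q}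
    have e2 := card_snd_mem (gaps H χ) {p, q}
    rw [sum_pair hpq.ne] at e1 e2
    rw [two_mul]
    nth_rw 1 [← e1]
    rw [← e2, vol_eq_card, ← card_union_of_disjoint]
    · refine card_le_card fun t ht => ?_
      simp only [mem_union, mem_filter, mem_univ, true_and] at ht ⊢
      tauto
    · rw [disjoint_left]
      rintro ⟨a, b⟩ h1 h2
      simp only [mem_filter, mem_univ, true_and, mem_insert, mem_singleton, gaps_adj] at h1 h2
      have := hpq.2
      rcases h1.2 with rfl | rfl <;> rcases h2.2 with rfl | rfl <;> simp_all
  have hRS : 2 * #(R ∩ S) + 2 ≤ vol (inner H χ) := by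
    have h1 : #R ≤ 2 * dg (gaps H χ) p := hsep p
    have h2 : #S ≤ 2 * dg (gaps H χ) q := hsep q
    have h3 := card_le_card (inter_subset_left (s₁ := R) (s₂ := S))
    have h4 := card_le_card (inter_subset_right (s₁ := R) (s₂ := S))
    have h5 := h.vol_gaps_lt
    omega
  have hfib : ∀ f ∈ F \ (R ∩ S), 3 * Fintype.card V ≤ 10 * #{t ∈ T | t.2.2 = f} := by
    rintro ⟨a, b⟩ hf
    rw [Finset.mem_sdiff] at hf
    obtain ⟨hf, hRS⟩ := hf
    obtain ⟨hab, n1, n2, n3, n4⟩ := hFne hf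
    have hsub : ∀ (Z : Finset V) (g : V → V × (V × V) × (V × V)), Function.Injective g →
        (∀ z ∈ Z, g z ∈ T ∧ (g z).2.2 = (a, b)) → #Z ≤ #{t ∈ T | t.2.2 = (a, b)} := by
      intro Z g hg hZ
      refine card_le_card_of_injOn g (fun z hz => ?_) hg.injOn
      rw [mem_coe, mem_filter]
      exact hZ z hz
    by_cases hc : χ a = χ p
    · -- same colour: the centre is a common neighbour of all four ends
      have h1 := h.common_of_list (b := χ p) (S := {p, q, a, b}) (by
        simp only [mem_insert, mem_singleton, forall_eq_or_imp, forall_eq, true_and]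
        exact ⟨hpq.2.symm, hc, hab.2.symm.trans hc⟩) (fun w _ => ht w)
        (card_le_four.trans (by norm_num))
      have h2 := hsub {z | ∀ x ∈ ({p, q, a, b} : Finset V), H.Adj x z} (fun z => (z, (p, q), (a, b)))
        (fun z z' h => (Prod.mk.inj h).1) (fun z hz => ⟨?_, rfl⟩)
      · omega
      · simp only [mem_filter, mem_univ, true_and, mem_insert, mem_singleton, forall_eq_or_imp,
          forall_eq] at hz
        rw [hT, mem_filter, mem_bowties]
        exact ⟨⟨⟨hz.1.symm, hz.2.1.symm, hpq.1⟩, ⟨hz.2.2.1.symm, hz.2.2.2.symm, hab.1⟩,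
          n1, n2, n3, n4⟩, .inr (.inr rfl)⟩
    -- different colours: the centre is an end of `pq` adjacent to both ends of `ab`
    have h1 := h.common_of_list (b := χ p) (S := {p, q}) (by
      simp only [mem_insert, mem_singleton, forall_eq_or_imp, forall_eq, true_and]
      exact hpq.2.symm) (fun w _ => ht w) (card_le_two.trans (by norm_num))
    set Z : Finset V := ({z | ∀ x ∈ ({p, q} : Finset V), H.Adj x z} : Finset V) \ {a, b} with hZ
    have h2 : 3 * Fintype.card V ≤ 10 * #Z := by
      have h3 : #{z | ∀ x ∈ ({p, q} : Finset V), H.Adj x z} - #({a, b} : Finset V) ≤ #Z :=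
        le_card_sdiff _ _
      have h4 : #({a, b} : Finset V) ≤ 2 := card_le_two
      omega
    have hZm : ∀ z ∈ Z, H.Adj p z ∧ H.Adj q z ∧ z ≠ a ∧ z ≠ b := by
      intro z hz
      simp only [hZ, Finset.mem_sdiff, mem_filter, mem_univ, true_and, mem_insert, mem_singleton,
        forall_eq_or_imp, forall_eq, not_or] at hz
      exact ⟨hz.1.1, hz.1.2, hz.2⟩
    refine h2.trans (Nat.mul_le_mul_left _ ?_)
    have hcp : χ p ≠ χ a ∧ χ p ≠ χ b := ⟨Ne.symm hc, fun e => hc (hab.2.trans e.symm)⟩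
    have hcq : χ q ≠ χ a ∧ χ q ≠ χ b := by rw [← hpq.2]; exact hcp
    have hnot : (H.Adj p a ∧ H.Adj p b) ∨ (H.Adj q a ∧ H.Adj q b) := by
      by_contra hcon
      apply hRS
      simp only [hR, hS, mem_inter, mem_filter, gaps_adj]
      refine ⟨⟨hf, ?_⟩, ⟨hf, ?_⟩⟩
      · by_cases ha : H.Adj p a
        · exact .inr ⟨fun hb => hcon (.inl ⟨ha, hb⟩), hcp.2⟩
        · exact .inl ⟨ha, hcp.1⟩
      · by_cases ha : H.Adj q a
        · exact .inr ⟨fun hb => hcon (.inr ⟨ha, hb⟩), hcq.2⟩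
        · exact .inl ⟨ha, hcq.1⟩
    rcases hnot with hnot | hnot
    · refine hsub Z (fun z => (p, (q, z), (a, b))) (fun z z' h => ?_) fun z hz => ⟨?_, rfl⟩
      · simpa using h
      · obtain ⟨z1, z2, z3, z4⟩ := hZm z hz
        rw [hT, mem_filter, mem_bowties]
        exact ⟨⟨⟨hpq.1, z1, z2⟩, ⟨hnot.1, hnot.2, hab.1⟩, n3, n4, z3, z4⟩, .inl ⟨rfl, rfl⟩⟩
    · refine hsub Z (fun z => (q, (p, z), (a, b))) (fun z z' h => ?_) fun z hz => ⟨?_, rfl⟩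
      · simpa using h
      · obtain ⟨z1, z2, z3, z4⟩ := hZm z hz
        rw [hT, mem_filter, mem_bowties]
        exact ⟨⟨⟨hpq.1.symm, z2, z1⟩, ⟨hnot.1, hnot.2, hab.1⟩, n1, n2, z3, z4⟩,
          .inr (.inl ⟨rfl, rfl⟩)⟩
  have hsum : ∑ f ∈ F \ (R ∩ S), #{t ∈ T | t.2.2 = f} ≤ #T := by
    rw [card_eq_sum_card_fiberwise (f := fun t => t.2.2) (t := univ) (by simp)]
    exact sum_le_sum_of_subset (subset_univ _)
  have hcard := le_card_sdiff (R ∩ S) F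
  have h1 := card_nsmul_le_sum _ _ _ hfib
  rw [smul_eq_mul, ← mul_sum] at h1
  have h2 : vol (inner H χ) - 2 ≤ 2 * #(F \ (R ∩ S)) := by omega
  calc 3 * Fintype.card V * (vol (inner H χ) - 2)
      ≤ 3 * Fintype.card V * (2 * #(F \ (R ∩ S))) := Nat.mul_le_mul_left _ h2
    _ = 2 * (#(F \ (R ∩ S)) * (3 * Fintype.card V)) := by ring
    _ ≤ 20 * #T := by omega

/-- An optimal graph contains all edges between the two colour classes. -/
theorem NearBip.no_gaps {H : SimpleGraph V} {χ : V → Bool} (h : NearBip H χ) (hH : Opt H)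
    {u v : V} (huv : χ u ≠ χ v) : H.Adj u v := by
  by_contra hn
  have hgap : (gaps H χ).Adj u v := ⟨hn, huv⟩
  have ht := h.typical hH
  have hd := h.dg_inner_le_one hH ht hgap
  have hcard := h.card_ge
  -- a gap forces a second inner edge
  have hvol : 4 ≤ vol (inner H χ) := by
    have h1 : vol (gaps H χ) ≠ 0 := by
      rw [vol_eq_card, card_ne_zero]
      exact ⟨(u, v), by simpa using hgap⟩
    have h2 := h.vol_gaps_lt
    have h3 := vol_eq_two_mul_ncard (gaps H χ)
    omega
  -- an inner edge whose deletion leaves `u` without neighbours of its own colour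
  obtain ⟨p, q, hpq, hu⟩ : ∃ p q, (inner H χ).Adj p q ∧
      ∀ w, ¬ (inner (delEdge H p q) χ).Adj u w := by
    by_cases h0 : ∃ w, (inner H χ).Adj u w
    · obtain ⟨w, hw⟩ := h0
      refine ⟨u, w, hw, fun w' hw' => ?_⟩
      rw [inner_delEdge, delEdge_adj] at hw'
      refine hw'.2 (.inl ⟨rfl, ?_⟩)
      exact card_le_one.1 (hd u) w' (by simpa using hw'.1) w (by simpa using hw)
    · push Not at h0
      have h1 : vol (inner H χ) ≠ 0 := by omega
      rw [vol_eq_card, card_ne_zero] at h1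
      obtain ⟨⟨p, q⟩, hpq⟩ := h1
      simp only [mem_filter, mem_univ, true_and] at hpq
      exact ⟨p, q, hpq, fun w hw => h0 w ⟨delEdge_le _ _ _ hw.1, hw.2⟩⟩
  have h1 := h.card_matching_bowties_ge ht hd hpq
  have h2 := hH.exchange hpq.1 (fun e => huv (by rw [e])) hn
    (filter_subset (fun t => (t.1 = p ∧ t.2.1.1 = q) ∨ (t.1 = q ∧ t.2.1.1 = p) ∨ t.2.1 = (p, q))
      (bowties H)) (by
      rintro ⟨c, ⟨a, b⟩, ⟨d, e⟩⟩ ht h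
      simp only [mem_filter, mem_bowties, Prod.mk.injEq] at ht h
      rcases ht.2 with ⟨rfl, rfl⟩ | ⟨rfl, rfl⟩ | ⟨rfl, rfl⟩
      · exact (delEdge_adj.1 h.1.1).2 (.inl ⟨rfl, rfl⟩)
      · exact (delEdge_adj.1 h.1.1).2 (.inr ⟨rfl, rfl⟩)
      · exact (delEdge_adj.1 h.1.2.2).2 (.inl ⟨rfl, rfl⟩))
  set G := delEdge H p q with hG
  have hi : inner G χ ≤ inner H χ := fun a b hab => ⟨delEdge_le _ _ _ hab.1, hab.2⟩
  have hiv := vol_mono hi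
  have huniq : ∀ {a b b'}, (inner G χ).Adj a b → (inner G χ).Adj a b' → b = b' := fun {a b b'} h h' =>
    card_le_one.1 (hd a) b (by simpa using hi h) b' (by simpa using hi h')
  have h3 : ∑ z ∈ commonNbrs G u v, (avoid G u v z + avoid G v u z + avoid G z u v) ≤
      3 * vol (inner H χ) := by
    have hvz : ∀ z ∈ commonNbrs G u v, (inner G χ).Adj v z := fun z hz => by
      have := commonNbrs_subset (G := G) huv hz
      simp only [mem_union, mem_filter, mem_univ, true_and] at this
      exact this.resolve_left (hu z)
    refine (sum_le_card_nsmul _ _ (3 * vol (inner H χ)) fun z hz => ?_).trans ?_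
    · have hz' := hvz z hz
      have e1 := avoid_le_vol_inner (G := G) (χ := χ) (c := u) (x := v) (y := z)
        fun w hw => absurd hw (hu w)
      have e2 := avoid_le_vol_inner (G := G) (χ := χ) (c := v) (x := u) (y := z)
        fun w hw => .inr (huniq hw hz')
      have e3 := avoid_le_vol_inner (G := G) (χ := χ) (c := z) (x := u) (y := v)
        fun w hw => .inr (huniq hw hz'.symm)
      omega
    · have : #(commonNbrs G u v) ≤ 1 :=
        card_le_one.2 fun z hz z' hz' => huniq (hvz z hz) (hvz z' hz')
      rw [smul_eq_mul]
      exact (Nat.mul_le_mul_right _ this).trans (by rw [one_mul])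
  obtain ⟨m, hm⟩ : ∃ m, vol (inner H χ) = m + 4 := ⟨vol (inner H χ) - 4, by omega⟩
  rw [hm] at h1 h3
  have h4 : 3 * Fintype.card V * (m + 4 - 2) ≤ 240 * (m + 4) := by omega
  have e : m + 4 - 2 = m + 2 := by omega
  rw [e] at h4
  nlinarith

/-! ### The structure of optimal graphs -/

/-- A graph containing all edges between a set of vertices and its complement is a join, of the graphs
that it induces on them. -/
def isoJoin (H : SimpleGraph V) (P : V → Prop) (h : ∀ u v, P u → ¬ P v → H.Adj u v) :
    join (H.induce {v | P v}) (H.induce {v | ¬ P v}) ≃g H where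
  toEquiv := Equiv.sumCompl P
  map_rel_iff' := by
    rintro (u | u) (v | v)
    · exact Iff.rfl
    · exact iff_of_true (h _ _ u.2 v.2) trivial
    · exact iff_of_true (h _ _ v.2 u.2).symm trivial
    · exact Iff.rfl

lemma card_setOf (P : V → Prop) [DecidablePred P] [Fintype {v | P v}] :
    Fintype.card {v | P v} = #{v | P v} :=
  Fintype.card_of_subtype _ (by simp)

/-- `H` has more than `n ^ 2 / 4` edges, hardly any of which are inner edges, so the classes have almost
equal sizes. -/
lemma NearBip.class_balanced {H : SimpleGraph V} {χ : V → Bool} (h : NearBip H χ) {e : ℕ}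
    (he : vol H = 2 * e) (h4 : Fintype.card V ^ 2 < 4 * e) (b : Bool) :
    100000 * #{v | χ v = b} ≤ 100001 * #{v | χ v = !b} := by
  have h1 := vol_inner_add_vol_cross H χ
  have h2 := vol_cross_add_vol_gaps H χ
  have h3 := card_true_add_card_false χ
  have h5 := h.vol_inner_le
  have key : ∀ a b n : ℕ, a + b = n → 10 ^ 16 * n ^ 2 ≤ 10 ^ 16 * (4 * (a * b)) + 2 * n ^ 2 →
      100000 * a ≤ 100001 * b := by
    rintro a b n rfl h
    by_contra hc
    push Not at hc
    zify at h hc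
    nlinarith
  have h6 : 10 ^ 16 * Fintype.card V ^ 2 ≤
      10 ^ 16 * (4 * (#{v | χ v = true} * #{v | χ v = false})) + 2 * Fintype.card V ^ 2 := by
    omega
  cases b
  · exact key _ _ _ ((add_comm _ _).trans h3) (by rwa [mul_comm #{v | χ v = false}])
  · exact key _ _ _ h3 h6

/-- An optimal graph with slightly more than `n ^ 2 / 4` edges contains a balanced complete bipartite
graph. -/
theorem Opt.exists_balanced {H : SimpleGraph V} (hH : Opt H) {e : ℕ} (he : vol H = 2 * e) {δ : ℝ}
    (hδ : δ ≤ 1 / 10 ^ 82) (hn : 1 ≤ δ * Fintype.card V)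
    (h4 : Fintype.card V ^ 2 < 4 * e) (hE : (e : ℝ) ≤ (1 / 4 + δ) * Fintype.card V ^ 2) :
    ∃ χ : V → Bool, (∀ u v, χ u ≠ χ v → H.Adj u v) ∧
      ∀ b, #{v | χ v = b} ≤ #{v | χ v = !b} + 1 := by
  obtain ⟨χ, hχ⟩ := hH.exists_nearBip he hδ hn h4 hE
  refine ⟨χ, fun u v => hχ.no_gaps hH, fun b => ?_⟩
  have hadj : ∀ u v, χ u = b → ¬ χ v = b → H.Adj u v := fun u v hu hv =>
    hχ.no_gaps hH (by rw [hu]; exact Ne.symm hv)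
  have hc : #{v | ¬ χ v = b} = #{v | χ v = !b} := by
    congr 1; ext v; cases b <;> simp
  have e := isoJoin H (fun v => χ v = b) hadj
  have hJ : Opt (join (H.induce {v | χ v = b}) (H.induce {v | ¬ χ v = b})) := hH.iso e.symm
  have hvj := vol_iso e
  have hvj' := vol_join (H.induce {v | χ v = b}) (H.induce {v | ¬ χ v = b})
  have hbal := hχ.class_balanced he h4 b
  have hge := hχ.class_ge
  have hcard := hχ.card_ge
  have hD := hχ.vol_inner_le
  have hin := vol_inner_add_vol_cross H χ
  have hcr := vol_cross_add_vol_gaps H χ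
  have hsum := card_true_add_card_false χ
  have hg : vol (gaps H χ) = 0 := by
    rw [vol_eq_card, card_eq_zero]
    ext t
    simp only [mem_filter, mem_univ, true_and, gaps_adj, notMem_empty, iff_false, not_and]
    exact fun h h' => h (hχ.no_gaps hH h')
  have hc1 : Fintype.card {v | χ v = b} = #{v | χ v = b} := card_setOf _
  have hc2 : Fintype.card {v | ¬ χ v = b} = #{v | χ v = !b} := (card_setOf _).trans hc
  have hmul : #{v | χ v = true} * #{v | χ v = false} = #{v | χ v = b} * #{v | χ v = !b} := by
    cases b
    · exact mul_comm _ _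
    · rfl
  have hadd : #{v | χ v = b} + #{v | χ v = !b} = Fintype.card V := by
    cases b
    · exact (add_comm _ _).trans hsum
    · exact hsum
  have hge' := hge (!b)
  rw [hc1, hc2, mul_assoc] at hvj'
  have hvol : vol (H.induce {v | χ v = b}) + vol (H.induce {v | ¬ χ v = b}) = vol (inner H χ) := by
    rw [hmul] at hcr
    zify at hcr hin hvj hg ⊢
    linarith
  have hmain := hJ.card_le_of_join
  rw [hc1, hc2, hvol, ← hvj, he, hadd] at hmain
  generalize #{v | χ v = b} = x at *
  generalize #{v | χ v = !b} = y at *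
  generalize vol (inner H χ) = D at *
  generalize Fintype.card V = n at *
  refine hmain (by omega) hbal ?_ (by omega)
  have : (49 * n) ^ 2 ≤ (100 * y) ^ 2 := Nat.pow_le_pow_left hge' 2
  rw [mul_pow, mul_pow] at this
  omega

lemma sum_range_even (n : ℕ) : ∑ i ∈ range n, (if i % 2 = 0 then 1 else 0) = (n + 1) / 2 := by
  induction n with
  | zero => rfl
  | succ n ih =>
    rw [sum_range_succ, ih]
    split_ifs <;> omega

lemma card_even (n : ℕ) : #{i : Fin n | (i : ℕ) % 2 = 0} = (n + 1) / 2 := by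
  rw [card_filter, Fin.sum_univ_eq_sum_range (fun i => if i % 2 = 0 then 1 else 0),
    sum_range_even]

lemma turanGraph_two_isContained (H : SimpleGraph V) (P : V → Prop) [DecidablePred P]
    (h : ∀ u v, P u → ¬ P v → H.Adj u v) (hP : #{v | P v} = (Fintype.card V + 1) / 2) :
    SimpleGraph.turanGraph (Fintype.card V) 2 ⊑ H := by
  have c1 : Fintype.card {i : Fin (Fintype.card V) // (i : ℕ) % 2 = 0} =
      Fintype.card {v // P v} := by
    rw [Fintype.card_subtype, Fintype.card_subtype, card_even, hP]
  have c2 : Fintype.card {i : Fin (Fintype.card V) // ¬ (i : ℕ) % 2 = 0} =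
      Fintype.card {v // ¬ P v} := by
    rw [Fintype.card_subtype_compl, Fintype.card_subtype_compl, c1, Fintype.card_fin]
  obtain ⟨e1⟩ := Fintype.card_eq.1 c1
  obtain ⟨e2⟩ := Fintype.card_eq.1 c2
  set f : Fin (Fintype.card V) → V := fun i =>
    if hi : (i : ℕ) % 2 = 0 then e1 ⟨i, hi⟩ else e2 ⟨i, hi⟩ with hf
  have f1 : ∀ i : Fin (Fintype.card V), ∀ hi : (i : ℕ) % 2 = 0, f i = e1 ⟨i, hi⟩ := fun i hi => dif_pos hi
  have f2 : ∀ i : Fin (Fintype.card V), ∀ hi : ¬ (i : ℕ) % 2 = 0, f i = e2 ⟨i, hi⟩ := fun i hi => dif_neg hi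
  have hPf : ∀ i, P (f i) ↔ (i : ℕ) % 2 = 0 := fun i => by
    by_cases hi : (i : ℕ) % 2 = 0
    · rw [f1 i hi]; exact iff_of_true (e1 _).2 hi
    · rw [f2 i hi]; exact iff_of_false (e2 _).2 hi
  refine ⟨⟨⟨f, fun {i j} hij => ?_⟩, fun i j hij => ?_⟩⟩
  · rw [SimpleGraph.turanGraph_adj] at hij
    by_cases hi : (i : ℕ) % 2 = 0
    · exact h _ _ ((hPf i).2 hi) fun hj => hij (by rw [hi, (hPf j).1 hj])
    · refine (h _ _ ((hPf j).2 (by omega)) fun hi' => hi ((hPf i).1 hi')).symm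
  · replace hij : f i = f j := hij
    by_cases hi : (i : ℕ) % 2 = 0
    · have hj : (j : ℕ) % 2 = 0 := by rwa [← hPf, ← hij, hPf]
      rw [f1 i hi, f1 j hj] at hij
      exact (Subtype.mk.inj (e1.injective (Subtype.ext hij)))
    · have hj : ¬ (j : ℕ) % 2 = 0 := by rwa [← hPf, ← hij, hPf]
      rw [f2 i hi, f2 j hj] at hij
      exact (Subtype.mk.inj (e2.injective (Subtype.ext hij)))

/-- The classes of a balanced colouring have the sizes of the parts of the Turán graph. -/
lemma exists_card_eq_of_balanced {χ : V → Bool} (h : ∀ b, #{v | χ v = b} ≤ #{v | χ v = !b} + 1) :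
    ∃ b, #{v | χ v = b} = (Fintype.card V + 1) / 2 := by
  have h1 := card_true_add_card_false χ
  have h2 : _ ≤ #{v | χ v = false} + 1 := h true
  have h3 : _ ≤ #{v | χ v = true} + 1 := h false
  rcases Nat.lt_or_ge #{v | χ v = true} #{v | χ v = false} with h4 | h4
  · exact ⟨false, by omega⟩
  · exact ⟨true, by omega⟩

lemma turanGraph_isContained_of_balanced {H : SimpleGraph V} {χ : V → Bool}
    (hadj : ∀ u v, χ u ≠ χ v → H.Adj u v) (h : ∀ b, #{v | χ v = b} ≤ #{v | χ v = !b} + 1) :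
    SimpleGraph.turanGraph (Fintype.card V) 2 ⊑ H := by
  obtain ⟨b, hb⟩ := exists_card_eq_of_balanced h
  exact turanGraph_two_isContained H (fun v => χ v = b)
    (fun u v hu hv => hadj u v (by rw [hu]; exact Ne.symm hv)) hb

lemma mul_eq_of_balanced {χ : V → Bool} (h : ∀ b, #{v | χ v = b} ≤ #{v | χ v = !b} + 1) :
    #{v | χ v = true} * #{v | χ v = false} = Fintype.card V ^ 2 / 4 := by
  have h1 := card_true_add_card_false χ
  have h2 : _ ≤ #{v | χ v = false} + 1 := h true
  have h3 : _ ≤ #{v | χ v = true} + 1 := h false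
  rw [← h1]
  generalize #{v | χ v = true} = a at *
  generalize #{v | χ v = false} = b at *
  have : a = b ∨ a = b + 1 ∨ b = a + 1 := by omega
  rcases this with rfl | rfl | rfl
  · have : (a + a) ^ 2 = 4 * (a * a) := by ring
    omega
  · have : (b + 1 + b) ^ 2 = 4 * ((b + 1) * b) + 1 := by ring
    omega
  · have : (a + (a + 1)) ^ 2 = 4 * (a * (a + 1)) + 1 := by ring
    omega

/-! ### The extremal number of the bowtie -/

/-- A complete bipartite graph with one additional edge contains no bowtie. -/
lemma bow_addEdge_cross_top {χ : V → Bool} {p q : V} (hpq : p ≠ q) (hc : χ p = χ q) :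
    bow (addEdge (cross ⊤ χ) p q) = 0 := by
  have hin : inner (cross ⊤ χ) χ = ⊥ := by
    ext a b
    simp only [inner_adj, cross_adj, SimpleGraph.bot_adj, iff_false]
    tauto
  have hbot : vol (inner (cross (⊤ : SimpleGraph V) χ) χ) = 0 := by
    rw [hin]; simp [vol, dg]
  have h0 : bow (cross (⊤ : SimpleGraph V) χ) = 0 := by
    rw [bow, card_eq_zero, eq_empty_iff_forall_notMem]
    intro s hs
    have := two_le_card_inner_of_mem _ χ hs
    simp [hin] at this
  have h1 := bow_addEdge_le hpq (H := cross ⊤ χ) (fun h => h.2 hc)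
  have h2 : ∀ c x y, avoid (cross (⊤ : SimpleGraph V) χ) c x y = 0 := fun c x y => by
    have := avoid_le_vol_inner (G := cross ⊤ χ) (χ := χ) (c := c) (x := x) (y := y)
      fun w hw => by rw [hin] at hw; exact hw.elim
    omega
  simp only [h2, h0] at h1
  simpa using h1

lemma vol_addEdge_cross_top {χ : V → Bool} {p q : V} (hpq : p ≠ q) (hc : χ p = χ q) :
    vol (addEdge (cross ⊤ χ) p q) = 2 * (#{v | χ v = true} * #{v | χ v = false} + 1) := by
  rw [vol_addEdge hpq (fun h => (cross_adj.1 h).2 hc)]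
  have h := vol_cross_add_vol_gaps ⊤ χ
  have : vol (gaps (⊤ : SimpleGraph V) χ) = 0 := by
    rw [vol_eq_card, card_eq_zero]
    ext t
    simp only [mem_filter, mem_univ, true_and, gaps_adj, SimpleGraph.top_adj, notMem_empty,
      iff_false, not_and, not_not]
    intro h
    rw [h]
  omega

/-- Two edges inside the parts of an almost balanced complete bipartite graph yield a bowtie. -/
lemma bow_ne_zero_of_complete {H : SimpleGraph V} {χ : V → Bool}
    (hadj : ∀ u v, χ u ≠ χ v → H.Adj u v) (hc : ∀ b, 5 ≤ #{v | χ v = b})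
    (hv : 4 ≤ vol (inner H χ)) : bow H ≠ 0 := by
  have hadj' : ∀ u v, χ u = true → ¬ χ v = true → H.Adj u v := fun u v hu hv =>
    hadj u v (by rw [hu]; exact Ne.symm hv)
  have e := isoJoin H (fun v => χ v = true) hadj'
  have hb := bow_iso e
  have hvj := vol_iso e
  have hlow := bowPoly_le_bow_join (H.induce {v | χ v = true}) (H.induce {v | ¬ χ v = true})
  have hvj' := vol_join (H.induce {v | χ v = true}) (H.induce {v | ¬ χ v = true})
  have hp := sqDeg_le_sum_sq (H.induce {v | χ v = true}) 0
  have hq := sqDeg_le_sum_sq (H.induce {v | ¬ χ v = true}) 0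
  have hin := vol_inner_add_vol_cross H χ
  have hcr := vol_cross_add_vol_gaps H χ
  have hg : vol (gaps H χ) = 0 := by
    rw [vol_eq_card, card_eq_zero]
    ext t
    simp only [mem_filter, mem_univ, true_and, gaps_adj, notMem_empty, iff_false, not_and]
    exact fun h h' => h (hadj _ _ h')
  have hc1 : Fintype.card {v | χ v = true} = #{v | χ v = true} := card_setOf _
  have hc2 : Fintype.card {v | ¬ χ v = true} = #{v | χ v = false} := (card_setOf _).trans (by simp)
  have ha5 := hc true
  have hb5 := hc false
  obtain ⟨x, hx⟩ : ∃ x, vol (H.induce {v | χ v = true}) = 2 * x := ⟨_, vol_eq_two_mul_ncard _⟩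
  obtain ⟨y, hy⟩ : ∃ y, vol (H.induce {v | ¬ χ v = true}) = 2 * y := ⟨_, vol_eq_two_mul_ncard _⟩
  rw [hc1, hc2, hx, hy] at hvj' hlow
  rw [hc1, hx] at hp
  rw [hc2, hy] at hq
  have hxy : 2 ≤ x + y := by
    zify at hcr hin hvj hg hv ⊢
    push_cast at hvj'
    linarith
  rw [← hb] at *
  intro h0
  rw [h0] at hlow
  generalize ∑ c, (dg (H.induce {v | χ v = true}) c : ℝ) ^ 2 = p at *
  generalize ∑ c, (dg (H.induce {v | ¬ χ v = true}) c : ℝ) ^ 2 = q at *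
  generalize #{v | χ v = true} = a at *
  generalize #{v | χ v = false} = b at *
  have hx2 : ((2 * x : ℕ) : ℝ) / 2 = x := by push_cast; ring
  have hy2 : ((2 * y : ℕ) : ℝ) / 2 = y := by push_cast; ring
  rw [hx2, hy2] at hlow
  rw [hx2] at hp
  rw [hy2] at hq
  have haR : (5 : ℝ) ≤ a := by exact_mod_cast ha5
  have hbR : (5 : ℝ) ≤ b := by exact_mod_cast hb5
  have hp' : 2 * (x : ℝ) ≤ p := by simpa [sqDeg] using hp
  have hq' : 2 * (y : ℝ) ≤ q := by simpa [sqDeg] using hq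
  have h1 : (b : ℝ) * (b - 2) * (2 * x) ≤ b * (b - 2) * p :=
    mul_le_mul_of_nonneg_left hp' (mul_nonneg (by linarith) (by linarith))
  have h2 : (a : ℝ) * (a - 2) * (2 * y) ≤ a * (a - 2) * q :=
    mul_le_mul_of_nonneg_left hq' (mul_nonneg (by linarith) (by linarith))
  have h3 : (b : ℝ) * (x * (x - 1)) + a * (y * (y - 1)) + 4 * (a + b - 4) * (x * y) ≤ 0 := by
    unfold bowPoly at hlow
    push_cast at hlow
    linarith
  have h4 : ∀ z : ℕ, (0 : ℝ) ≤ z * (z - 1) := fun z => by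
    rcases z with _ | z
    · simp
    · push_cast; simp; positivity
  have h5 : (0 : ℝ) < x * (x - 1) + y * (y - 1) + x * y := by
    rcases Nat.lt_or_ge x 1 with hx0 | hx0
    · obtain rfl : x = 0 := by omega
      have : (2 : ℝ) ≤ y := by exact_mod_cast (by omega : 2 ≤ y)
      simp only [Nat.cast_zero]
      nlinarith
    rcases Nat.lt_or_ge y 1 with hy0 | hy0
    · obtain rfl : y = 0 := by omega
      have : (2 : ℝ) ≤ x := by exact_mod_cast (by omega : 2 ≤ x)
      simp only [Nat.cast_zero]
      nlinarith
    · have h6 : (1 : ℝ) ≤ x := by exact_mod_cast hx0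
      have h7 : (1 : ℝ) ≤ y := by exact_mod_cast hy0
      have := h4 x
      have := h4 y
      nlinarith
  have h8 := mul_le_mul_of_nonneg_right hbR (h4 x)
  have h9 := mul_le_mul_of_nonneg_right haR (h4 y)
  have h10 : 5 * ((x : ℝ) * y) ≤ 4 * (a + b - 4) * (x * y) :=
    mul_le_mul_of_nonneg_right (by linarith) (by positivity)
  linarith

lemma exists_le_vol_eq (H : SimpleGraph V) {k : ℕ} (hk : 2 * k ≤ vol H) :
    ∃ H' ≤ H, vol H' = 2 * k := by
  obtain ⟨m, hm⟩ : ∃ m, vol H = 2 * (k + m) := by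
    have := vol_eq_two_mul_ncard H
    exact ⟨vol H / 2 - k, by omega⟩
  induction m generalizing H with
  | zero => exact ⟨H, le_rfl, hm⟩
  | succ m ih =>
    have h0 : vol H ≠ 0 := by omega
    rw [vol_eq_card, card_ne_zero] at h0
    obtain ⟨⟨p, q⟩, hpq⟩ := h0
    simp only [mem_filter, mem_univ, true_and] at hpq
    have := vol_delEdge hpq
    obtain ⟨H', h1, h2⟩ := ih (delEdge H p q) (by omega) (by omega)
    exact ⟨H', h1.trans (delEdge_le _ _ _), h2⟩

lemma ncard_le_extremalNumber {G : SimpleGraph V} (h : bow G = 0) :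
    G.edgeSet.ncard ≤ SimpleGraph.extremalNumber (Fintype.card V) bowtie := by
  have := SimpleGraph.card_edgeFinset_le_extremalNumber (bow_eq_zero_iff.1 h)
  rwa [← SimpleGraph.coe_edgeFinset G, Set.ncard_coe_finset]

lemma sq_div_four_lt_extremalNumber {n : ℕ} (hn : 3 ≤ n) :
    n ^ 2 / 4 + 1 ≤ SimpleGraph.extremalNumber n bowtie := by
  set χ : Fin n → Bool := fun i => decide ((i : ℕ) % 2 = 0) with hχ
  have hne : (⟨0, by omega⟩ : Fin n) ≠ ⟨2, by omega⟩ := by simp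
  have hc : χ ⟨0, by omega⟩ = χ ⟨2, by omega⟩ := by simp [hχ]
  have h1 := ncard_le_extremalNumber (bow_addEdge_cross_top hne hc)
  have h2 := vol_addEdge_cross_top hne hc
  have h3 : #{v | χ v = true} = (n + 1) / 2 := by simpa [hχ] using card_even n
  have h4 := card_true_add_card_false χ
  rw [vol_eq_two_mul_ncard, mul_eq_of_balanced] at h2
  · rw [Fintype.card_fin] at h1 h2
    omega
  · rw [Fintype.card_fin] at h4
    intro b
    cases b <;> simp only [Bool.not_true, Bool.not_false] <;> omega

/-- A bowtie-free graph is optimal, so if it had `n ^ 2 / 4 + 2` edges, it would consist of a balanced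
complete bipartite graph and two inner edges. -/
theorem extremalNumber_bowtie {n : ℕ} (hn : 10 ^ 83 ≤ n) :
    SimpleGraph.extremalNumber n bowtie = n ^ 2 / 4 + 1 := by
  refine le_antisymm ?_ (sq_div_four_lt_extremalNumber (by omega))
  by_contra hcon
  push Not at hcon
  rw [← Fintype.card_fin n, SimpleGraph.lt_extremalNumber_iff, Fintype.card_fin] at hcon
  obtain ⟨G, _, hG, hGe⟩ := hcon
  rw [← bow_eq_zero_iff] at hG
  have hGv : 2 * (n ^ 2 / 4 + 2) ≤ vol G := by
    rw [vol_eq_two_mul_ncard, ← SimpleGraph.coe_edgeFinset G, Set.ncard_coe_finset]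
    have : n ^ 2 / 4 + 1 < #G.edgeFinset := by convert hGe
    omega
  obtain ⟨H, hHG, hHv⟩ := exists_le_vol_eq G hGv
  have hH0 : bow H = 0 := by have := bow_mono hHG; omega
  have hnR : (10 : ℝ) ^ 83 ≤ n := by exact_mod_cast hn
  have hOpt : Opt H := fun H' _ => by rw [hH0]; exact Nat.zero_le _
  obtain ⟨χ, hadj, hbal⟩ := hOpt.exists_balanced hHv (δ := 1 / 10 ^ 82) le_rfl
    (by rw [Fintype.card_fin]; linarith) (by rw [Fintype.card_fin]; omega) (by
      rw [Fintype.card_fin]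
      have h1 : ((n ^ 2 / 4 : ℕ) : ℝ) ≤ (n : ℝ) ^ 2 / 4 := by
        have := Nat.cast_div_le (α := ℝ) (m := n ^ 2) (n := 4)
        push_cast at this
        exact this
      have h2 : (10 : ℝ) ^ 83 * 1 ≤ n * n := by gcongr; linarith
      push_cast at h1 ⊢
      nlinarith)
  refine bow_ne_zero_of_complete hadj (fun b => ?_) ?_ hH0
  · have h1 := card_true_add_card_false χ
    have h2 : _ ≤ #{v | χ v = false} + 1 := hbal true
    have h3 : _ ≤ #{v | χ v = true} + 1 := hbal false
    rw [Fintype.card_fin] at h1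
    cases b <;> omega
  · have h1 := vol_inner_add_vol_cross H χ
    have h2 := vol_cross_add_vol_gaps H χ
    rw [mul_eq_of_balanced hbal, Fintype.card_fin] at h2
    omega

/-! ### Optimal graphs and the supersaturation functions -/

lemma ncard_edgeSet_iso {G : SimpleGraph V} {H : SimpleGraph W} (e : G ≃g H) :
    H.edgeSet.ncard = G.edgeSet.ncard := by
  have := vol_iso e
  rw [vol_eq_two_mul_ncard, vol_eq_two_mul_ncard] at this
  omega

lemma opt_of_isOptimal {H : SimpleGraph V} {q : ℕ} (h : IsOptimal bowtie q H) : Opt H := by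
  intro H' hv
  rw [vol_eq_two_mul_ncard, vol_eq_two_mul_ncard H] at hv
  rw [bow_le_bow_iff, h.2]
  have e : H' ≃g H'.overFin rfl := H'.overFinIso rfl
  refine Nat.sInf_le ⟨H'.overFin rfl, ?_, ?_⟩
  · rw [ncard_edgeSet_iso e, ← h.1]; omega
  · refine le_antisymm (bow_le_bow_iff.1 (bow_iso e).le) (bow_le_bow_iff.1 (bow_iso e).ge)

lemma vol_of_isOptimal {H : SimpleGraph V} {q : ℕ} (h : IsOptimal bowtie q H) :
    vol H = 2 * (SimpleGraph.extremalNumber (Fintype.card V) bowtie + q) := by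
  rw [vol_eq_two_mul_ncard, h.1]

/-- Optimal graphs with few additional edges contain a balanced complete bipartite graph. -/
lemma exists_balanced_of_isOptimal {H : SimpleGraph V} {q : ℕ} (h : IsOptimal bowtie q H)
    (hn : (10 : ℝ) ^ 82 ≤ Fintype.card V)
    (hE : (SimpleGraph.extremalNumber (Fintype.card V) bowtie : ℝ) + q ≤
      (1 / 4 + 1 / 10 ^ 82) * (Fintype.card V : ℝ) ^ 2) :
    ∃ χ : V → Bool, (∀ u v, χ u ≠ χ v → H.Adj u v) ∧
      ∀ b, #{v | χ v = b} ≤ #{v | χ v = !b} + 1 := by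
  have hnN : 10 ^ 82 ≤ Fintype.card V := by exact_mod_cast hn
  have hex := sq_div_four_lt_extremalNumber (n := Fintype.card V) (by omega)
  exact (opt_of_isOptimal h).exists_balanced (vol_of_isOptimal h) le_rfl (by linarith) (by omega)
    (by push_cast; exact hE)

/-- An optimal graph contains a balanced complete bipartite graph together with one more edge. -/
lemma exists_isMaxFree_le {H : SimpleGraph V} {q : ℕ} (h : IsOptimal bowtie q H)
    (hn : 10 ^ 83 ≤ Fintype.card V)
    (hE : (SimpleGraph.extremalNumber (Fintype.card V) bowtie : ℝ) + q ≤
      (1 / 4 + 1 / 10 ^ 82) * (Fintype.card V : ℝ) ^ 2) :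
    ∃ G, IsMaxFree bowtie G ∧ G ≤ H := by
  have hnR : (10 : ℝ) ^ 82 ≤ Fintype.card V := by
    exact_mod_cast (by omega : 10 ^ 82 ≤ Fintype.card V)
  obtain ⟨χ, hadj, hbal⟩ := exists_balanced_of_isOptimal h hnR hE
  have hvol := vol_of_isOptimal h
  rw [extremalNumber_bowtie hn] at hvol
  have h1 := vol_inner_add_vol_cross H χ
  have h2 := vol_cross_add_vol_gaps H χ
  rw [mul_eq_of_balanced hbal] at h2
  have h3 : vol (inner H χ) ≠ 0 := by omega
  rw [vol_eq_card, card_ne_zero] at h3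
  obtain ⟨⟨p, q⟩, hpq⟩ := h3
  simp only [mem_filter, mem_univ, true_and] at hpq
  refine ⟨addEdge (cross ⊤ χ) p q, ⟨?_, ?_⟩, fun a b hab => ?_⟩
  · exact bow_eq_zero_iff.1 (bow_addEdge_cross_top hpq.1.ne hpq.2)
  · have h4 := vol_addEdge_cross_top hpq.1.ne hpq.2
    rw [vol_eq_two_mul_ncard, mul_eq_of_balanced hbal] at h4
    rw [extremalNumber_bowtie hn]
    omega
  · rw [addEdge_adj hpq.1.ne, cross_adj] at hab
    rcases hab with hab | ⟨rfl, rfl⟩ | ⟨rfl, rfl⟩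
    · exact hadj a b hab.2
    · exact hpq.1
    · exact hpq.1.symm

lemma vol_top : vol (⊤ : SimpleGraph V) = Fintype.card V * (Fintype.card V - 1) := by
  rw [vol, sum_congr rfl (g := fun _ => Fintype.card V - 1) fun v _ => ?_, sum_const,
    Finset.card_univ, smul_eq_mul]
  rw [dg, ← Finset.card_univ, ← card_erase_of_mem (mem_univ v)]
  congr 1
  ext w
  simp [ne_comm]

lemma exists_ncard_eq {n e : ℕ} (h : 2 * e ≤ n * (n - 1)) :
    ∃ H : SimpleGraph (Fin n), H.edgeSet.ncard = e := by
  obtain ⟨H, -, hH⟩ := exists_le_vol_eq (⊤ : SimpleGraph (Fin n)) (k := e)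
    (by rwa [vol_top, Fintype.card_fin])
  rw [vol_eq_two_mul_ncard] at hH
  exact ⟨H, by omega⟩

/-- The two supersaturation functions agree as soon as every optimal graph contains a maximum
bowtie-free graph. -/
lemma minCopies_eq_minCopiesAdding {n q : ℕ}
    (hne : ∃ H : SimpleGraph (Fin n), H.edgeSet.ncard = SimpleGraph.extremalNumber n bowtie + q)
    (h : ∀ H : SimpleGraph (Fin n), IsOptimal bowtie q H → ∃ G, IsMaxFree bowtie G ∧ G ≤ H) :
    minCopies bowtie n q = minCopiesAdding bowtie n q := by
  obtain ⟨H₀, hH₀⟩ := hne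
  have hmem := Nat.sInf_mem (s := {k | ∃ H : SimpleGraph (Fin n),
    H.edgeSet.ncard = SimpleGraph.extremalNumber n bowtie + q ∧ H.copyCount bowtie = k})
    ⟨_, H₀, hH₀, rfl⟩
  obtain ⟨H, hH, hHc⟩ := hmem
  obtain ⟨G, hG, hGH⟩ := h H ⟨by rw [Fintype.card_fin, hH], by rw [Fintype.card_fin]; exact hHc⟩
  have hGe := hG.2
  rw [Fintype.card_fin] at hGe
  have hadd : ∃ G H : SimpleGraph (Fin n), IsMaxFree bowtie G ∧ G ≤ H ∧
      H.edgeSet.ncard = G.edgeSet.ncard + q ∧ H.copyCount bowtie = minCopies bowtie n q :=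
    ⟨G, H, hG, hGH, by rw [hH, hGe], hHc⟩
  refine le_antisymm ?_ (Nat.sInf_le hadd)
  obtain ⟨G', H', hG', -, he, hc⟩ := Nat.sInf_mem (s := {k | ∃ G H : SimpleGraph (Fin n),
    IsMaxFree bowtie G ∧ G ≤ H ∧ H.edgeSet.ncard = G.edgeSet.ncard + q ∧ H.copyCount bowtie = k})
    ⟨_, hadd⟩
  have hG'e := hG'.2
  rw [Fintype.card_fin] at hG'e
  exact Nat.sInf_le ⟨H', by rw [he, hG'e], hc⟩

/-- For `q = o(n ^ 2)`, the number of edges is eventually in the range where optimal graphs are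
understood. -/
lemma eventually_extremalNumber_add_le {q : ℕ → ℕ}
    (hq : (fun n : ℕ => (q n : ℝ)) =o[atTop] (fun n : ℕ => (n : ℝ) ^ 2)) :
    ∀ᶠ n : ℕ in atTop, 10 ^ 83 ≤ n ∧ (SimpleGraph.extremalNumber n bowtie : ℝ) + q n ≤
      (1 / 4 + 1 / 10 ^ 82) * (n : ℝ) ^ 2 := by
  filter_upwards [hq.def (c := 1 / 10 ^ 83) (by positivity), eventually_ge_atTop (10 ^ 83)]
    with n h1 h2
  refine ⟨h2, ?_⟩
  rw [Real.norm_of_nonneg (Nat.cast_nonneg _), Real.norm_of_nonneg (by positivity)] at h1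
  rw [extremalNumber_bowtie h2]
  have h3 : ((n ^ 2 / 4 : ℕ) : ℝ) ≤ (n : ℝ) ^ 2 / 4 := by
    have := Nat.cast_div_le (α := ℝ) (m := n ^ 2) (n := 4)
    push_cast at this
    exact this
  have hnR : (10 : ℝ) ^ 83 ≤ n := by exact_mod_cast h2
  have h4 : (10 : ℝ) ^ 83 * 1 ≤ n * n := by gcongr; linarith
  push_cast at h3 ⊢
  linarith

end

end BowtieSupersat

theorem theorem1 :
    (∃ δ : ℝ, 0 < δ ∧
      ∀ (V : Type*) [Fintype V] (n q : ℕ) (H : SimpleGraph V),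
        Fintype.card V = n → 1 / δ ≤ (n : ℝ) →
        (SimpleGraph.extremalNumber n bowtie : ℝ) + q ≤ (1 / 4 + δ) * (n : ℝ) ^ 2 →
        IsOptimal bowtie q H →
        SimpleGraph.turanGraph n 2 ⊑ H) ∧
    (∀ q : ℕ → ℕ, (fun n : ℕ => (q n : ℝ)) =o[atTop] (fun n : ℕ => (n : ℝ) ^ 2) →
      ∀ᶠ n : ℕ in atTop,
        minCopies bowtie n (q n) = minCopiesAdding bowtie n (q n) ∧
        ∀ (V : Type*) [Fintype V] (H : SimpleGraph V),
          Fintype.card V = n → IsOptimal bowtie (q n) H →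
          ∃ G : SimpleGraph V, IsMaxFree bowtie G ∧ G ≤ H) := by
  constructor
  · refine ⟨1 / 10 ^ 82, by positivity, ?_⟩
    rintro V _ n q H rfl hn hE hH
    rw [one_div_one_div] at hn
    obtain ⟨χ, hadj, hbal⟩ := BowtieSupersat.exists_balanced_of_isOptimal hH hn hE
    exact BowtieSupersat.turanGraph_isContained_of_balanced hadj hbal
  · intro q hq
    filter_upwards [BowtieSupersat.eventually_extremalNumber_add_le hq] with n hn
    refine ⟨BowtieSupersat.minCopies_eq_minCopiesAdding (BowtieSupersat.exists_ncard_eq ?_)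
      fun H hH => BowtieSupersat.exists_isMaxFree_le hH (by rw [Fintype.card_fin]; exact hn.1)
        (by rw [Fintype.card_fin]; exact hn.2), ?_⟩
    · have hnR : (10 : ℝ) ^ 83 ≤ n := by exact_mod_cast hn.1
      have h1 : ((2 * (SimpleGraph.extremalNumber n bowtie + q n) : ℕ) : ℝ) ≤
          ((n * (n - 1) : ℕ) : ℝ) := by
        rw [Nat.cast_mul n, Nat.cast_sub (le_trans (by norm_num) hn.1)]
        push_cast
        nlinarith [hn.2]
      exact_mod_cast h1
    · rintro V _ H rfl hH
      exact BowtieSupersat.exists_isMaxFree_le hH hn.1 hn.2
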